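/- **Theorem 2.** Let $L>0$, let $A=-\partial_{xx}$ in the complex space $L^2(0,L)$ with domain $D(A)=H^2(0,L)\cap H^1_0(0,L)$, and let $A^\nu$ ($\nu\ge 0$) be its fractional powers, so that $D(A^{1/2})=H^1_0(0,L)$. Let $\tau,\sigma,\xi\in[0,1]$, let $\rho_1,\rho_2,\rho_3,\kappa,b,\delta,\beta,\gamma,\mu_1,\mu_2,K>0$ and $\mu\in\mathbb R$. Put $\mathcal H=[D(A^{1/2})\times L^2(0,L)]^3$, and for $U=(\phi,\Phi,\psi,\Psi,\theta,\Theta)$ in $$D(\mathcal B_1)=D(\mathcal B_2)=D(A)\times [D(A^{1/2})\cap D(A^\tau)]\times D(A)\times [D(A^{1/2})\cap D(A^\sigma)]\times D(A)\times [D(A^{1/2})\cap D(A^\xi)]$$ put $$\mathcal B_1U=\Bigl(\Phi,\ \tfrac1{\rho_1}[\kappa(\phi_x+\psi)_x-\mu_1A^\tau\Phi],\ \Psi,\ -\tfrac1{\rho_2}[bA\psi+\kappa(\phi_x+\psi)+\beta\Theta_x+\mu_2A^\sigma\Psi],\ \Theta,\ -\tfrac1{\rho_3}[\delta A\theta+\gamma\Psi_x+KA^\xi\Theta]\Bigr),$$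 $$\mathcal B_2U=\Bigl(\Phi,\ \tfrac1{\rho_1}[\kappa(\phi_x+\psi)_x-\mu\Theta_x-\mu_1A^\tau\Phi],\ \Psi,\ \tfrac1{\rho_2}[-bA\psi-\kappa(\phi_x+\psi)+\mu\Theta-\mu_2A^\sigma\Psi],\ \Theta,\ \tfrac1{\rho_3}[-\delta A\theta-\mu(\Phi_x+\Psi)-\gamma A^\xi\Theta]\Bigr).$$ Let $i\in\{1,2\}$. For every $U_0\in\mathcal H$ there is a unique weak solution $U\in C([0,\infty),\mathcal H)$ of $$\frac{d}{dt}U(t)=\mathcal B_iU(t)\quad(t\ge 0),\qquad U(0)=U_0,$$ that is, a unique $U\in C([0,\infty),\mathcal H)$ with $U(0)=U_0$ such that for every $\ell\in D(\mathcal B_i^*)$ the function $t\mapsto\langle U(t),\ell\rangle$ is differentiable on $[0,\infty)$ with derivative $\langle U(t),\mathcal B_i^*\ell\rangle$. Furthermore, if $k\in\mathbb N$ (including $k=0$) and $U_0\in D(\mathcal B_i^k)$, then $$U\in\bigcap_{j=0}^kC^{k-j}\bigl([0,\infty),D(\mathcal B_i^j)\bigr),$$ where $D(\mathcal B_i^j)$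 carries the graph norm $\sum_{l=0}^j\|\mathcal B_i^l\,\cdot\,\|_{\mathcal H}$. -/

import Mathlib

open MeasureTheory Set
open scoped ContDiff InnerProductSpace

noncomputable section

namespace Timoshenko

/-! ### Sobolev spaces on the interval `(0, L)` -/

/-- The complex Hilbert space `L²(0, L)`. -/
abbrev L2 (L : ℝ) : Type := Lp ℂ 2 (volume.restrict (Ioo 0 L))

/-- Test functions: complex-valued, smooth, with compact support in `(0, L)`. -/
structure TestFn (L : ℝ) where
  toFun : ℝ → ℂ
  smooth : ContDiff ℝ ∞ toFun
  compact : HasCompactSupport toFun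
  supp : tsupport toFun ⊆ Ioo 0 L

theorem TestFn.memLp {L : ℝ} (η : TestFn L) :
    MemLp η.toFun 2 (volume.restrict (Ioo 0 L)) :=
  η.smooth.continuous.memLp_of_hasCompactSupport η.compact

theorem TestFn.memLp_deriv {L : ℝ} (η : TestFn L) :
    MemLp (deriv η.toFun) 2 (volume.restrict (Ioo 0 L)) :=
  (η.smooth.continuous_deriv (by simp)).memLp_of_hasCompactSupport η.compact.deriv

/-- A test function as an element of `L²(0, L)`. -/
def TestFn.fn {L : ℝ} (η : TestFn L) : L2 L := η.memLp.toLp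

/-- The derivative of a test function as an element of `L²(0, L)`. -/
def TestFn.dx {L : ℝ} (η : TestFn L) : L2 L := η.memLp_deriv.toLp

/-- The pairs `(u, v)` in `L²(0, L)²` such that `v` is the weak derivative of `u`:
`∫ u η' = - ∫ v η` for all test functions `η` (written with the inner product of `L²`, which
conjugates `η`; the conjugate of a test function is a test function). -/
def weakDerivGraph (L : ℝ) : Submodule ℂ (L2 L × L2 L) where
  carrier := {p | ∀ η : TestFn L, ⟪η.dx, p.1⟫_ℂ = -⟪η.fn, p.2⟫_ℂ}
  add_mem' {p q} hp hq η := by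
    simp only [Prod.fst_add, Prod.snd_add, inner_add_right, hp η, hq η]; ring
  zero_mem' η := by simp
  smul_mem' c p hp η := by
    simp only [Prod.smul_fst, Prod.smul_snd, inner_smul_right, hp η]; ring

/-- The weak derivative is unique. -/
theorem weakDerivGraph_unique (L : ℝ) (p : L2 L × L2 L) (hp : p ∈ weakDerivGraph L)
    (h0 : p.1 = 0) : p.2 = 0 := by
  have key : ∀ g : ℝ → ℝ, ContDiff ℝ ∞ g → HasCompactSupport g → tsupport g ⊆ Ioo 0 L →
      ∫ x, g x • (p.2 : ℝ → ℂ) x ∂(volume.restrict (Ioo 0 L)) = 0 := by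
    intro g hg hc hs
    have hsub : Function.support (fun x => (g x : ℂ)) = Function.support g := by
      ext x; simp
    let η : TestFn L :=
      { toFun := fun x => (g x : ℂ)
        smooth := Complex.ofRealCLM.contDiff.comp hg
        compact := by
          unfold HasCompactSupport tsupport; rw [hsub]; exact hc
        supp := by
          unfold tsupport; rw [hsub]; exact hs }
    have h := hp η
    rw [h0, inner_zero_right, eq_comm, neg_eq_zero, L2.inner_def] at h
    rw [← h]
    refine integral_congr_ae ?_
    filter_upwards [η.memLp.coeFn_toLp] with x hx
    have : (η.fn : ℝ → ℂ) x = (g x : ℂ) := hx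
    rw [this]
    simp [mul_comm]
  have hloc : LocallyIntegrableOn (p.2 : ℝ → ℂ) (Ioo 0 L) (volume.restrict (Ioo 0 L)) := by
    have : IsFiniteMeasure (volume.restrict (Ioo (0 : ℝ) L)) := ⟨by simp⟩
    exact ((Lp.memLp p.2).integrable (by norm_num)).integrableOn.locallyIntegrableOn
  have h := isOpen_Ioo.ae_eq_zero_of_integral_contDiff_smul_eq_zero hloc key
  refine (Lp.eq_zero_iff_ae_eq_zero).2 ?_
  filter_upwards [h, ae_restrict_mem measurableSet_Ioo] with x hx hm
  exact hx hm

/-- The weak derivative `∂ₓ` as an operator in `L²(0, L)`, with domain `H¹(0, L)`. -/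
def weakDeriv (L : ℝ) : L2 L →ₗ.[ℂ] L2 L := (weakDerivGraph L).toLinearPMap

theorem weakDeriv_graph (L : ℝ) : (weakDeriv L).graph = weakDerivGraph L :=
  Submodule.toLinearPMap_graph_eq _ (weakDerivGraph_unique L)

/-- `C_c^∞(0, L)`, embedded in `L² × L²` by `η ↦ (η, η')`. -/
def testGraph (L : ℝ) : Submodule ℂ (L2 L × L2 L) :=
  Submodule.span ℂ (Set.range fun η : TestFn L => (η.fn, η.dx))

/-- `H¹₀(0, L)`, the closure of `C_c^∞(0, L)` in the norm of `H¹(0, L)`. An element is stored as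
the pair consisting of the function and its derivative. By Poincaré's inequality its
norm is equivalent to `‖∂ₓ u‖ = ‖A^{1/2} u‖`. -/
def H01 (L : ℝ) : Type := ↥(testGraph L).topologicalClosure

instance (L : ℝ) : NormedAddCommGroup (H01 L) :=
  inferInstanceAs (NormedAddCommGroup ↥(testGraph L).topologicalClosure)

instance (L : ℝ) : NormedSpace ℂ (H01 L) :=
  inferInstanceAs (NormedSpace ℂ ↥(testGraph L).topologicalClosure)

instance (L : ℝ) : CompleteSpace (H01 L) :=
  (Submodule.isClosed_topologicalClosure (testGraph L)).completeSpace_coe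

/-- The function underlying an element of `H¹₀(0, L)`. -/
def H01.fn (L : ℝ) : H01 L →ₗ[ℂ] L2 L where
  toFun u := u.1.1
  map_add' _ _ := rfl
  map_smul' _ _ := rfl

/-- The derivative of an element of `H¹₀(0, L)`. -/
def H01.dx (L : ℝ) : H01 L →ₗ[ℂ] L2 L where
  toFun u := u.1.2
  map_add' _ _ := rfl
  map_smul' _ _ := rfl

theorem TestFn.inner_dx {L : ℝ} (η ζ : TestFn L) :
    ⟪η.dx, ζ.fn⟫_ℂ = -⟪η.fn, ζ.dx⟫_ℂ := by
  have hvan : ∀ (f : TestFn L) (x : ℝ), x ∉ Ioo 0 L → f.toFun x = 0 := fun f x hx =>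
    image_eq_zero_of_notMem_tsupport fun h => hx (f.supp h)
  have hd : ∀ (f : TestFn L) (x : ℝ), HasDerivAt f.toFun (deriv f.toFun x) x := fun f x =>
    ((f.smooth.differentiable (by simp)) x).hasDerivAt
  have hcd : ∀ f : TestFn L, Continuous (deriv f.toFun) := fun f =>
    f.smooth.continuous_deriv (by simp)
  have hcs : HasCompactSupport (fun x => star (η.toFun x)) :=
    η.compact.comp_left (g := star) (by simp)
  have hcs' : HasCompactSupport (fun x => star (deriv η.toFun x)) :=
    η.compact.deriv.comp_left (g := star) (by simp)
  have hibp := integral_mul_deriv_eq_deriv_mul_of_integrable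
    (u := fun x => star (η.toFun x)) (u' := fun x => star (deriv η.toFun x))
    (v := ζ.toFun) (v' := deriv ζ.toFun)
    (fun x _ => (hd η x).star) (fun x _ => hd ζ x)
    (((continuous_star.comp η.smooth.continuous).mul (hcd ζ)).integrable_of_hasCompactSupport
      hcs.mul_right)
    (((continuous_star.comp (hcd η)).mul ζ.smooth.continuous).integrable_of_hasCompactSupport
      hcs'.mul_right)
    (((continuous_star.comp η.smooth.continuous).mul
      ζ.smooth.continuous).integrable_of_hasCompactSupport hcs.mul_right)
  have e1 : ⟪η.dx, ζ.fn⟫_ℂ = ∫ x, star (deriv η.toFun x) * ζ.toFun x := by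
    have hset : ∫ x in Ioo 0 L, star (deriv η.toFun x) * ζ.toFun x = ∫ x, star (deriv η.toFun x) * ζ.toFun x :=
      setIntegral_eq_integral_of_forall_compl_eq_zero fun x hx => by rw [hvan ζ x hx, mul_zero]
    rw [L2.inner_def, ← hset]
    refine integral_congr_ae ?_
    filter_upwards [η.memLp_deriv.coeFn_toLp, ζ.memLp.coeFn_toLp] with x h1 h2
    have h1' : (η.dx : ℝ → ℂ) x = deriv η.toFun x := h1
    have h2' : (ζ.fn : ℝ → ℂ) x = ζ.toFun x := h2
    rw [h1', h2']; simp [mul_comm]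
  have e2 : ⟪η.fn, ζ.dx⟫_ℂ = ∫ x, star (η.toFun x) * deriv ζ.toFun x := by
    have hset : ∫ x in Ioo 0 L, star (η.toFun x) * deriv ζ.toFun x = ∫ x, star (η.toFun x) * deriv ζ.toFun x :=
      setIntegral_eq_integral_of_forall_compl_eq_zero fun x hx => by rw [hvan η x hx, star_zero, zero_mul]
    rw [L2.inner_def, ← hset]
    refine integral_congr_ae ?_
    filter_upwards [η.memLp.coeFn_toLp, ζ.memLp_deriv.coeFn_toLp] with x h1 h2
    have h1' : (η.fn : ℝ → ℂ) x = η.toFun x := h1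
    have h2' : (ζ.dx : ℝ → ℂ) x = deriv ζ.toFun x := h2
    rw [h1', h2']; simp [mul_comm]
  rw [e1, e2, hibp, neg_neg]

/-- `H¹₀(0, L)` is contained in `H¹(0, L)`, with the same derivative. -/
theorem H01.mem_weakDerivGraph {L : ℝ} (u : H01 L) : (H01.fn L u, H01.dx L u) ∈ weakDerivGraph L := by
  have hclosed : IsClosed (weakDerivGraph L : Set (L2 L × L2 L)) := by
    have : (weakDerivGraph L : Set (L2 L × L2 L)) =
        ⋂ η : TestFn L, {p | ⟪η.dx, p.1⟫_ℂ = -⟪η.fn, p.2⟫_ℂ} := by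
      ext p; simp only [Set.mem_iInter]; rfl
    rw [this]
    exact isClosed_iInter fun η => isClosed_eq (by fun_prop) (by fun_prop)
  have hle : (testGraph L).topologicalClosure ≤ weakDerivGraph L := by
    refine Submodule.topologicalClosure_minimal _ (Submodule.span_le.2 ?_) hclosed
    rintro _ ⟨ζ, rfl⟩ η
    exact η.inner_dx ζ
  exact hle u.2

theorem H01.fn_injective (L : ℝ) : Function.Injective (H01.fn L) := by
  refine (injective_iff_map_eq_zero _).2 fun u hu => ?_
  have h := weakDerivGraph_unique L _ u.mem_weakDerivGraph hu
  exact Subtype.ext (Prod.ext hu h)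

theorem H01.fn_mem {L : ℝ} (u : H01 L) : H01.fn L u ∈ (weakDeriv L).domain :=
  LinearPMap.mem_domain_of_mem_graph (by rw [weakDeriv_graph]; exact u.mem_weakDerivGraph)

theorem weakDeriv_apply_fn {L : ℝ} (u : H01 L) :
    weakDeriv L ⟨H01.fn L u, u.fn_mem⟩ = H01.dx L u := by
  have h : (H01.fn L u, H01.dx L u) ∈ (weakDeriv L).graph := by
    rw [weakDeriv_graph]; exact u.mem_weakDerivGraph
  obtain ⟨y, hy1, hy2⟩ := (LinearPMap.mem_graph_iff _).1 h
  have hy : (⟨H01.fn L u, u.fn_mem⟩ : (weakDeriv L).domain) = y := Subtype.ext hy1.symm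
  rw [hy]; exact hy2

/-- `H¹₀(0, L)` as a subspace of `L²(0, L)`. -/
def h01Space (L : ℝ) : Submodule ℂ (L2 L) := LinearMap.range (H01.fn L)

/-- `H²(0, L)` as a subspace of `L²(0, L)`: functions in `H¹` with derivative in `H¹`. -/
def h2Space (L : ℝ) : Submodule ℂ (L2 L) :=
  ((weakDeriv L).domain.comap (weakDeriv L).toFun).map (weakDeriv L).domain.subtype

theorem h2Space_le (L : ℝ) : h2Space L ≤ (weakDeriv L).domain :=
  Submodule.map_subtype_le _ _

/-! ### Operators -/

/-- The composition `x ↦ T (f x)` of a partially defined operator `T` with an everywhere defined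
linear map `f` taking values in the domain of `T`. -/
def applyOn {D E F : Type*} [AddCommGroup D] [Module ℂ D] [AddCommGroup E] [Module ℂ E]
    [AddCommGroup F] [Module ℂ F] (T : E →ₗ.[ℂ] F) (f : D →ₗ[ℂ] E) (h : ∀ x, f x ∈ T.domain) :
    D →ₗ[ℂ] F :=
  T.toFun.comp (f.codRestrict T.domain h)

theorem weakDeriv_mem_of_h2 {L : ℝ} {u : L2 L} (hu : u ∈ h2Space L) :
    weakDeriv L ⟨u, h2Space_le L hu⟩ ∈ (weakDeriv L).domain := by
  obtain ⟨y, hy, rfl⟩ := hu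
  exact hy

/-- The operator `A = -∂ₓₓ` in `L²(0, L)` with domain `D(A) = H²(0, L) ∩ H¹₀(0, L)`. -/
def opA (L : ℝ) : L2 L →ₗ.[ℂ] L2 L where
  domain := h2Space L ⊓ h01Space L
  toFun := -applyOn (weakDeriv L)
    (applyOn (weakDeriv L) (h2Space L ⊓ h01Space L).subtype fun u => h2Space_le L u.2.1)
    fun u => weakDeriv_mem_of_h2 u.2.1

/-- The (closed) eigenspace `{e | T e = r e}` of a partially defined operator. -/
def eigenspace {E : Type*} [NormedAddCommGroup E] [InnerProductSpace ℂ E] (T : E →ₗ.[ℂ] E)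
    (r : ℝ) : Submodule ℂ E :=
  (T.graph.comap (LinearMap.id.prod ((r : ℂ) • LinearMap.id))).topologicalClosure

instance {E : Type*} [NormedAddCommGroup E] [InnerProductSpace ℂ E] [CompleteSpace E]
    (T : E →ₗ.[ℂ] E) (r : ℝ) : CompleteSpace (eigenspace T r) :=
  (Submodule.isClosed_topologicalClosure _).completeSpace_coe

/-- The power `T ^ ν` of a positive self-adjoint operator `T` with compact inverse, by its spectral
decomposition: `T ^ ν u = ∑ r ^ ν P_r u` over the eigenvalues `r` of `T`, where `P_r` is the
orthogonal projection onto the eigenspace of `r` (it vanishes if `r` is not an eigenvalue). The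
domain consists of those `u` for which the (orthogonal) series converges. -/
def opPow {E : Type*} [NormedAddCommGroup E] [InnerProductSpace ℂ E] [CompleteSpace E]
    (T : E →ₗ.[ℂ] E) (ν : ℝ) : E →ₗ.[ℂ] E where
  domain :=
    { carrier := {u | Summable fun r : ℝ => ((r ^ ν : ℝ) : ℂ) • (eigenspace T r).starProjection u}
      add_mem' := fun {u v} hu hv => by
        have := Summable.add hu hv
        simpa only [Set.mem_ofPred_eq, map_add, smul_add] using this
      zero_mem' := by simp [summable_zero]
      smul_mem' := fun c u hu => by
        have := Summable.const_smul c hu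
        simpa only [Set.mem_ofPred_eq, map_smul, smul_comm c] using this }
  toFun :=
    { toFun := fun u =>
        ∑' r : ℝ, ((r ^ ν : ℝ) : ℂ) • (eigenspace T r).starProjection (u : E)
      map_add' := fun u v => by
        rw [← Summable.tsum_add u.2 v.2]
        simp only [Submodule.coe_add, map_add, smul_add]
      map_smul' := fun c u => by
        rw [RingHom.id_apply, ← Summable.tsum_const_smul c u.2]
        simp only [Submodule.coe_smul, map_smul, smul_comm c] }

/-! ### Energy space and the two operators -/

/-- The energy space `[D(A^{1/2}) × L²(0, L)]³`, with `D(A^{1/2}) = H¹₀(0, L)`; its elements are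
`U = (φ, Φ, ψ, Ψ, θ, Θ)`. -/
def Energy (L : ℝ) : Type := H01 L × L2 L × H01 L × L2 L × H01 L × L2 L

instance (L : ℝ) : NormedAddCommGroup (Energy L) :=
  inferInstanceAs (NormedAddCommGroup (H01 L × L2 L × H01 L × L2 L × H01 L × L2 L))

instance (L : ℝ) : NormedSpace ℂ (Energy L) :=
  inferInstanceAs (NormedSpace ℂ (H01 L × L2 L × H01 L × L2 L × H01 L × L2 L))

instance (L : ℝ) : CompleteSpace (Energy L) :=
  inferInstanceAs (CompleteSpace (H01 L × L2 L × H01 L × L2 L × H01 L × L2 L))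

namespace Energy

variable (L : ℝ)

/-- The component `φ`. -/
def phi : Energy L →ₗ[ℂ] H01 L where
  toFun U := U.1
  map_add' _ _ := rfl
  map_smul' _ _ := rfl

/-- The component `Φ`. -/
def phiT : Energy L →ₗ[ℂ] L2 L where
  toFun U := U.2.1
  map_add' _ _ := rfl
  map_smul' _ _ := rfl

/-- The component `ψ`. -/
def psi : Energy L →ₗ[ℂ] H01 L where
  toFun U := U.2.2.1
  map_add' _ _ := rfl
  map_smul' _ _ := rfl

/-- The component `Ψ`. -/
def psiT : Energy L →ₗ[ℂ] L2 L where
  toFun U := U.2.2.2.1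
  map_add' _ _ := rfl
  map_smul' _ _ := rfl

/-- The component `θ`. -/
def theta : Energy L →ₗ[ℂ] H01 L where
  toFun U := U.2.2.2.2.1
  map_add' _ _ := rfl
  map_smul' _ _ := rfl

/-- The component `Θ`. -/
def thetaT : Energy L →ₗ[ℂ] L2 L where
  toFun U := U.2.2.2.2.2
  map_add' _ _ := rfl
  map_smul' _ _ := rfl

/-- The linear map with the six given components. -/
def ofComponents {D : Type*} [AddCommGroup D] [Module ℂ D] (f₁ : D →ₗ[ℂ] H01 L)
    (f₂ : D →ₗ[ℂ] L2 L) (f₃ : D →ₗ[ℂ] H01 L) (f₄ : D →ₗ[ℂ] L2 L) (f₅ : D →ₗ[ℂ] H01 L)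
    (f₆ : D →ₗ[ℂ] L2 L) : D →ₗ[ℂ] Energy L where
  toFun x := (f₁ x, f₂ x, f₃ x, f₄ x, f₅ x, f₆ x)
  map_add' x y := by simp only [map_add]; rfl
  map_smul' c x := by simp only [map_smul]; rfl

end Energy

/-- The common domain
`D(A) × (D(A^{1/2}) ∩ D(A^τ)) × D(A) × (D(A^{1/2}) ∩ D(A^σ)) × D(A) × (D(A^{1/2}) ∩ D(A^ξ))`
of the two operators. -/
def domB (L τ σ ξ : ℝ) : Submodule ℂ (Energy L) :=
  (opA L).domain.comap (H01.fn L ∘ₗ Energy.phi L) ⊓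
  (h01Space L ⊓ (opPow (opA L) τ).domain).comap (Energy.phiT L) ⊓
  (opA L).domain.comap (H01.fn L ∘ₗ Energy.psi L) ⊓
  (h01Space L ⊓ (opPow (opA L) σ).domain).comap (Energy.psiT L) ⊓
  (opA L).domain.comap (H01.fn L ∘ₗ Energy.theta L) ⊓
  (h01Space L ⊓ (opPow (opA L) ξ).domain).comap (Energy.thetaT L)

namespace domB

variable (L τ σ ξ : ℝ)

/-- The component `φ` as an element of `H¹₀`. -/
def phi : domB L τ σ ξ →ₗ[ℂ] H01 L := Energy.phi L ∘ₗ (domB L τ σ ξ).subtype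

/-- The component `ψ` as an element of `H¹₀`. -/
def psi : domB L τ σ ξ →ₗ[ℂ] H01 L := Energy.psi L ∘ₗ (domB L τ σ ξ).subtype

/-- The component `θ` as an element of `H¹₀`. -/
def theta : domB L τ σ ξ →ₗ[ℂ] H01 L := Energy.theta L ∘ₗ (domB L τ σ ξ).subtype

/-- An element of `L²` that lies in `H¹₀`, as an element of `H¹₀`. -/
def liftH01 : h01Space L →ₗ[ℂ] H01 L :=
  (LinearEquiv.ofInjective (H01.fn L) (H01.fn_injective L)).symm.toLinearMap

/-- The component `Φ` as an element of `H¹₀`. -/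
def phiT : domB L τ σ ξ →ₗ[ℂ] H01 L :=
  liftH01 L ∘ₗ (Energy.phiT L ∘ₗ (domB L τ σ ξ).subtype).codRestrict (h01Space L)
    fun U => U.2.1.1.1.1.2.1

/-- The component `Ψ` as an element of `H¹₀`. -/
def psiT : domB L τ σ ξ →ₗ[ℂ] H01 L :=
  liftH01 L ∘ₗ (Energy.psiT L ∘ₗ (domB L τ σ ξ).subtype).codRestrict (h01Space L)
    fun U => U.2.1.1.2.1

/-- The component `Θ` as an element of `H¹₀`. -/
def thetaT : domB L τ σ ξ →ₗ[ℂ] H01 L :=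
  liftH01 L ∘ₗ (Energy.thetaT L ∘ₗ (domB L τ σ ξ).subtype).codRestrict (h01Space L)
    fun U => U.2.2.1

theorem fn_liftH01 (u : h01Space L) : H01.fn L (liftH01 L u) = u :=
  congrArg Subtype.val
    ((LinearEquiv.ofInjective (H01.fn L) (H01.fn_injective L)).apply_symm_apply u)

/-- `U ↦ A ψ`. -/
def aPsi : domB L τ σ ξ →ₗ[ℂ] L2 L :=
  applyOn (D := domB L τ σ ξ) (opA L) (H01.fn L ∘ₗ psi L τ σ ξ) fun U => U.2.1.1.1.2

/-- `U ↦ A θ`. -/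
def aTheta : domB L τ σ ξ →ₗ[ℂ] L2 L :=
  applyOn (D := domB L τ σ ξ) (opA L) (H01.fn L ∘ₗ theta L τ σ ξ) fun U => U.2.1.2

/-- `U ↦ A^τ Φ`. -/
def powPhiT : domB L τ σ ξ →ₗ[ℂ] L2 L :=
  applyOn (D := domB L τ σ ξ) (opPow (opA L) τ) (Energy.phiT L ∘ₗ (domB L τ σ ξ).subtype) fun U => U.2.1.1.1.1.2.2

/-- `U ↦ A^σ Ψ`. -/
def powPsiT : domB L τ σ ξ →ₗ[ℂ] L2 L :=
  applyOn (D := domB L τ σ ξ) (opPow (opA L) σ) (Energy.psiT L ∘ₗ (domB L τ σ ξ).subtype) fun U => U.2.1.1.2.2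

/-- `U ↦ A^ξ Θ`. -/
def powThetaT : domB L τ σ ξ →ₗ[ℂ] L2 L :=
  applyOn (D := domB L τ σ ξ) (opPow (opA L) ξ) (Energy.thetaT L ∘ₗ (domB L τ σ ξ).subtype) fun U => U.2.2.2

/-- `U ↦ φₓ + ψ`. -/
def shear : domB L τ σ ξ →ₗ[ℂ] L2 L :=
  H01.dx L ∘ₗ phi L τ σ ξ + H01.fn L ∘ₗ psi L τ σ ξ

theorem shear_mem (U : domB L τ σ ξ) : shear L τ σ ξ U ∈ (weakDeriv L).domain := by
  refine Submodule.add_mem _ ?_ (H01.fn_mem _)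
  have h : H01.fn L (phi L τ σ ξ U) ∈ h2Space L := U.2.1.1.1.1.1.1
  have h' := weakDeriv_mem_of_h2 h
  rwa [weakDeriv_apply_fn] at h'

/-- `U ↦ (φₓ + ψ)ₓ`. -/
def shearX : domB L τ σ ξ →ₗ[ℂ] L2 L :=
  applyOn (D := domB L τ σ ξ) (weakDeriv L) (shear L τ σ ξ) (shear_mem L τ σ ξ)

/-- `U ↦ Φₓ`. -/
def phiTX : domB L τ σ ξ →ₗ[ℂ] L2 L := H01.dx L ∘ₗ phiT L τ σ ξ

/-- `U ↦ Ψₓ`. -/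
def psiTX : domB L τ σ ξ →ₗ[ℂ] L2 L := H01.dx L ∘ₗ psiT L τ σ ξ

/-- `U ↦ Θₓ`. -/
def thetaTX : domB L τ σ ξ →ₗ[ℂ] L2 L := H01.dx L ∘ₗ thetaT L τ σ ξ

/-- `U ↦ Ψ` with values in `L²`. -/
def psiT' : domB L τ σ ξ →ₗ[ℂ] L2 L := Energy.psiT L ∘ₗ (domB L τ σ ξ).subtype

/-- `U ↦ Θ` with values in `L²`. -/
def thetaT' : domB L τ σ ξ →ₗ[ℂ] L2 L := Energy.thetaT L ∘ₗ (domB L τ σ ξ).subtype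

end domB

open domB

/-- The operator of the first system,
`B₁ U = (Φ, ρ₁⁻¹ [κ (φₓ + ψ)ₓ - μ₁ A^τ Φ], Ψ, -ρ₂⁻¹ [b A ψ + κ (φₓ + ψ) + β Θₓ + μ₂ A^σ Ψ],
  Θ, -ρ₃⁻¹ [δ A θ + γ Ψₓ + K A^ξ Θ])`. -/
def opB₁ (L ρ₁ ρ₂ ρ₃ κ b δ β γ μ₁ μ₂ K τ σ ξ : ℝ) : Energy L →ₗ.[ℂ] Energy L where
  domain := domB L τ σ ξ
  toFun := Energy.ofComponents L
    (phiT L τ σ ξ)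
    ((1 / ρ₁) • (κ • shearX L τ σ ξ - μ₁ • powPhiT L τ σ ξ))
    (psiT L τ σ ξ)
    (-((1 / ρ₂) • (b • aPsi L τ σ ξ + κ • shear L τ σ ξ + β • thetaTX L τ σ ξ
      + μ₂ • powPsiT L τ σ ξ)))
    (thetaT L τ σ ξ)
    (-((1 / ρ₃) • (δ • aTheta L τ σ ξ + γ • psiTX L τ σ ξ + K • powThetaT L τ σ ξ)))

/-- The operator of the second system,
`B₂ U = (Φ, ρ₁⁻¹ [κ (φₓ + ψ)ₓ - μ Θₓ - μ₁ A^τ Φ], Ψ,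
  ρ₂⁻¹ [-b A ψ - κ (φₓ + ψ) + μ Θ - μ₂ A^σ Ψ], Θ,
  ρ₃⁻¹ [-δ A θ - μ (Φₓ + Ψ) - γ A^ξ Θ])`. -/
def opB₂ (L ρ₁ ρ₂ ρ₃ κ b δ μ γ μ₁ μ₂ τ σ ξ : ℝ) : Energy L →ₗ.[ℂ] Energy L where
  domain := domB L τ σ ξ
  toFun := Energy.ofComponents L
    (phiT L τ σ ξ)
    ((1 / ρ₁) • (κ • shearX L τ σ ξ - μ • thetaTX L τ σ ξ - μ₁ • powPhiT L τ σ ξ))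
    (psiT L τ σ ξ)
    ((1 / ρ₂) • (-(b • aPsi L τ σ ξ) - κ • shear L τ σ ξ + μ • thetaT' L τ σ ξ
      - μ₂ • powPsiT L τ σ ξ))
    (thetaT L τ σ ξ)
    ((1 / ρ₃) • (-(δ • aTheta L τ σ ξ) - μ • (phiTX L τ σ ξ + psiT' L τ σ ξ)
      - γ • powThetaT L τ σ ξ))

/-! ### Weak solutions and domains of powers -/

/-- `u : [0, ∞) → E` is a weak solution of `u' = B u`, `u(0) = U₀`: it is continuous, `u(0) = U₀`,
and for every `ℓ` in the domain of the adjoint `B*` and `m = B* ℓ` (that is, `ℓ, m` are bounded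
functionals with `ℓ (B x) = m x` on the domain of `B`), the function `t ↦ ℓ (u t)` is
differentiable on `[0, ∞)` with derivative `m (u t)`. Only the values of `u` on `[0, ∞)` matter. -/
structure IsWeakSolution {E : Type*} [NormedAddCommGroup E] [NormedSpace ℂ E] (B : E →ₗ.[ℂ] E)
    (U₀ : E) (u : ℝ → E) : Prop where
  continuousOn : ContinuousOn u (Ici 0)
  initial : u 0 = U₀
  hasDeriv : ∀ ℓ m : E →L[ℂ] ℂ, (∀ x : B.domain, ℓ (B x) = m x) →
    ∀ t ∈ Ici (0 : ℝ), HasDerivWithinAt (fun s => ℓ (u s)) (m (u t)) (Ici 0) t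

/-- The normed space `D(B^j)` with the graph norm `max_{i ≤ j} ‖B^i x‖`: an element `x` is stored as
the tuple `(x, B x, …, B^j x)`, which exists if and only if `x` is in the domain of `B^j`. -/
def powDomain {E : Type*} [NormedAddCommGroup E] [NormedSpace ℂ E] (B : E →ₗ.[ℂ] E) (j : ℕ) :
    Submodule ℂ (Fin (j + 1) → E) where
  carrier := {w | ∀ i : Fin j, (w i.castSucc, w i.succ) ∈ B.graph}
  add_mem' hv hw i := B.graph.add_mem (hv i) (hw i)
  zero_mem' _ := B.graph.zero_mem
  smul_mem' c _ hw i := B.graph.smul_mem c (hw i)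

/-- The inclusion of `D(B^j)` in `E`. -/
def powDomain.incl {E : Type*} [NormedAddCommGroup E] [NormedSpace ℂ E] (B : E →ₗ.[ℂ] E) (j : ℕ) :
    powDomain B j →ₗ[ℂ] E :=
  (LinearMap.proj 0).comp (powDomain B j).subtype

end Timoshenko

end

open MeasureTheory Set
open scoped ContDiff InnerProductSpace

namespace Timoshenko

open Filter Topology

set_option linter.unusedSectionVars false

/-! ### Pregenerators of contraction semigroups -/

/-! The two halves of the theorem are of different nature, because the operators B are in general
not closed: if a damping exponent exceeds 1/2, the graph norm controls only the sum of the elastic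
and the damping term, not each of them.

Well-posedness. After weighting the components and applying A^{1/2} to the positions, both systems
read x' = α A^{1/2} v, v' = -α A^{1/2} x - c A^s v + ε ∂ₓ v + Q(x, v). The elastic part is skew and
the damping is nonpositive. The coupling through the velocities is skew, since ε is symmetric and ∂ₓ
is skew on H¹₀. The coupling through the positions is bounded in the energy norm and goes into Q. So
B - ω is dissipative with ω = ∑ ‖Q_j‖, and an eigenvector of the adjoint for a real eigenvalue above
ω vanishes, as testing with its own spectral truncations shows (`eq_zero_of_adjoint`). Hence the
closure of B - ω generates a contraction semigroup; it is obtained from Yosida approximations, using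
only the continuous extension of the resolvent (`exists_isSolutionOp`). Weak solutions are unique
because the resolvent turns them into strongly differentiable curves on which dissipativity acts
(`weakSolution_zero`).

Regularity. An orbit u starting in D(B) is C¹, but semigroup theory places it only in the domain of
the closure. What has to be proved is that D(B) itself is invariant; repeated differentiation then
gives the rest (`exists_regular`). Velocities stay in D(A^{1/2}) because x' = α A^{1/2} v is
continuous. The question is whether x_j stays in D(A^{1/2}). If s_j ≤ 1/2, the velocity equation
says so directly. If s_j > 1/2, solve the velocity equation for v and insert it in x' = α A^{1/2} v:
each coefficient of y = A^{1/2} x_j solves y' = -a_n y + a_n h/α, where a_n grows like n^{2(1-s_j)}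
and h = -v' + ε D(x'/α) + Q(u), with D = ∂ₓ A^{-1/2} mapping sines to cosines.

The convolution ∫ a_n e^{-a_n σ} h(t-σ) dσ need not be square summable for a merely continuous h.
However, h is a Lipschitz term plus time derivatives of v and of D x. Integrating by parts moves the
derivative to the kernel, and interpolating between Lipschitz continuity in L² and boundedness in a
fractional domain makes the singularity at σ = 0 integrable (`sqSum_conv_deriv`). For v the
fractional domain is D(A^{1/2}). For D x one first derives from the same formula that x is bounded
in every fractional domain below D(A^{1/2}) (`exists_sum_le`), and then needs that D respects low
fractional orders, which follows from the decay of the overlaps of sines and cosines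
(`exists_sum_D_le`).

The sine basis makes A and its powers diagonal, identifies all domains with weighted ℓ² conditions,
and so reduces the two concrete operators to this model. -/

theorem hasDerivWithinAt_norm_sq {X : Type*} [NormedAddCommGroup X] [InnerProductSpace ℂ X]
    {f : ℝ → X} {f' : X} {s : Set ℝ} {t : ℝ} (hf : HasDerivWithinAt f f' s t) :
    HasDerivWithinAt (fun t => ‖f t‖ ^ 2) (2 * (⟪f t, f'⟫_ℂ).re) s t := by
  let _ : InnerProductSpace ℝ X := InnerProductSpace.complexToReal
  exact hf.norm_sq

section Semigroup

variable {X : Type*} [NormedAddCommGroup X] [InnerProductSpace ℂ X]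

/-- A densely defined dissipative operator `B` such that `λ - B` has dense range for all `λ > 0`,
so that the closure of `B` generates a contraction semigroup (Lumer-Phillips). -/
structure IsPregenerator (B : X →ₗ.[ℂ] X) : Prop where
  dense_domain : Dense (B.domain : Set X)
  dissipative : ∀ x : B.domain, (⟪B x, (x : X)⟫_ℂ).re ≤ 0
  dense_range : ∀ lam : ℝ, 0 < lam → DenseRange fun x : B.domain => (lam : ℂ) • (x : X) - B x

/-- The map `λ - B` on the domain of `B`. -/
noncomputable def subOp (B : X →ₗ.[ℂ] X) (lam : ℝ) : B.domain →ₗ[ℂ] X :=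
  (lam : ℂ) • B.domain.subtype - B.toFun

theorem subOp_apply (B : X →ₗ.[ℂ] X) (lam : ℝ) (x : B.domain) :
    subOp B lam x = (lam : ℂ) • (x : X) - B x := rfl

variable [CompleteSpace X]

/-- The resolvent of the closure of `B`, the continuous extension of `(λ - B) x ↦ x`. -/
noncomputable def resolvent (B : X →ₗ.[ℂ] X) (lam : ℝ) : X →L[ℂ] X :=
  B.domain.subtype.extendOfNorm (subOp B lam)

namespace IsPregenerator

variable {B : X →ₗ.[ℂ] X} (hB : IsPregenerator B)

include hB

theorem denseRange_subOp {lam : ℝ} (hl : 0 < lam) : DenseRange (subOp B lam) :=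
  hB.dense_range lam hl

/-- Dissipativity gives λ‖x‖² ≤ Re ⟨(λ - B)x, x⟩. This bound is what allows (λ - B)x ↦ x to be
extended to the whole space. -/
theorem norm_le_subOp {lam : ℝ} (hl : 0 < lam) (x : B.domain) :
    ‖B.domain.subtype x‖ ≤ lam⁻¹ * ‖subOp B lam x‖ := by
  rcases eq_or_ne (x : X) 0 with h0 | h0
  · simp only [Submodule.subtype_apply, h0, norm_zero]; positivity
  have hx : 0 < ‖(x : X)‖ := norm_pos_iff.2 h0
  have h1 : lam * ‖(x : X)‖ ^ 2 ≤ (⟪subOp B lam x, (x : X)⟫_ℂ).re := by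
    rw [subOp_apply, inner_sub_left, inner_smul_left, inner_self_eq_norm_sq_to_K]
    have := hB.dissipative x
    simp only [Complex.conj_ofReal, Complex.sub_re]
    have h2 : ((lam : ℂ) * ((‖(x : X)‖ : ℂ)) ^ 2).re = lam * ‖(x : X)‖ ^ 2 := by
      rw [← Complex.ofReal_pow, ← Complex.ofReal_mul, Complex.ofReal_re]
    erw [h2]
    linarith
  have h2 : (⟪subOp B lam x, (x : X)⟫_ℂ).re ≤ ‖subOp B lam x‖ * ‖(x : X)‖ :=
    (Complex.re_le_norm _).trans (norm_inner_le_norm _ _)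
  have h3 : lam * ‖(x : X)‖ ≤ ‖subOp B lam x‖ := by
    have : (lam * ‖(x : X)‖) * ‖(x : X)‖ ≤ ‖subOp B lam x‖ * ‖(x : X)‖ := by nlinarith
    exact le_of_mul_le_mul_right this hx
  rw [Submodule.subtype_apply, inv_mul_eq_div, le_div_iff₀ hl]
  linarith

theorem resolvent_subOp {lam : ℝ} (hl : 0 < lam) (x : B.domain) :
    resolvent B lam (subOp B lam x) = x :=
  LinearMap.extendOfNorm_eq (hB.denseRange_subOp hl) ⟨_, hB.norm_le_subOp hl⟩ x

theorem norm_resolvent_le {lam : ℝ} (hl : 0 < lam) (x : X) :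
    ‖resolvent B lam x‖ ≤ lam⁻¹ * ‖x‖ :=
  LinearMap.norm_extendOfNorm_apply_le (hB.denseRange_subOp hl) _ (hB.norm_le_subOp hl) x

theorem norm_smul_resolvent_le {lam : ℝ} (hl : 0 < lam) (x : X) :
    ‖(lam : ℂ) • resolvent B lam x‖ ≤ ‖x‖ := by
  rw [norm_smul, Complex.norm_real, Real.norm_of_nonneg hl.le]
  calc lam * ‖resolvent B lam x‖ ≤ lam * (lam⁻¹ * ‖x‖) :=
        mul_le_mul_of_nonneg_left (hB.norm_resolvent_le hl x) hl.le
    _ = ‖x‖ := by field_simp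

/-- `R_λ B x = λ R_λ x - x`. -/
theorem resolvent_apply_op {lam : ℝ} (hl : 0 < lam) (x : B.domain) :
    resolvent B lam (B x) = (lam : ℂ) • resolvent B lam x - x := by
  have h := hB.resolvent_subOp hl x
  rw [subOp_apply, map_sub, map_smul] at h
  rw [eq_sub_iff_add_eq, add_comm, ← eq_sub_iff_add_eq]; exact h.symm

/-- Verified on the dense range of ν - B and extended by continuity. Other facts about the resolvent
are obtained in the same way, so the closure of B never has to be constructed. -/
theorem resolvent_sub_resolvent {lam nu : ℝ} (hl : 0 < lam) (hn : 0 < nu) (y : X) :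
    resolvent B lam y - resolvent B nu y =
      ((nu : ℂ) - lam) • resolvent B lam (resolvent B nu y) := by
  refine isClosed_property (p := fun y => resolvent B lam y - resolvent B nu y =
      ((nu : ℂ) - lam) • resolvent B lam (resolvent B nu y)) (hB.denseRange_subOp hn)
    (isClosed_eq (by fun_prop) (by fun_prop)) (fun x => ?_) y
  rw [hB.resolvent_subOp hn, subOp_apply, map_sub, map_smul, hB.resolvent_apply_op hl, sub_smul]
  abel

theorem resolvent_comm {lam nu : ℝ} (hl : 0 < lam) (hn : 0 < nu) :
    Commute (resolvent B lam) (resolvent B nu) := by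
  rcases eq_or_ne lam nu with h | h
  · rw [h]
  refine ContinuousLinearMap.ext fun y => ?_
  have h1 := hB.resolvent_sub_resolvent hl hn y
  have h2 := hB.resolvent_sub_resolvent hn hl y
  have h3 : ((nu : ℂ) - lam) • (resolvent B lam (resolvent B nu y)
      - resolvent B nu (resolvent B lam y)) = 0 := by
    rw [smul_sub, ← h1]
    have : ((nu : ℂ) - lam) • resolvent B nu (resolvent B lam y) =
        -(((lam : ℂ) - nu) • resolvent B nu (resolvent B lam y)) := by
      rw [← neg_smul, neg_sub]
    rw [this, ← h2]; abel
  rcases smul_eq_zero.1 h3 with h4 | h4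
  · exact absurd (by exact_mod_cast (sub_eq_zero.1 h4).symm) h
  · exact sub_eq_zero.1 h4

/-- Since λR - 1 plays the role of (closure of B) ∘ R, this is dissipativity of the closure. -/
theorem re_inner_resolvent_le {lam : ℝ} (hl : 0 < lam) (y : X) :
    (⟪(lam : ℂ) • resolvent B lam y - y, resolvent B lam y⟫_ℂ).re ≤ 0 := by
  refine isClosed_property (p := fun y => (⟪(lam : ℂ) • resolvent B lam y - y,
    resolvent B lam y⟫_ℂ).re ≤ 0) (hB.denseRange_subOp hl)
    (isClosed_le (by fun_prop) (by fun_prop)) (fun x => ?_) y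
  rw [hB.resolvent_subOp hl, subOp_apply, sub_sub_cancel]
  exact hB.dissipative x

/-- On the domain, λRz - z = R B z is O(1/λ); the operators λR are contractions, so density of the
domain suffices. -/
theorem tendsto_smul_resolvent (x : X) :
    Tendsto (fun n : ℕ => (((n : ℝ) + 1 : ℝ) : ℂ) • resolvent B (n + 1) x) atTop (𝓝 x) := by
  rw [Metric.tendsto_atTop]
  intro ε hε
  obtain ⟨z, hz, hxz⟩ := Metric.mem_closure_iff.1 (hB.dense_domain x) (ε / 3) (by positivity)
  obtain ⟨N, hN⟩ := exists_nat_gt (3 * ‖B ⟨z, hz⟩‖ / ε)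
  refine ⟨N, fun n hn => ?_⟩
  have hn0 : (0 : ℝ) < n + 1 := by positivity
  have h1 : ‖(((n : ℝ) + 1 : ℝ) : ℂ) • resolvent B (n + 1) (x - z)‖ ≤ ‖x - z‖ :=
    hB.norm_smul_resolvent_le hn0 _
  have h2 : ‖(((n : ℝ) + 1 : ℝ) : ℂ) • resolvent B (n + 1) z - z‖ < ε / 3 := by
    have h := hB.resolvent_apply_op hn0 ⟨z, hz⟩
    rw [← h]
    refine (hB.norm_resolvent_le hn0 _).trans_lt ?_
    rw [inv_mul_lt_iff₀ hn0]
    rw [div_lt_iff₀ hε] at hN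
    have : (N : ℝ) ≤ n := by exact_mod_cast hn
    nlinarith
  rw [dist_eq_norm] at hxz ⊢
  have e : (((n : ℝ) + 1 : ℝ) : ℂ) • resolvent B (n + 1) x - x =
      (((n : ℝ) + 1 : ℝ) : ℂ) • resolvent B (n + 1) (x - z) +
      ((((n : ℝ) + 1 : ℝ) : ℂ) • resolvent B (n + 1) z - z) - (x - z) := by
    rw [map_sub, smul_sub]; abel
  rw [e]
  calc _ ≤ _ := norm_sub_le _ _
    _ ≤ ‖x - z‖ + ‖(((n : ℝ) + 1 : ℝ) : ℂ) • resolvent B (n + 1) z - z‖ + ‖x - z‖ := by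
        gcongr
        exact (norm_add_le _ _).trans (by gcongr)
    _ < ε := by linarith

end IsPregenerator

/-- The Yosida approximation `λ (λ R_λ - 1)`. -/
noncomputable def yosida (B : X →ₗ.[ℂ] X) (lam : ℝ) : X →L[ℂ] X :=
  (lam : ℂ) • ((lam : ℂ) • resolvent B lam - 1)

theorem yosida_apply (B : X →ₗ.[ℂ] X) (lam : ℝ) (x : X) :
    yosida B lam x = (lam : ℂ) • ((lam : ℂ) • resolvent B lam x - x) := rfl

/-- The semigroup generated by a Yosida approximation. -/
noncomputable def yosidaExp (B : X →ₗ.[ℂ] X) (lam t : ℝ) : X →L[ℂ] X :=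
  NormedSpace.exp (t • yosida B lam)

theorem yosidaExp_zero (B : X →ₗ.[ℂ] X) (lam : ℝ) : yosidaExp B lam 0 = 1 := by
  rw [yosidaExp, zero_smul, NormedSpace.exp_zero]

theorem hasDerivAt_yosidaExp (B : X →ₗ.[ℂ] X) (lam t : ℝ) :
    HasDerivAt (yosidaExp B lam) (yosida B lam * yosidaExp B lam t) t :=
  hasDerivAt_exp_smul_const' (yosida B lam) t

theorem hasDerivAt_yosidaExp_apply (B : X →ₗ.[ℂ] X) (lam t : ℝ) (x : X) :
    HasDerivAt (fun t => yosidaExp B lam t x) (yosida B lam (yosidaExp B lam t x)) t :=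
  ((ContinuousLinearMap.apply ℂ X x).restrictScalars ℝ).hasFDerivAt.comp_hasDerivAt t
    (hasDerivAt_yosidaExp B lam t)

theorem continuous_yosidaExp_apply (B : X →ₗ.[ℂ] X) (lam : ℝ) (x : X) :
    Continuous fun t => yosidaExp B lam t x :=
  continuous_iff_continuousAt.2 fun t => (hasDerivAt_yosidaExp_apply B lam t x).continuousAt

theorem commute_yosida_yosidaExp (B : X →ₗ.[ℂ] X) (lam t : ℝ) :
    Commute (yosida B lam) (yosidaExp B lam t) :=
  ((Commute.refl (yosida B lam)).smul_left t).exp_left.symm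

/-! ### Contraction semigroups of the Yosida approximations and their limit -/

namespace IsPregenerator

variable {B : X →ₗ.[ℂ] X} (hB : IsPregenerator B)

include hB

theorem yosida_comm {lam nu : ℝ} (hl : 0 < lam) (hn : 0 < nu) :
    Commute (yosida B lam) (yosida B nu) := by
  unfold yosida
  exact ((((((hB.resolvent_comm hl hn).smul_left _).sub_left (Commute.one_left _)).smul_right
    _).sub_right (Commute.one_right _)).smul_right _).smul_left _

/-- With z = λRy - y one has y = λRy - z, so ⟨y, z⟩ = λ⟨Ry, z⟩ - ‖z‖², and both terms have
nonpositive real part. -/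
theorem re_inner_yosida_le {lam : ℝ} (hl : 0 < lam) (y : X) :
    (⟪y, yosida B lam y⟫_ℂ).re ≤ 0 := by
  rw [yosida_apply, inner_smul_right, Complex.re_ofReal_mul]
  refine mul_nonpos_of_nonneg_of_nonpos hl.le ?_
  set z := (lam : ℂ) • resolvent B lam y - y with hz
  have e : y = (lam : ℂ) • resolvent B lam y - z := by rw [hz]; abel
  have h1 : (⟪resolvent B lam y, z⟫_ℂ).re ≤ 0 := by
    have := hB.re_inner_resolvent_le hl y
    rw [← inner_conj_symm, Complex.conj_re] at this
    exact this
  have h2 : (0 : ℝ) ≤ (⟪z, z⟫_ℂ).re := inner_self_nonneg (𝕜 := ℂ)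
  rw [e, inner_sub_left, inner_smul_left, Complex.sub_re, Complex.conj_ofReal,
    Complex.re_ofReal_mul]
  nlinarith

theorem norm_yosidaExp_le {lam t : ℝ} (hl : 0 < lam) (ht : 0 ≤ t) (x : X) :
    ‖yosidaExp B lam t x‖ ≤ ‖x‖ := by
  have hd : ∀ s, HasDerivAt (fun s => ‖yosidaExp B lam s x‖ ^ 2)
      (2 * (⟪yosidaExp B lam s x, yosida B lam (yosidaExp B lam s x)⟫_ℂ).re) s := fun s =>
    hasDerivWithinAt_univ.1
      (hasDerivWithinAt_norm_sq (hasDerivAt_yosidaExp_apply B lam s x).hasDerivWithinAt)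
  have ha : Antitone fun s => ‖yosidaExp B lam s x‖ ^ 2 := by
    refine antitone_of_deriv_nonpos (fun s => (hd s).differentiableAt) fun s => ?_
    rw [(hd s).deriv]
    have := hB.re_inner_yosida_le hl (yosidaExp B lam s x)
    exact mul_nonpos_of_nonneg_of_nonpos zero_le_two this
  have h := ha ht
  simp only [yosidaExp_zero, one_apply_eq_self] at h
  exact (sq_le_sq₀ (norm_nonneg _) (norm_nonneg _)).1 h

/-- The curve s ↦ e^{(t-s)B_ν} e^{sB_λ} x joins the two exponentials. As the approximations commute,
its derivative is a product of contractions applied to (B_λ - B_ν)x. -/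
theorem norm_yosidaExp_sub_le {lam nu t : ℝ} (hl : 0 < lam) (hn : 0 < nu) (ht : 0 ≤ t) (x : X) :
    ‖yosidaExp B lam t x - yosidaExp B nu t x‖ ≤ ‖yosida B lam x - yosida B nu x‖ * t := by
  have hd : ∀ s, HasDerivAt (fun s => yosidaExp B nu (t - s) (yosidaExp B lam s x))
      (yosidaExp B nu (t - s) (yosidaExp B lam s (yosida B lam x - yosida B nu x))) s := by
    intro s
    have h1 : HasDerivAt (fun s => yosidaExp B nu (t - s))
        (-(yosida B nu * yosidaExp B nu (t - s))) s :=
      (hasDerivAt_yosidaExp B nu (t - s)).comp_const_sub t s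
    have h2 := hasDerivAt_yosidaExp B lam s
    have h3 := ((ContinuousLinearMap.apply ℂ X x).restrictScalars ℝ).hasFDerivAt.comp_hasDerivAt s
      (h1.mul h2)
    refine h3.congr_deriv ?_
    have c1 : Commute (yosida B nu) (yosidaExp B lam s) :=
      (((hB.yosida_comm hl hn).smul_left s).exp_left).symm
    have e : -(yosida B nu * yosidaExp B nu (t - s)) * yosidaExp B lam s +
        yosidaExp B nu (t - s) * (yosida B lam * yosidaExp B lam s) =
        yosidaExp B nu (t - s) * (yosidaExp B lam s * (yosida B lam - yosida B nu)) := by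
      rw [(commute_yosida_yosidaExp B nu (t - s)).eq, neg_mul, mul_assoc, c1.eq,
        (commute_yosida_yosidaExp B lam s).eq, mul_sub, mul_sub]
      abel
    rw [e]; rfl
  have h := Convex.norm_image_sub_le_of_norm_hasDerivWithin_le (s := Icc 0 t) (x := 0) (y := t)
    (C := ‖yosida B lam x - yosida B nu x‖)
    (fun s _ => (hd s).hasDerivWithinAt) (fun s hs => ?_) (convex_Icc 0 t)
    (left_mem_Icc.2 ht) (right_mem_Icc.2 ht)
  · simpa [yosidaExp_zero, abs_of_nonneg ht] using h
  · exact (hB.norm_yosidaExp_le hn (sub_nonneg.2 hs.2) _).trans (hB.norm_yosidaExp_le hl hs.1 _)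

theorem tendsto_yosida (x : B.domain) :
    Tendsto (fun n : ℕ => yosida B (n + 1) (x : X)) atTop (𝓝 (B x)) := by
  refine (hB.tendsto_smul_resolvent (B x)).congr fun n => ?_
  rw [yosida_apply, hB.resolvent_apply_op (by positivity)]

theorem cauchySeq_yosidaExp {t : ℝ} (ht : 0 ≤ t) (x : X) :
    CauchySeq fun n : ℕ => yosidaExp B (n + 1) t x := by
  have key : ∀ z : B.domain, CauchySeq fun n : ℕ => yosidaExp B (n + 1) t z := by
    intro z
    rw [Metric.cauchySeq_iff']
    intro ε hε
    obtain ⟨N, hN⟩ := Metric.cauchySeq_iff'.1 (hB.tendsto_yosida z).cauchySeq (ε / (t + 1))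
      (by positivity)
    refine ⟨N, fun n hn => ?_⟩
    have h1 := hN n hn
    rw [dist_eq_norm] at h1 ⊢
    refine (hB.norm_yosidaExp_sub_le (by positivity) (by positivity) ht _).trans_lt ?_
    rw [lt_div_iff₀ (by positivity)] at h1
    nlinarith [norm_nonneg (yosida B (n + 1) (z : X) - yosida B (N + 1) (z : X))]
  rw [Metric.cauchySeq_iff']
  intro ε hε
  obtain ⟨z, hz, hxz⟩ := Metric.mem_closure_iff.1 (hB.dense_domain x) (ε / 3) (by positivity)
  obtain ⟨N, hN⟩ := Metric.cauchySeq_iff'.1 (key ⟨z, hz⟩) (ε / 3) (by positivity)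
  refine ⟨N, fun n hn => ?_⟩
  have h1 := hN n hn
  have h2 : ∀ k : ℕ, dist (yosidaExp B (k + 1) t x) (yosidaExp B (k + 1) t z) < ε / 3 := by
    intro k
    rw [dist_eq_norm, ← map_sub]
    rw [dist_eq_norm] at hxz
    exact (hB.norm_yosidaExp_le (by positivity) ht _).trans_lt hxz
  calc _ ≤ _ := dist_triangle4_right _ _ (yosidaExp B (n + 1) t z) (yosidaExp B (N + 1) t z)
    _ < ε := by
      have := h2 n; have := h2 N
      simp only at h1
      linarith

/-- The semigroup generated by the closure of `B`; constant for negative times. -/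
theorem exists_semigroup : ∃ S : ℝ → X →L[ℂ] X, ∀ t, ∀ x,
    Tendsto (fun n : ℕ => yosidaExp B (n + 1) (max t 0) x) atTop (𝓝 (S t x)) := by
  have : ∀ t : ℝ, ∃ s : X →L[ℂ] X, ∀ x,
      Tendsto (fun n : ℕ => yosidaExp B (n + 1) (max t 0) x) atTop (𝓝 (s x)) := by
    intro t
    choose f hf using fun x => cauchySeq_tendsto_of_complete
      (hB.cauchySeq_yosidaExp (le_max_right t 0) x)
    exact ⟨continuousLinearMapOfTendsto (l := atTop)
      (fun n : ℕ => yosidaExp B (n + 1) (max t 0)) (tendsto_pi_nhds.2 hf), hf⟩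
  choose S hS using this
  exact ⟨S, hS⟩

end IsPregenerator

end Semigroup

/-! ### Solution operators -/

/-- `S` is the family of solution operators of `u' = B u`: the orbits are the unique weak solutions,
and they are differentiable if they start in the domain. -/
structure IsSolutionOp {E : Type*} [NormedAddCommGroup E] [NormedSpace ℂ E] (B : E →ₗ.[ℂ] E)
    (S : ℝ → E →L[ℂ] E) : Prop where
  weak : ∀ x, IsWeakSolution B x fun t => S t x
  unique : ∀ x u, IsWeakSolution B x u → EqOn u (fun t => S t x) (Ici 0)
  hasDeriv : ∀ x : B.domain, ∀ t ∈ Ici (0 : ℝ),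
    HasDerivWithinAt (fun s => S s x) (S t (B x)) (Ici 0) t

theorem tendsto_apply_of_norm_le {E F : Type*} [NormedAddCommGroup E] [NormedSpace ℂ E]
    [NormedAddCommGroup F] [NormedSpace ℂ F] {T : ℕ → E →L[ℂ] F} {y : F} {x : E} {u : ℕ → E}
    (hT : ∀ n z, ‖T n z‖ ≤ ‖z‖) (hx : Tendsto (fun n => T n x) atTop (𝓝 y))
    (hu : Tendsto u atTop (𝓝 x)) : Tendsto (fun n => T n (u n)) atTop (𝓝 y) := by
  have h : Tendsto (fun n => T n (u n - x)) atTop (𝓝 0) := by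
    refine squeeze_zero_norm (fun n => hT n _) ?_
    simpa using (hu.sub_const x).norm
  simpa using h.add hx

theorem hasDerivWithinAt_of_eq_integral {E : Type*} [NormedAddCommGroup E] [NormedSpace ℝ E]
    [CompleteSpace E] {f g : ℝ → E} (hg : Continuous g) {c : E}
    (h : ∀ t ∈ Ici (0 : ℝ), f t = c + ∫ s in (0 : ℝ)..t, g s) :
    ∀ t ∈ Ici (0 : ℝ), HasDerivWithinAt f (g t) (Ici 0) t := fun t ht =>
  ((hg.integral_hasStrictDerivAt 0 t).hasDerivAt.const_add c).hasDerivWithinAt.congr h (h t ht)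

theorem continuous_comp_max_zero {E : Type*} [TopologicalSpace E] {f : ℝ → E}
    (hf : ContinuousOn f (Ici 0)) : Continuous fun t => f (max t 0) :=
  hf.comp_continuous (by fun_prop) fun t => le_max_right t 0

theorem eq_of_hasDerivWithinAt_zero {E : Type*} [NormedAddCommGroup E] [NormedSpace ℝ E]
    {f : ℝ → E} (hf : ∀ t ∈ Ici (0 : ℝ), HasDerivWithinAt f 0 (Ici 0) t) {t : ℝ} (ht : 0 ≤ t) :
    f t = f 0 := by
  have h := Convex.norm_image_sub_le_of_norm_hasDerivWithin_le (f' := fun _ => (0 : E)) (C := 0) hf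
    (fun x _ => by simp) (convex_Ici 0) (self_mem_Ici) (mem_Ici.2 ht)
  rw [zero_mul] at h
  exact sub_eq_zero.1 (norm_le_zero_iff.1 h)

/-! ### Orbits of the limit semigroup and uniqueness of weak solutions -/

section

variable {X : Type*} [NormedAddCommGroup X] [InnerProductSpace ℂ X] [CompleteSpace X]

namespace IsPregenerator

variable {B : X →ₗ.[ℂ] X} (hB : IsPregenerator B)

include hB

theorem norm_yosidaExp_sub_time_le {lam s t : ℝ} (hl : 0 < lam) (hs : 0 ≤ s) (ht : 0 ≤ t) (x : X) :
    ‖yosidaExp B lam t x - yosidaExp B lam s x‖ ≤ ‖yosida B lam x‖ * ‖t - s‖ :=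
  Convex.norm_image_sub_le_of_norm_hasDerivWithin_le (s := Ici 0)
    (fun r _ => (hasDerivAt_yosidaExp_apply B lam r x).hasDerivWithinAt)
    (fun r hr => by
      have e : yosida B lam (yosidaExp B lam r x) = yosidaExp B lam r (yosida B lam x) :=
        DFunLike.congr_fun (commute_yosida_yosidaExp B lam r).eq x
      rw [e]
      exact hB.norm_yosidaExp_le hl hr _) (convex_Ici 0) hs ht

/-- The relation ℓ ∘ B = m implies ℓ ∘ (λR - 1) = m ∘ R. This carries the weak formulation over to
the bounded approximations, for data outside the domain as well. -/
theorem map_yosida {l m : X →L[ℂ] ℂ} (hlm : ∀ x : B.domain, l (B x) = m x) {lam : ℝ}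
    (hl : 0 < lam) (y : X) : l (yosida B lam y) = m ((lam : ℂ) • resolvent B lam y) := by
  have h : (lam : ℂ) * l (resolvent B lam y) - m (resolvent B lam y) = l y := by
    refine isClosed_property (p := fun y => (lam : ℂ) * l (resolvent B lam y) -
      m (resolvent B lam y) = l y) (hB.denseRange_subOp hl)
      (isClosed_eq (by fun_prop) (by fun_prop)) (fun x => ?_) y
    rw [hB.resolvent_subOp hl, subOp_apply, map_sub, map_smul, hlm, smul_eq_mul]
  rw [yosida_apply, map_smul, map_sub, map_smul, map_smul, ← h, smul_eq_mul, smul_eq_mul,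
    smul_eq_mul]
  ring

/-- Weak solutions of the homogeneous problem vanish. -/
theorem weakSolution_zero {u : ℝ → X} (hu : IsWeakSolution B 0 u) {t : ℝ} (ht : 0 ≤ t) :
    u t = 0 := by
  have key : ∀ lam : ℝ, 0 < lam → resolvent B lam (u t) = 0 := by
    intro lam hl
    set R := resolvent B lam with hR
    set M : X →L[ℂ] X := (lam : ℂ) • R - 1 with hM
    have hc : Continuous fun s => M (u (max s 0)) :=
      M.continuous.comp (continuous_comp_max_zero hu.continuousOn)
    -- For every y the functionals ⟨y, R ·⟩ and ⟨y, (λR - 1) ·⟩ form an admissible test pair. Hence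
    -- R u is the integral of a norm continuous function, although u is differentiable only in the
    -- weak sense.
    have hint : ∀ t ∈ Ici (0 : ℝ), R (u t) = 0 + ∫ s in (0 : ℝ)..t, M (u (max s 0)) := by
      intro t ht
      rw [zero_add, ← sub_eq_zero]
      refine ext_inner_left ℂ fun y => ?_
      rw [inner_zero_right]
      set F : ℝ → X := fun t => R (u t) - ∫ s in (0 : ℝ)..t, M (u (max s 0)) with hF
      have hd : ∀ t ∈ Ici (0 : ℝ), HasDerivWithinAt (fun t => ⟪y, F t⟫_ℂ) 0 (Ici 0) t := by
        intro t ht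
        have h1 := hu.hasDeriv ((innerSL ℂ y).comp R) ((innerSL ℂ y).comp M) (fun x => by
          change ⟪y, R (B x)⟫_ℂ = ⟪y, (lam : ℂ) • R x - x⟫_ℂ
          rw [hR, hB.resolvent_apply_op hl]) t ht
        have h2 := ((innerSL ℂ y).restrictScalars ℝ).hasFDerivAt.comp_hasDerivWithinAt t
          (hc.integral_hasStrictDerivAt 0 t).hasDerivAt.hasDerivWithinAt (s := Ici 0)
        have h3 := h1.sub h2
        have e : max t 0 = t := max_eq_left ht
        refine (h3.congr_deriv ?_).congr (fun s _ => ?_) ?_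
        · simp [e]
        · simp [hF]
        · simp [hF]
      rw [eq_of_hasDerivWithinAt_zero hd ht]
      simp [hF, hu.initial]
    have hderiv := hasDerivWithinAt_of_eq_integral hc hint
    have hsq : ∀ s ∈ Ici (0 : ℝ), HasDerivWithinAt (fun t => ‖R (u t)‖ ^ 2)
        (2 * (⟪R (u s), M (u s)⟫_ℂ).re) (Ici 0) s := by
      intro s hs
      have h := hasDerivWithinAt_norm_sq (hderiv s hs)
      rwa [max_eq_left (mem_Ici.1 hs)] at h
    have hanti : AntitoneOn (fun t => ‖R (u t)‖ ^ 2) (Ici 0) := by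
      refine antitoneOn_of_deriv_nonpos (convex_Ici 0)
        (fun s hs => (hsq s hs).continuousWithinAt) (fun s hs => ?_) fun s hs => ?_
      · rw [interior_Ici] at hs ⊢
        exact ((hsq s (mem_Ici.2 (mem_Ioi.1 hs).le)).mono Ioi_subset_Ici_self).differentiableWithinAt
      · rw [interior_Ici] at hs
        rw [((hsq s (mem_Ici.2 (mem_Ioi.1 hs).le)).hasDerivAt (Ici_mem_nhds hs)).deriv]
        have := hB.re_inner_resolvent_le hl (u s)
        rw [← inner_conj_symm, Complex.conj_re] at this
        exact mul_nonpos_of_nonneg_of_nonpos zero_le_two this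
    have h := hanti self_mem_Ici (mem_Ici.2 ht) ht
    simp only [hu.initial, map_zero, norm_zero] at h
    have h' : ‖R (u t)‖ ^ 2 = 0 := le_antisymm (by simpa using h) (by positivity)
    exact norm_eq_zero.1 (pow_eq_zero_iff two_ne_zero |>.1 h')
  refine tendsto_nhds_unique (hB.tendsto_smul_resolvent (u t)) ?_
  refine tendsto_const_nhds.congr fun n => ?_
  rw [key _ (by positivity), smul_zero]

/-- Orbits from the domain are Lipschitz with constant ‖Bx‖, and uniform approximation gives
continuity of all orbits. Both the strong and the weak equation are obtained in integrated form,
where dominated convergence applies to the Yosida approximations. -/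
theorem exists_isSolutionOp : ∃ S, IsSolutionOp B S := by
  obtain ⟨S, hS⟩ := hB.exists_semigroup
  have hpos : ∀ n : ℕ, (0 : ℝ) < n + 1 := fun n => by positivity
  have hnorm : ∀ t x, ‖S t x‖ ≤ ‖x‖ := fun t x =>
    le_of_tendsto (hS t x).norm (Eventually.of_forall fun n =>
      hB.norm_yosidaExp_le (hpos n) (le_max_right t 0) x)
  have hzero : ∀ x, S 0 x = x := fun x =>
    tendsto_nhds_unique (hS 0 x) (by simp [yosidaExp_zero])
  have hcontD : ∀ x : B.domain, Continuous fun t => S t x := by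
    intro x
    have hl : LipschitzWith ‖B x‖₊ fun t => S t x := by
      refine LipschitzWith.of_dist_le_mul fun t s => ?_
      have h := le_of_tendsto_of_tendsto (((hS t x).sub (hS s x)).norm)
        ((hB.tendsto_yosida x).norm.mul_const ‖max t 0 - max s 0‖)
        (Eventually.of_forall fun n => hB.norm_yosidaExp_sub_time_le (hpos n) (le_max_right s 0)
          (le_max_right t 0) x)
      rw [dist_eq_norm, dist_eq_norm, coe_nnnorm]
      refine h.trans (mul_le_mul_of_nonneg_left ?_ (norm_nonneg _))
      simpa using abs_max_sub_max_le_abs t s 0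
    exact hl.continuous
  have hcont : ∀ x, Continuous fun t => S t x := by
    intro x
    refine continuous_of_uniform_approx_of_continuous fun U hU => ?_
    obtain ⟨ε, hε, hεU⟩ := Metric.mem_uniformity_dist.1 hU
    obtain ⟨z, hz, hxz⟩ := Metric.mem_closure_iff.1 (hB.dense_domain x) ε hε
    refine ⟨_, hcontD ⟨z, hz⟩, fun t => hεU ?_⟩
    rw [dist_eq_norm, ← map_sub]
    rw [dist_eq_norm] at hxz
    exact (hnorm t _).trans_lt hxz
  have hlim : ∀ {t : ℝ}, 0 ≤ t → ∀ x,
      Tendsto (fun n : ℕ => yosidaExp B (n + 1) t x) atTop (𝓝 (S t x)) := fun {t} ht x => by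
    simpa [max_eq_left ht] using hS t x
  have hstrong : ∀ x : B.domain, ∀ t ∈ Ici (0 : ℝ),
      S t x = x + ∫ s in (0 : ℝ)..t, S s (B x) := by
    intro x t ht
    have h1 : ∀ n : ℕ, yosidaExp B (n + 1) t x =
        x + ∫ s in (0 : ℝ)..t, yosidaExp B (n + 1) s (yosida B (n + 1) x) := by
      intro n
      have hd : ∀ s, HasDerivAt (fun s => yosidaExp B (n + 1) s (x : X))
          (yosidaExp B (n + 1) s (yosida B (n + 1) x)) s := fun s =>
        (hasDerivAt_yosidaExp_apply B _ s x).congr_deriv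
          (DFunLike.congr_fun (commute_yosida_yosidaExp B _ s).eq (x : X))
      rw [intervalIntegral.integral_eq_sub_of_hasDerivAt (fun s _ => hd s)
        ((continuous_yosidaExp_apply B _ _).intervalIntegrable _ _)]
      simp [yosidaExp_zero]
    refine tendsto_nhds_unique (hlim ht x) ?_
    simp_rw [h1]
    refine tendsto_const_nhds.add ?_
    obtain ⟨C, hC⟩ := (hB.tendsto_yosida x).norm.bddAbove_range
    refine intervalIntegral.tendsto_integral_filter_of_dominated_convergence (fun _ => C)
      (Eventually.of_forall fun n => (continuous_yosidaExp_apply B _ _).aestronglyMeasurable)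
      (Eventually.of_forall fun n => Eventually.of_forall fun s hs => ?_)
      intervalIntegrable_const (Eventually.of_forall fun s hs => ?_)
    · rw [uIoc_of_le ht] at hs
      exact (hB.norm_yosidaExp_le (hpos n) hs.1.le _).trans (hC ⟨n, rfl⟩)
    · rw [uIoc_of_le ht] at hs
      exact tendsto_apply_of_norm_le (fun n z => hB.norm_yosidaExp_le (hpos n) hs.1.le z)
        (hlim hs.1.le _) (hB.tendsto_yosida x)
  have hweak : ∀ (l m : X →L[ℂ] ℂ), (∀ x : B.domain, l (B x) = m x) → ∀ x, ∀ t ∈ Ici (0 : ℝ),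
      l (S t x) = l x + ∫ s in (0 : ℝ)..t, m (S s x) := by
    intro l m hlm x t ht
    have hc : ∀ n : ℕ, Continuous fun s => m ((((n : ℝ) + 1 : ℝ) : ℂ) •
        resolvent B (n + 1) (yosidaExp B (n + 1) s x)) := fun n =>
      m.continuous.comp (((resolvent B _).continuous.comp
        (continuous_yosidaExp_apply B _ _)).const_smul _)
    have h1 : ∀ n : ℕ, l (yosidaExp B (n + 1) t x) = l x + ∫ s in (0 : ℝ)..t,
        m ((((n : ℝ) + 1 : ℝ) : ℂ) • resolvent B (n + 1) (yosidaExp B (n + 1) s x)) := by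
      intro n
      have hd : ∀ s, HasDerivAt (fun s => l (yosidaExp B (n + 1) s x))
          (m ((((n : ℝ) + 1 : ℝ) : ℂ) • resolvent B (n + 1) (yosidaExp B (n + 1) s x))) s := by
        intro s
        rw [← hB.map_yosida hlm (hpos n)]
        exact (l.restrictScalars ℝ).hasFDerivAt.comp_hasDerivAt s
          (hasDerivAt_yosidaExp_apply B _ s x)
      rw [intervalIntegral.integral_eq_sub_of_hasDerivAt (fun s _ => hd s)
        ((hc n).intervalIntegrable _ _)]
      simp [yosidaExp_zero]
    refine tendsto_nhds_unique ((l.continuous.tendsto _).comp (hlim ht x)) ?_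
    simp only [Function.comp_def, h1]
    refine tendsto_const_nhds.add ?_
    refine intervalIntegral.tendsto_integral_filter_of_dominated_convergence
      (fun _ => ‖m‖ * ‖x‖) (Eventually.of_forall fun n => (hc n).aestronglyMeasurable)
      (Eventually.of_forall fun n => Eventually.of_forall fun s hs => ?_)
      intervalIntegrable_const (Eventually.of_forall fun s hs => ?_)
    · rw [uIoc_of_le ht] at hs
      refine (m.le_opNorm _).trans (mul_le_mul_of_nonneg_left ?_ (norm_nonneg _))
      exact (hB.norm_smul_resolvent_le (hpos n) _).trans
        (hB.norm_yosidaExp_le (hpos n) hs.1.le _)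
    · rw [uIoc_of_le ht] at hs
      refine (m.continuous.tendsto _).comp ?_
      exact tendsto_apply_of_norm_le
        (T := fun n : ℕ => (((n : ℝ) + 1 : ℝ) : ℂ) • resolvent B (n + 1))
        (fun n z => hB.norm_smul_resolvent_le (hpos n) z) (hB.tendsto_smul_resolvent _)
        (hlim hs.1.le x)
  have hsol : ∀ x, IsWeakSolution B x fun t => S t x := fun x =>
    ⟨(hcont x).continuousOn, hzero x, fun l m hlm =>
      hasDerivWithinAt_of_eq_integral (m.continuous.comp (hcont x)) (hweak l m hlm x)⟩
  refine ⟨S, hsol, fun x u hu t ht => ?_, fun x =>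
    hasDerivWithinAt_of_eq_integral (hcont _) (hstrong x)⟩
  have h : IsWeakSolution B 0 fun t => u t - S t x :=
    ⟨hu.continuousOn.sub (hcont x).continuousOn, by rw [hu.initial, hzero, sub_self],
      fun l m hlm t ht => by
        simp only [map_sub]
        exact (hu.hasDeriv l m hlm t ht).sub ((hsol x).hasDeriv l m hlm t ht)⟩
  exact sub_eq_zero.1 (hB.weakSolution_zero h ht)

end IsPregenerator

end

/-! ### Shifts and similarity transforms of the equation -/

section Transfer

variable {E F : Type*} [NormedAddCommGroup E] [NormedSpace ℂ E] [NormedAddCommGroup F]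
  [NormedSpace ℂ F]

/-- The operator `B - ω`. -/
def shiftOp (B : E →ₗ.[ℂ] E) (om : ℝ) : E →ₗ.[ℂ] E where
  domain := B.domain
  toFun := B.toFun - (om : ℂ) • B.domain.subtype

theorem shiftOp_apply (B : E →ₗ.[ℂ] E) (om : ℝ) (x : B.domain) :
    shiftOp B om x = B x - (om : ℂ) • (x : E) := rfl

/-- The operator `T B T⁻¹`. -/
def conjOp (B : E →ₗ.[ℂ] E) (T : E ≃L[ℂ] F) : F →ₗ.[ℂ] F where
  domain := B.domain.comap (T.symm : F →ₗ[ℂ] E)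
  toFun := (T : E →ₗ[ℂ] F) ∘ₗ B.toFun ∘ₗ
    ((T.symm : F →ₗ[ℂ] E) ∘ₗ Submodule.subtype _).codRestrict B.domain fun x => x.2

theorem conjOp_apply (B : E →ₗ.[ℂ] E) (T : E ≃L[ℂ] F) (y : (conjOp B T).domain) :
    conjOp B T y = T (B ⟨T.symm y, y.2⟩) := rfl

theorem hasDerivWithinAt_exp_mul {u : ℝ → E} {u' : E} {s : Set ℝ} {t : ℝ} (om : ℝ)
    (hu : HasDerivWithinAt u u' s t) :
    HasDerivWithinAt (fun r => ((Real.exp (om * r) : ℝ) : ℂ) • u r)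
      (((Real.exp (om * t) : ℝ) : ℂ) • (u' + (om : ℂ) • u t)) s t := by
  have h1 : HasDerivAt (fun r => Real.exp (om * r)) (Real.exp (om * t) * om) t := by
    simpa using ((hasDerivAt_id t).const_mul om).exp
  have h2 := h1.hasDerivWithinAt.smul hu (s := s)
  refine (h2.congr_deriv ?_).congr (fun r _ => ?_) ?_
  · simp only [Complex.coe_smul, smul_add, smul_smul]
  · exact Complex.coe_smul _ _
  · exact Complex.coe_smul _ _

/-- The test pairs correspond: (ℓ, m) is one for B exactly if (ℓ, m - ωℓ) is one for B - ω. -/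
theorem IsWeakSolution.exp_smul {B : E →ₗ.[ℂ] E} {om : ℝ} {x : E} {u : ℝ → E}
    (hu : IsWeakSolution (shiftOp B om) x u) :
    IsWeakSolution B x fun t => ((Real.exp (om * t) : ℝ) : ℂ) • u t := by
  refine ⟨ContinuousOn.smul (by fun_prop) hu.continuousOn, by simp [hu.initial],
    fun l m hlm t ht => ?_⟩
  have h := hu.hasDeriv l (m - (om : ℂ) • l) (fun y => by
    change l (B ⟨y, y.2⟩ - (om : ℂ) • (y : E)) = m y - (om : ℂ) • l y
    rw [map_sub, hlm ⟨y, y.2⟩, map_smul]) t ht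
  refine ((hasDerivWithinAt_exp_mul om h).congr_deriv ?_).congr (fun r _ => ?_) ?_
  · simp
  · simp
  · simp

theorem IsSolutionOp.of_shiftOp {B : E →ₗ.[ℂ] E} {om : ℝ} {S : ℝ → E →L[ℂ] E}
    (hS : IsSolutionOp (shiftOp B om) S) :
    IsSolutionOp B fun t => ((Real.exp (om * t) : ℝ) : ℂ) • S t := by
  refine ⟨fun x => (hS.weak x).exp_smul, fun x u hu t ht => ?_, fun x t ht => ?_⟩
  -- Viewing B as the shift of B - ω by -ω lets the forward statement also take weak solutions for B
  -- back to weak solutions for B - ω.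
  · have e : B = shiftOp (shiftOp B om) (-om) := by
      refine LinearPMap.ext rfl fun y hy hy' => ?_
      change B ⟨y, hy⟩ = B ⟨y, hy⟩ - (om : ℂ) • y - ((-om : ℝ) : ℂ) • y
      simp
    rw [e] at hu
    have h := hS.unique x _ hu.exp_smul ht
    simp only [smul_apply] at h ⊢
    rw [← h, smul_smul, ← Complex.ofReal_mul, ← Real.exp_add]
    simp
  · have h := hasDerivWithinAt_exp_mul om (hS.hasDeriv x t ht)
    refine h.congr_deriv ?_
    rw [shiftOp_apply, map_sub, map_smul, sub_add_cancel]; rfl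

theorem IsWeakSolution.map {B : E →ₗ.[ℂ] E} {B' : F →ₗ.[ℂ] F} (T : E →L[ℂ] F)
    (hT : ∀ x : B.domain, ∃ h : T x ∈ B'.domain, B' ⟨T x, h⟩ = T (B x)) {x : E} {u : ℝ → E}
    (hu : IsWeakSolution B x u) : IsWeakSolution B' (T x) fun t => T (u t) := by
  refine ⟨T.continuous.comp_continuousOn hu.continuousOn, by rw [hu.initial],
    fun l m hlm t ht => hu.hasDeriv (l.comp T) (m.comp T) (fun y => ?_) t ht⟩
  obtain ⟨h, e⟩ := hT y
  simp only [ContinuousLinearMap.comp_apply]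
  rw [← e, hlm]

theorem IsSolutionOp.of_conjOp {B : E →ₗ.[ℂ] E} {T : E ≃L[ℂ] F} {S : ℝ → F →L[ℂ] F}
    (hS : IsSolutionOp (conjOp B T) S) :
    IsSolutionOp B fun t => (T.symm : F →L[ℂ] E).comp ((S t).comp (T : E →L[ℂ] F)) := by
  have h1 : ∀ x : B.domain, ∃ h : (T : E →L[ℂ] F) x ∈ (conjOp B T).domain,
      conjOp B T ⟨(T : E →L[ℂ] F) x, h⟩ = (T : E →L[ℂ] F) (B x) := by
    intro x
    have h : T.symm (T x) ∈ B.domain := by rw [T.symm_apply_apply]; exact x.2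
    refine ⟨h, ?_⟩
    rw [conjOp_apply]
    simp
  have h2 : ∀ y : (conjOp B T).domain, ∃ h : (T.symm : F →L[ℂ] E) y ∈ B.domain,
      B ⟨(T.symm : F →L[ℂ] E) y, h⟩ = (T.symm : F →L[ℂ] E) (conjOp B T y) := by
    intro y
    refine ⟨y.2, ?_⟩
    rw [conjOp_apply]
    simp
  refine ⟨fun x => ?_, fun x u hu t ht => ?_, fun x t ht => ?_⟩
  · simpa using (hS.weak (T x)).map (T.symm : F →L[ℂ] E) h2
  · have h := hS.unique _ _ (hu.map (T : E →L[ℂ] F) h1) ht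
    have h' := congrArg T.symm h
    simpa using h'
  · obtain ⟨hx, e⟩ := h1 x
    have h := hS.hasDeriv ⟨_, hx⟩ t ht
    rw [e] at h
    exact ((T.symm : F →L[ℂ] E).restrictScalars ℝ).hasFDerivAt.comp_hasDerivWithinAt t h

end Transfer

/-! ### Regularity of orbits -/

section Regularity

variable {E : Type*} [NormedAddCommGroup E] [NormedSpace ℂ E]

/-- The candidate f' is given as an element of D(B^j), so convergence of the difference quotients in
the product space suffices. Closedness of B, which may fail, is not needed. -/
theorem hasDerivWithinAt_powDomain {B : E →ₗ.[ℂ] E} {j : ℕ} {f : ℝ → powDomain B j}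
    {f' : powDomain B j} {s : Set ℝ} {t : ℝ}
    (h : ∀ i, HasDerivWithinAt (fun r => (f r : Fin (j + 1) → E) i) ((f' : Fin (j + 1) → E) i) s t) :
    HasDerivWithinAt f f' s t := by
  have h' : HasDerivWithinAt (fun r => (f r : Fin (j + 1) → E)) f' s t := hasDerivWithinAt_pi.2 h
  rw [hasDerivWithinAt_iff_isLittleO, Asymptotics.isLittleO_iff] at h' ⊢
  exact h'

/-- The orbits of the solution operators, as curves in `D(B^j)`. -/
def powOrbit {B : E →ₗ.[ℂ] E} {S : ℝ → E →L[ℂ] E} (v : ℕ → E) (k j off : ℕ)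
    (hv : ∀ i < k, ∀ t, (S (max t 0) (v i), S (max t 0) (v (i + 1))) ∈ B.graph)
    (hoff : off + j ≤ k) (t : ℝ) : powDomain B j :=
  ⟨fun i => S (max t 0) (v (off + i)), fun i => by
    simpa [add_assoc] using hv (off + i) (by omega) t⟩

/-- Differentiating the window (S v_off, …, S v_{off+j}) shifts it by one. Each derivative uses up
one power of B, whence the budget off + j + m ≤ k. -/
theorem contDiffOn_powOrbit {B : E →ₗ.[ℂ] E} {S : ℝ → E →L[ℂ] E} (hS : IsSolutionOp B S)
    (v : ℕ → E) (k j : ℕ) (hB : ∀ i < k, (v i, v (i + 1)) ∈ B.graph)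
    (hv : ∀ i < k, ∀ t, (S (max t 0) (v i), S (max t 0) (v (i + 1))) ∈ B.graph) (m : ℕ) :
    ∀ (off : ℕ) (hoff : off + j ≤ k), off + j + m ≤ k →
      ContDiffOn ℝ m (powOrbit v k j off hv hoff) (Ici 0) := by
  induction m with
  | zero =>
    intro off hoff _
    rw [Nat.cast_zero, contDiffOn_zero]
    refine ContinuousOn.mono ?_ (subset_univ _)
    rw [continuousOn_univ]
    refine Continuous.subtype_mk (continuous_pi fun i => ?_) _
    exact continuous_comp_max_zero (hS.weak _).continuousOn
  | succ m ih =>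
    intro off hoff hle
    have hd : ∀ t ∈ Ici (0 : ℝ), HasDerivWithinAt (powOrbit v k j off hv hoff)
        (powOrbit v k j (off + 1) hv (by omega) t) (Ici 0) t := by
      intro t ht
      refine hasDerivWithinAt_powDomain fun i => ?_
      obtain ⟨y, hy1, hy2⟩ := (LinearPMap.mem_graph_iff _).1 (hB (off + i) (by omega))
      have h := hS.hasDeriv y t ht
      rw [hy2] at h
      change HasDerivWithinAt (fun r => S (max r 0) (v (off + i)))
        (S (max t 0) (v (off + 1 + i))) (Ici 0) t
      rw [max_eq_left (mem_Ici.1 ht), add_right_comm]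
      refine h.congr (fun r hr => ?_) ?_
      · rw [max_eq_left (mem_Ici.1 hr), hy1]
      · rw [max_eq_left (mem_Ici.1 ht), hy1]
    rw [Nat.cast_succ, contDiffOn_succ_iff_derivWithin (uniqueDiffOn_Ici 0)]
    refine ⟨fun t ht => (hd t ht).differentiableWithinAt, by simp, ?_⟩
    exact (ih (off + 1) (by omega) (by omega)).congr fun t ht =>
      (hd t ht).derivWithin (uniqueDiffOn_Ici 0 t ht)

/-- Existence, uniqueness and regularity of weak solutions, from solution operators that leave the
domain invariant. -/
theorem IsSolutionOp.exists_regular {B : E →ₗ.[ℂ] E} {S : ℝ → E →L[ℂ] E} (hS : IsSolutionOp B S)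
    (hinv : ∀ x : B.domain, ∀ t, 0 ≤ t → (S t x, S t (B x)) ∈ B.graph) (x : E) :
    ∃ U : ℝ → E, IsWeakSolution B x U ∧
      (∀ V : ℝ → E, IsWeakSolution B x V → EqOn V U (Ici 0)) ∧
      ∀ k : ℕ, x ∈ LinearMap.range (powDomain.incl B k) →
        ∀ j m : ℕ, m + j = k →
          ∃ W : ℝ → powDomain B j,
            ContDiffOn ℝ m W (Ici 0) ∧
            ∀ t ∈ Ici (0 : ℝ), powDomain.incl B j (W t) = U t := by
  refine ⟨fun t => S t x, hS.weak x, hS.unique x, ?_⟩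
  rintro k ⟨w, hw⟩ j m hjm
  -- The sequence B^i x, made total by repeating the last entry; the values beyond index k are never
  -- used.
  set v : ℕ → E := fun i => (w : Fin (k + 1) → E) ⟨min i k, by omega⟩ with hvdef
  have hB : ∀ i < k, (v i, v (i + 1)) ∈ B.graph := by
    intro i hi
    have h := w.2 ⟨i, hi⟩
    have e1 : (⟨min i k, by omega⟩ : Fin (k + 1)) = Fin.castSucc ⟨i, hi⟩ :=
      Fin.ext (min_eq_left hi.le)
    have e2 : (⟨min (i + 1) k, by omega⟩ : Fin (k + 1)) = Fin.succ ⟨i, hi⟩ :=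
      Fin.ext (min_eq_left hi)
    simp only [hvdef, e1, e2]
    exact h
  have hv : ∀ i < k, ∀ t, (S (max t 0) (v i), S (max t 0) (v (i + 1))) ∈ B.graph := by
    intro i hi t
    obtain ⟨y, hy1, hy2⟩ := (LinearPMap.mem_graph_iff _).1 (hB i hi)
    have h := hinv y _ (le_max_right t 0)
    rwa [hy1, hy2] at h
  refine ⟨powOrbit v k j 0 hv (by omega), contDiffOn_powOrbit hS v k j hB hv m 0 _ (by omega),
    fun t ht => ?_⟩
  change S (max t 0) (v (0 + 0)) = S t x
  have h0 : v (0 + 0) = x := by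
    rw [← hw]
    change (w : Fin (k + 1) → E) _ = (w : Fin (k + 1) → E) 0
    congr 1
  rw [h0, max_eq_left (mem_Ici.1 ht)]

end Regularity

/-! ### Diagonal operators -/

section Diagonal

variable {H : Type*} [NormedAddCommGroup H] [InnerProductSpace ℂ H]

theorem hasSum_sq_coef (e : HilbertBasis ℕ ℂ H) (u : H) :
    HasSum (fun n => ‖⟪e n, u⟫_ℂ‖ ^ 2) (‖u‖ ^ 2) := by
  have h := Complex.hasSum_re (e.hasSum_inner_mul_inner u u)
  rw [inner_self_eq_norm_sq_to_K] at h
  have e2 : ((‖u‖ : ℂ) ^ 2).re = ‖u‖ ^ 2 := by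
    rw [← Complex.ofReal_pow, Complex.ofReal_re]
  erw [e2] at h
  refine h.congr_fun fun n => ?_
  rw [← inner_conj_symm (e n) u, Complex.mul_conj', ← Complex.ofReal_pow, Complex.ofReal_re,
    RCLike.norm_conj]

theorem summable_sq_coef (e : HilbertBasis ℕ ℂ H) (u : H) :
    Summable fun n => ‖⟪e n, u⟫_ℂ‖ ^ 2 := (hasSum_sq_coef e u).summable

theorem ext_coef (e : HilbertBasis ℕ ℂ H) {u v : H} (h : ∀ n, ⟪e n, u⟫_ℂ = ⟪e n, v⟫_ℂ) : u = v :=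
  e.repr.injective (lp.ext (funext fun n => by simp only [e.repr_apply_apply, h n]))

theorem exists_coef (e : HilbertBasis ℕ ℂ H) {a : ℕ → ℂ} (h : Summable fun n => ‖a n‖ ^ 2) :
    ∃ u, ∀ n, ⟪e n, u⟫_ℂ = a n := by
  have hm : Memℓp a 2 := memℓp_gen (by simpa using h)
  refine ⟨e.repr.symm ⟨a, hm⟩, fun n => ?_⟩
  rw [← e.repr_apply_apply, LinearIsometryEquiv.apply_symm_apply]

/-- `w` is the image of `u` under the diagonal operator with entries `a n`. -/
def IsDiag (e : HilbertBasis ℕ ℂ H) (a : ℕ → ℝ) (u w : H) : Prop :=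
  ∀ n, ⟪e n, w⟫_ℂ = a n * ⟪e n, u⟫_ℂ

theorem exists_isDiag (e : HilbertBasis ℕ ℂ H) {a : ℕ → ℝ} {u : H}
    (h : Summable fun n => a n ^ 2 * ‖⟪e n, u⟫_ℂ‖ ^ 2) : ∃ w, IsDiag e a u w :=
  exists_coef e (by simpa [mul_pow] using h)

theorem IsDiag.summable {e : HilbertBasis ℕ ℂ H} {a : ℕ → ℝ} {u w : H} (h : IsDiag e a u w) :
    Summable fun n => a n ^ 2 * ‖⟪e n, u⟫_ℂ‖ ^ 2 := by
  refine (summable_sq_coef e w).congr fun n => ?_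
  rw [h n, norm_mul, mul_pow, Complex.norm_real, Real.norm_eq_abs, sq_abs]

theorem IsDiag.inner_eq {e : HilbertBasis ℕ ℂ H} {a : ℕ → ℝ} {u v w z : H} (h : IsDiag e a u w)
    (h' : IsDiag e a v z) : ⟪w, v⟫_ℂ = ⟪u, z⟫_ℂ := by
  rw [← e.tsum_inner_mul_inner, ← e.tsum_inner_mul_inner]
  congr 1; ext n
  rw [h' n, ← inner_conj_symm, h n, map_mul, Complex.conj_ofReal, inner_conj_symm]
  ring

theorem IsDiag.re_inner_nonneg {e : HilbertBasis ℕ ℂ H} {a : ℕ → ℝ} {u w : H}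
    (h : IsDiag e a u w) (ha : ∀ n, 0 ≤ a n) : 0 ≤ (⟪w, u⟫_ℂ).re := by
  refine (Complex.hasSum_re (e.hasSum_inner_mul_inner w u)).nonneg fun n => ?_
  rw [← inner_conj_symm, h n, map_mul, Complex.conj_ofReal, mul_assoc, Complex.conj_mul',
    ← Complex.ofReal_pow, ← Complex.ofReal_mul, Complex.ofReal_re]
  exact mul_nonneg (ha n) (by positivity)

/-- The orthogonal projection onto the span of the first `N` basis vectors. -/
noncomputable def trunc (e : HilbertBasis ℕ ℂ H) (N : ℕ) : H →L[ℂ] H :=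
  ∑ n ∈ Finset.range N, (innerSL ℂ (e n)).smulRight (e n)

theorem trunc_apply (e : HilbertBasis ℕ ℂ H) (N : ℕ) (u : H) :
    trunc e N u = ∑ n ∈ Finset.range N, ⟪e n, u⟫_ℂ • e n := by
  simp [trunc]

theorem inner_trunc (e : HilbertBasis ℕ ℂ H) (N m : ℕ) (u : H) :
    ⟪e m, trunc e N u⟫_ℂ = if m < N then ⟪e m, u⟫_ℂ else 0 := by
  rw [trunc_apply, inner_sum]
  simp only [inner_smul_right, orthonormal_iff_ite.1 e.orthonormal m]
  simp

theorem tendsto_trunc (e : HilbertBasis ℕ ℂ H) (u : H) :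
    Tendsto (fun N => trunc e N u) atTop (𝓝 u) := by
  simp_rw [trunc_apply, ← e.repr_apply_apply]
  exact (e.hasSum_repr u).tendsto_sum_nat

theorem isDiag_trunc (e : HilbertBasis ℕ ℂ H) (N : ℕ) (u : H) :
    IsDiag e (fun n => if n < N then 1 else 0) u (trunc e N u) := by
  intro n
  rw [inner_trunc]
  by_cases h : n < N <;> simp [h]

theorem trunc_inner (e : HilbertBasis ℕ ℂ H) (N : ℕ) (u v : H) :
    ⟪trunc e N u, v⟫_ℂ = ⟪u, trunc e N v⟫_ℂ :=
  (isDiag_trunc e N u).inner_eq (isDiag_trunc e N v)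

theorem norm_trunc_le (e : HilbertBasis ℕ ℂ H) (N : ℕ) (u : H) : ‖trunc e N u‖ ≤ ‖u‖ := by
  rw [← sq_le_sq₀ (norm_nonneg _) (norm_nonneg _)]
  refine hasSum_le (fun n => ?_) (hasSum_sq_coef e _) (hasSum_sq_coef e u)
  rw [inner_trunc]
  split_ifs
  · rfl
  · simp

theorem IsDiag.trunc {e : HilbertBasis ℕ ℂ H} {a : ℕ → ℝ} {u w : H} (h : IsDiag e a u w) (N : ℕ) :
    IsDiag e a (trunc e N u) (trunc e N w) := by
  intro n
  rw [inner_trunc, inner_trunc]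
  split_ifs
  · exact h n
  · simp

theorem summable_trunc (e : HilbertBasis ℕ ℂ H) (a : ℕ → ℝ) (N : ℕ) (u : H) :
    Summable fun n => a n ^ 2 * ‖⟪e n, Timoshenko.trunc e N u⟫_ℂ‖ ^ 2 := by
  refine summable_of_ne_finset_zero (s := Finset.range N) fun n hn => ?_
  rw [inner_trunc, if_neg (by simpa using hn)]
  simp

variable [CompleteSpace H]

/-- The isometry that maps a Hilbert basis to an orthonormal sequence. -/
noncomputable def basisMap (e : HilbertBasis ℕ ℂ H) {f : ℕ → H} (hf : Orthonormal ℂ f) : H →L[ℂ] H :=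
  (hf.orthogonalFamily.linearIsometry.comp e.repr.toLinearIsometry).toContinuousLinearMap

theorem norm_basisMap (e : HilbertBasis ℕ ℂ H) {f : ℕ → H} (hf : Orthonormal ℂ f) (u : H) :
    ‖basisMap e hf u‖ = ‖u‖ :=
  (hf.orthogonalFamily.linearIsometry.comp e.repr.toLinearIsometry).norm_map u

theorem hasSum_basisMap (e : HilbertBasis ℕ ℂ H) {f : ℕ → H} (hf : Orthonormal ℂ f) (u : H) :
    HasSum (fun n => ⟪e n, u⟫_ℂ • f n) (basisMap e hf u) := by
  have h := hf.orthogonalFamily.hasSum_linearIsometry (e.repr u)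
  refine h.congr_fun fun n => ?_
  rw [e.repr_apply_apply]; rfl

end Diagonal

/-! ### Systems of damped waves -/

/-- The data of a system of damped waves `x' = α A^{1/2} v`,
`v' = -α A^{1/2} x - c A^s v + ε D A^{1/2} v + Q (x, v)`: here `A` is diagonal in the basis `e` with
eigenvalues `(freq (n + 1))²`, and `D` maps `e n` to `f n`. -/
structure WaveData (ι H : Type*) [Fintype ι] [NormedAddCommGroup H] [InnerProductSpace ℂ H] where
  e : HilbertBasis ℕ ℂ H
  f : ℕ → H
  freq : ℝ
  α : ι → ℝ
  c : ι → ℝ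
  s : ι → ℝ
  ε : ι → ι → ℝ
  Q : ι → PiLp 2 (fun _ : ι ⊕ ι => H) →L[ℂ] H
  orthonormal : Orthonormal ℂ f
  freq_pos : 0 < freq
  α_pos : ∀ j, 0 < α j
  c_pos : ∀ j, 0 < c j
  s_nonneg : ∀ j, 0 ≤ s j
  s_le : ∀ j, s j ≤ 1
  symm : ∀ j k, ε j k = ε k j
  skew : ∀ m n : ℕ, ((m + 1 : ℝ) : ℂ) * ⟪f m, e n⟫_ℂ = -(((n + 1 : ℝ) : ℂ) * ⟪e m, f n⟫_ℂ)
  decay : ∀ m n : ℕ, 2 * (n + 1) ≤ m + 1 → ‖⟪e m, f n⟫_ℂ‖ ≤ 2 / (m + 1)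

namespace WaveData

variable {ι H : Type*} [Fintype ι] [NormedAddCommGroup H] [InnerProductSpace ℂ H]

/-- The eigenvalues of `A^{1/2}`. -/
def om (p : WaveData ι H) (n : ℕ) : ℝ := p.freq * (n + 1)

theorem om_pos (p : WaveData ι H) (n : ℕ) : 0 < p.om n := mul_pos p.freq_pos (by positivity)

/-- The eigenvalues of `A^s`. -/
noncomputable def damp (p : WaveData ι H) (j : ι) (n : ℕ) : ℝ := p.om n ^ (2 * p.s j)

theorem damp_pos (p : WaveData ι H) (j : ι) (n : ℕ) : 0 < p.damp j n :=
  Real.rpow_pos_of_pos (p.om_pos n) _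

/-- The operator of the system. -/
structure IsWaveOp (p : WaveData ι H)
    (B : PiLp 2 (fun _ : ι ⊕ ι => H) →ₗ.[ℂ] PiLp 2 (fun _ : ι ⊕ ι => H)) : Prop where
  mem_domain : ∀ U, U ∈ B.domain ↔ ∀ j,
    (Summable fun n => p.om n ^ 2 * ‖⟪p.e n, U (Sum.inl j)⟫_ℂ‖ ^ 2) ∧
    (Summable fun n => p.om n ^ 2 * ‖⟪p.e n, U (Sum.inr j)⟫_ℂ‖ ^ 2) ∧
    Summable fun n => p.damp j n ^ 2 * ‖⟪p.e n, U (Sum.inr j)⟫_ℂ‖ ^ 2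
  coef_inl : ∀ (U : B.domain) (j : ι) (n : ℕ), ⟪p.e n, B U (Sum.inl j)⟫_ℂ =
    p.α j * (p.om n * ⟪p.e n, U.1 (Sum.inr j)⟫_ℂ)
  coef_inr : ∀ (U : B.domain) (j : ι) (n : ℕ), ⟪p.e n, B U (Sum.inr j)⟫_ℂ =
    -(p.α j * (p.om n * ⟪p.e n, U.1 (Sum.inl j)⟫_ℂ))
      - p.c j * (p.damp j n * ⟪p.e n, U.1 (Sum.inr j)⟫_ℂ)
      - ∑ k, p.ε j k * (p.om n * ⟪p.f n, U.1 (Sum.inr k)⟫_ℂ) + ⟪p.e n, p.Q j U.1⟫_ℂ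

variable [CompleteSpace H]

/-- The isometry `D`. -/
noncomputable def D (p : WaveData ι H) : H →L[ℂ] H := basisMap p.e p.orthonormal

/-- `D A^{1/2} v` has the coefficients `-ω_n ⟨f_n, v⟩`. -/
theorem coef_D (p : WaveData ι H) {v w : H} (h : IsDiag p.e p.om v w) (n : ℕ) :
    ⟪p.e n, p.D w⟫_ℂ = -(p.om n * ⟪p.f n, v⟫_ℂ) := by
  have h1 := (hasSum_basisMap p.e p.orthonormal w).mapL (innerSL ℂ (p.e n))
  have h2 := ((p.e.hasSum_inner_mul_inner (p.f n) v).mul_left (p.om n : ℂ)).neg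
  refine h1.unique (h2.congr_fun fun m => ?_)
  rw [innerSL_apply_apply, inner_smul_right, h m]
  have := p.skew n m
  simp only [om, Complex.ofReal_mul] at *
  linear_combination ((p.freq : ℂ) * ⟪p.e m, v⟫_ℂ) * this

/-- Integration by parts for ∂ₓ = D A^{1/2} on H¹₀: by `coef_D` both sides expand into the same
series. -/
theorem D_skew (p : WaveData ι H) {u v w z : H} (h : IsDiag p.e p.om u w)
    (h' : IsDiag p.e p.om v z) : ⟪p.D w, v⟫_ℂ = -⟪u, p.D z⟫_ℂ := by
  have h1 := p.e.hasSum_inner_mul_inner (p.D w) v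
  have h2 := ((hasSum_basisMap p.e p.orthonormal z).mapL (innerSL ℂ u)).neg
  refine h1.unique (h2.congr_fun fun m => ?_)
  rw [innerSL_apply_apply, inner_smul_right, h' m, ← inner_conj_symm, p.coef_D h m, map_neg, map_mul,
    Complex.conj_ofReal, inner_conj_symm]
  ring

/-- A symmetric matrix times a skew form: the real parts are antisymmetric in (j, k) and cancel in
pairs. No damping is needed to absorb this unbounded coupling. -/
theorem re_inner_coupling (p : WaveData ι H) {v w : ι → H}
    (h : ∀ j, IsDiag p.e p.om (v j) (w j)) :
    (∑ j, ∑ k, (p.ε j k : ℂ) * ⟪p.D (w k), v j⟫_ℂ).re = 0 := by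
  set a : ι → ι → ℝ := fun j k => p.ε j k * (⟪p.D (w k), v j⟫_ℂ).re with ha
  have e : (∑ j, ∑ k, (p.ε j k : ℂ) * ⟪p.D (w k), v j⟫_ℂ).re = ∑ j, ∑ k, a j k := by
    simp [ha, Complex.re_sum]
  have hanti : ∀ j k, a j k = -a k j := by
    intro j k
    simp only [ha]
    rw [p.D_skew (h k) (h j), Complex.neg_re, ← inner_conj_symm, Complex.conj_re, p.symm]
    ring
  have h2 : ∑ j, ∑ k, a j k = -∑ j, ∑ k, a j k := by
    conv_lhs => rw [Finset.sum_comm]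
    rw [← Finset.sum_neg_distrib]
    refine Finset.sum_congr rfl fun j _ => ?_
    rw [← Finset.sum_neg_distrib]
    exact Finset.sum_congr rfl fun k _ => hanti k j
  rw [e]; linarith

/-- A bound for the perturbation `Q`. -/
noncomputable def bound (p : WaveData ι H) : ℝ := ∑ j, ‖p.Q j‖

theorem bound_nonneg (p : WaveData ι H) : 0 ≤ p.bound := by
  unfold bound; positivity

theorem norm_inner_Q_le (p : WaveData ι H) (U Y : PiLp 2 (fun _ : ι ⊕ ι => H)) :
    ‖∑ j, ⟪p.Q j U, Y (Sum.inr j)⟫_ℂ‖ ≤ p.bound * ‖U‖ * ‖Y‖ := by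
  rw [bound, Finset.sum_mul, Finset.sum_mul]
  refine norm_sum_le_of_le _ fun j _ => (norm_inner_le_norm _ _).trans ?_
  gcongr
  · exact (p.Q j).le_opNorm U
  · exact PiLp.norm_apply_le Y _

/-! ### Dissipativity and dense range for the wave system -/

namespace IsWaveOp

variable {p : WaveData ι H}
  {B : PiLp 2 (fun _ : ι ⊕ ι => H) →ₗ.[ℂ] PiLp 2 (fun _ : ι ⊕ ι => H)} (hB : p.IsWaveOp B)

include hB

/-- The second argument is left arbitrary, because the formula serves for the dissipativity estimate
and also for the adjoint eigenvalue problem, where Y need not lie in the domain. -/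
theorem inner_apply (U : B.domain) (Y : PiLp 2 (fun _ : ι ⊕ ι => H)) {wx wv z : ι → H}
    (hx : ∀ j, IsDiag p.e p.om (U.1 (Sum.inl j)) (wx j))
    (hv : ∀ j, IsDiag p.e p.om (U.1 (Sum.inr j)) (wv j))
    (hz : ∀ j, IsDiag p.e (p.damp j) (U.1 (Sum.inr j)) (z j)) :
    ⟪B U, Y⟫_ℂ = ∑ j, (p.α j * (⟪wv j, Y (Sum.inl j)⟫_ℂ - ⟪wx j, Y (Sum.inr j)⟫_ℂ)
      - p.c j * ⟪z j, Y (Sum.inr j)⟫_ℂ) + ∑ j, ∑ k, (p.ε j k : ℂ) * ⟪p.D (wv k), Y (Sum.inr j)⟫_ℂ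
      + ∑ j, ⟪p.Q j U, Y (Sum.inr j)⟫_ℂ := by
  have e1 : ∀ j, B U (Sum.inl j) = (p.α j : ℂ) • wv j := fun j => ext_coef p.e fun n => by
    rw [hB.coef_inl, inner_smul_right, hv j n]
  have e2 : ∀ j, B U (Sum.inr j) = -((p.α j : ℂ) • wx j) - (p.c j : ℂ) • z j
      + ∑ k, (p.ε j k : ℂ) • p.D (wv k) + p.Q j U := fun j => ext_coef p.e fun n => by
    rw [hB.coef_inr]
    simp only [inner_add_right, inner_sub_right, inner_neg_right, inner_smul_right, inner_sum,
      hx j n, hz j n, p.coef_D (hv _)]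
    simp only [mul_neg, Finset.sum_neg_distrib]
    ring
  rw [PiLp.inner_apply, Fintype.sum_sum_type, ← Finset.sum_add_distrib, ← Finset.sum_add_distrib,
    ← Finset.sum_add_distrib]
  refine Finset.sum_congr rfl fun j _ => ?_
  rw [e1, e2]
  simp only [inner_add_left, inner_sub_left, inner_neg_left, inner_smul_left, sum_inner,
    Complex.conj_ofReal]
  ring

theorem exists_isDiag (U : B.domain) : ∃ wx wv z : ι → H,
    (∀ j, IsDiag p.e p.om (U.1 (Sum.inl j)) (wx j)) ∧
    (∀ j, IsDiag p.e p.om (U.1 (Sum.inr j)) (wv j)) ∧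
    ∀ j, IsDiag p.e (p.damp j) (U.1 (Sum.inr j)) (z j) := by
  have h := (hB.mem_domain _).1 U.2
  choose wx hx using fun j => Timoshenko.exists_isDiag p.e (h j).1
  choose wv hv using fun j => Timoshenko.exists_isDiag p.e (h j).2.1
  choose z hz using fun j => Timoshenko.exists_isDiag p.e (h j).2.2
  exact ⟨wx, wv, z, hx, hv, hz⟩

/-- The elastic terms cancel, the damping has a sign, the velocity coupling is skew; only the
bounded perturbation remains. -/
theorem re_inner_le (U : B.domain) : (⟪B U, (U : PiLp 2 (fun _ : ι ⊕ ι => H))⟫_ℂ).re ≤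
    p.bound * ‖(U : PiLp 2 (fun _ : ι ⊕ ι => H))‖ ^ 2 := by
  obtain ⟨wx, wv, z, hx, hv, hz⟩ := hB.exists_isDiag U
  rw [hB.inner_apply U U hx hv hz, Complex.add_re, Complex.add_re, p.re_inner_coupling hv, add_zero]
  have h1 : (∑ j, (p.α j * (⟪wv j, U.1 (Sum.inl j)⟫_ℂ - ⟪wx j, U.1 (Sum.inr j)⟫_ℂ)
      - p.c j * ⟪z j, U.1 (Sum.inr j)⟫_ℂ)).re ≤ 0 := by
    rw [Complex.re_sum]
    refine Finset.sum_nonpos fun j _ => ?_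
    rw [Complex.sub_re, Complex.re_ofReal_mul, Complex.re_ofReal_mul, Complex.sub_re,
      (hx j).inner_eq (hv j), ← inner_conj_symm (U.1 (Sum.inl j)) (wv j), Complex.conj_re, sub_self,
      mul_zero, zero_sub, neg_nonpos]
    exact mul_nonneg (p.c_pos j).le ((hz j).re_inner_nonneg fun n => (p.damp_pos j n).le)
  have h2 := (Complex.re_le_norm _).trans (p.norm_inner_Q_le U U)
  nlinarith

omit hB in
/-- Truncation of all components. -/
noncomputable def truncX (p : WaveData ι H) (N : ℕ) (U : PiLp 2 (fun _ : ι ⊕ ι => H)) :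
    PiLp 2 (fun _ : ι ⊕ ι => H) := WithLp.toLp 2 fun i => trunc p.e N (U i)

omit hB in
theorem tendsto_truncX (U : PiLp 2 (fun _ : ι ⊕ ι => H)) :
    Tendsto (fun N => truncX p N U) atTop (𝓝 U) := by
  refine ((PiLp.continuous_toLp 2 (fun _ : ι ⊕ ι => H)).tendsto _).comp
    (tendsto_pi_nhds.2 fun i => ?_)
  exact tendsto_trunc p.e (U i)

omit hB in
theorem norm_truncX_le (N : ℕ) (U : PiLp 2 (fun _ : ι ⊕ ι => H)) : ‖truncX p N U‖ ≤ ‖U‖ := by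
  rw [← sq_le_sq₀ (norm_nonneg _) (norm_nonneg _), PiLp.norm_sq_eq_of_L2, PiLp.norm_sq_eq_of_L2]
  exact Finset.sum_le_sum fun i _ =>
    (sq_le_sq₀ (norm_nonneg _) (norm_nonneg _)).2 (norm_trunc_le p.e N (U i))

theorem truncX_mem (N : ℕ) (U : PiLp 2 (fun _ : ι ⊕ ι => H)) : truncX p N U ∈ B.domain :=
  (hB.mem_domain _).2 fun _ =>
    ⟨summable_trunc _ _ _ _, summable_trunc _ _ _ _, summable_trunc _ _ _ _⟩

theorem dense_domain : Dense (B.domain : Set (PiLp 2 (fun _ : ι ⊕ ι => H))) := fun U =>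
  mem_closure_of_tendsto (tendsto_truncX (p := p) U)
    (Eventually.of_forall fun N => hB.truncX_mem N U)

/-- Elements of the eigenspaces of the adjoint have velocities in the domain of `A^{1/2}`. -/
theorem exists_isDiag_of_adjoint [DecidableEq ι] {Y : PiLp 2 (fun _ : ι ⊕ ι => H)} {lam : ℝ}
    (hY : ∀ U : B.domain, ⟪B U, Y⟫_ℂ = lam * ⟪(U : PiLp 2 (fun _ : ι ⊕ ι => H)), Y⟫_ℂ) (j : ι) :
    ∃ w, IsDiag p.e p.om (Y (Sum.inr j)) w := by
  set q : PiLp 2 (fun _ : ι ⊕ ι => H) :=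
    ∑ k, ContinuousLinearMap.adjoint (p.Q k) (Y (Sum.inr k)) with hq
  -- Testing with e_n in the j-th position gives -α ω_n ⟨e_n, Y_v⟩ + ⟨e_n, q⟩ = λ ⟨e_n, Y_x⟩; the
  -- witness is what results from solving for ω_n ⟨e_n, Y_v⟩.
  refine ⟨((p.α j)⁻¹ : ℂ) • (q (Sum.inl j) - (lam : ℂ) • Y (Sum.inl j)), fun n => ?_⟩
  set V : PiLp 2 (fun _ : ι ⊕ ι => H) := PiLp.single 2 (Sum.inl j) (p.e n) with hV
  have hVl : ∀ k, V (Sum.inl k) = if k = j then p.e n else 0 := by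
    intro k
    rw [hV, PiLp.single_apply]
    by_cases h : k = j
    · subst h; simp
    · simp [h]
  have hVr : ∀ k, V (Sum.inr k) = 0 := by
    intro k
    rw [hV, PiLp.single_apply]; simp
  have hdx : ∀ k, IsDiag p.e p.om (V (Sum.inl k)) (if k = j then (p.om n : ℂ) • p.e n else 0) := by
    intro k m
    rw [hVl]
    split_ifs
    · rw [inner_smul_right, orthonormal_iff_ite.1 p.e.orthonormal]
      split_ifs with h
      · rw [h]
      · simp
    · simp
  have hdv : ∀ (a : ℕ → ℝ) k, IsDiag p.e a (V (Sum.inr k)) 0 := by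
    intro a k m
    rw [hVr]; simp
  have hmem : V ∈ B.domain := (hB.mem_domain _).2 fun k =>
    ⟨(hdx k).summable, (hdv _ k).summable, (hdv _ k).summable⟩
  have h := hY ⟨V, hmem⟩
  rw [hB.inner_apply ⟨V, hmem⟩ Y (wv := fun _ => 0) (z := fun _ => 0) hdx (hdv _)
    (fun k => hdv _ k)] at h
  have h3 : ∑ k, ⟪p.Q k V, Y (Sum.inr k)⟫_ℂ = ⟪V, q⟫_ℂ := by
    rw [hq, inner_sum]
    exact Finset.sum_congr rfl fun k _ => (ContinuousLinearMap.adjoint_inner_right _ _ _).symm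
  have h4 : ∀ Z : PiLp 2 (fun _ : ι ⊕ ι => H), ⟪V, Z⟫_ℂ = ⟪p.e n, Z (Sum.inl j)⟫_ℂ := by
    intro Z
    rw [PiLp.inner_apply, Fintype.sum_sum_type]
    simp only [hVl, hVr, inner_zero_left, Finset.sum_const_zero, add_zero]
    rw [Finset.sum_eq_single j (fun k _ hk => by simp [hk]) (by simp)]
    simp
  simp only [h3, h4, inner_zero_left, map_zero, mul_zero, Finset.sum_const_zero, zero_sub,
    sub_zero] at h
  rw [Finset.sum_eq_single j (fun k _ hk => by simp [hk]) (by simp)] at h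
  simp only [if_true, inner_smul_left, Complex.conj_ofReal, add_zero] at h
  have hα : (p.α j : ℂ) ≠ 0 := by exact_mod_cast (p.α_pos j).ne'
  rw [inner_smul_right, inner_sub_right, inner_smul_right]
  field_simp
  linear_combination h

/-- Y itself cannot be used as a test vector, but its truncations P_N Y can. Truncation commutes
with the diagonal operators, so the elastic terms cancel and the damping has a sign for every N. It
does not commute with D; the coupling vanishes only in the limit, which exists because A^{1/2} of
the velocities of Y is in L². What is left is λ‖Y‖² ≤ ω‖Y‖² with ω = `p.bound` < λ. -/
theorem eq_zero_of_adjoint {Y : PiLp 2 (fun _ : ι ⊕ ι => H)} {lam : ℝ} (hl : p.bound < lam)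
    (hY : ∀ U : B.domain, ⟪B U, Y⟫_ℂ = lam * ⟪(U : PiLp 2 (fun _ : ι ⊕ ι => H)), Y⟫_ℂ) : Y = 0 := by
  classical
  choose w hw using hB.exists_isDiag_of_adjoint hY
  have hbound : ∀ N : ℕ, lam * (⟪truncX p N Y, Y⟫_ℂ).re ≤
      (∑ j, ∑ k, (p.ε j k : ℂ) * ⟪p.D (trunc p.e N (w k)), Y (Sum.inr j)⟫_ℂ).re
        + p.bound * ‖Y‖ ^ 2 := by
    intro N
    obtain ⟨wx, -, z, hx, -, hz⟩ := hB.exists_isDiag ⟨_, hB.truncX_mem N Y⟩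
    have hwN : ∀ j, IsDiag p.e p.om (truncX p N Y (Sum.inr j)) (trunc p.e N (w j)) := fun j =>
      (hw j).trunc N
    have h := hY ⟨_, hB.truncX_mem N Y⟩
    rw [hB.inner_apply ⟨_, hB.truncX_mem N Y⟩ Y hx hwN hz] at h
    have h' := congrArg Complex.re h
    rw [Complex.re_ofReal_mul, Complex.add_re, Complex.add_re] at h'
    have h1 : (∑ j, (p.α j * (⟪trunc p.e N (w j), Y (Sum.inl j)⟫_ℂ - ⟪wx j, Y (Sum.inr j)⟫_ℂ)
        - p.c j * ⟪z j, Y (Sum.inr j)⟫_ℂ)).re ≤ 0 := by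
      rw [Complex.re_sum]
      refine Finset.sum_nonpos fun j _ => ?_
      have e1 : ⟪wx j, Y (Sum.inr j)⟫_ℂ = ⟪Y (Sum.inl j), trunc p.e N (w j)⟫_ℂ := by
        rw [(hx j).inner_eq (hw j)]
        exact trunc_inner _ _ _ _
      have e2 : ⟪z j, Y (Sum.inr j)⟫_ℂ = ⟪z j, trunc p.e N (Y (Sum.inr j))⟫_ℂ := by
        rw [← trunc_inner]
        congr 1
        refine ext_coef p.e fun n => ?_
        rw [inner_trunc]
        split_ifs with hn
        · rfl
        · rw [hz j n]
          change _ * ⟪p.e n, trunc p.e N _⟫_ℂ = _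
          rw [inner_trunc, if_neg hn, mul_zero]
      rw [Complex.sub_re, Complex.re_ofReal_mul, Complex.re_ofReal_mul, Complex.sub_re, e1,
        ← inner_conj_symm (Y (Sum.inl j)), Complex.conj_re, sub_self, mul_zero, zero_sub,
        neg_nonpos, e2]
      exact mul_nonneg (p.c_pos j).le ((hz j).re_inner_nonneg fun n => (p.damp_pos j n).le)
    have h2 := (Complex.re_le_norm _).trans (p.norm_inner_Q_le (truncX p N Y) Y)
    have h3 : p.bound * ‖truncX p N Y‖ * ‖Y‖ ≤ p.bound * ‖Y‖ * ‖Y‖ := by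
      have := norm_truncX_le (p := p) N Y
      have := p.bound_nonneg
      gcongr
    rw [← h']
    nlinarith
  have hlim1 : Tendsto (fun N => lam * (⟪truncX p N Y, Y⟫_ℂ).re) atTop (𝓝 (lam * ‖Y‖ ^ 2)) := by
    refine Tendsto.const_mul lam ?_
    have h := (Complex.continuous_re.tendsto _).comp
      ((tendsto_truncX (p := p) Y).inner (tendsto_const_nhds (x := Y)) (𝕜 := ℂ))
    rw [inner_self_eq_norm_sq_to_K] at h
    have e2 : ((‖Y‖ : ℂ) ^ 2).re = ‖Y‖ ^ 2 := by rw [← Complex.ofReal_pow, Complex.ofReal_re]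
    erw [e2] at h
    exact h
  have hlim2 : Tendsto (fun N => (∑ j, ∑ k, (p.ε j k : ℂ) *
      ⟪p.D (trunc p.e N (w k)), Y (Sum.inr j)⟫_ℂ).re + p.bound * ‖Y‖ ^ 2) atTop
      (𝓝 (0 + p.bound * ‖Y‖ ^ 2)) := by
    rw [← p.re_inner_coupling hw]
    refine Tendsto.add_const _ ((Complex.continuous_re.tendsto _).comp ?_)
    refine tendsto_finsetSum _ fun j _ => tendsto_finsetSum _ fun k _ => Tendsto.const_mul _ ?_
    exact ((p.D.continuous.tendsto _).comp (tendsto_trunc p.e (w k))).inner tendsto_const_nhds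
  have hfin := le_of_tendsto_of_tendsto hlim1 hlim2 (Eventually.of_forall hbound)
  by_contra hne
  have : 0 < ‖Y‖ ^ 2 := by positivity
  nlinarith

/-- A vector orthogonal to the range of λ - (B - ω) is an eigenvector of the adjoint of B with
eigenvalue λ + ω > ω, hence zero. -/
theorem isPregenerator : IsPregenerator (shiftOp B p.bound) := by
  refine ⟨hB.dense_domain, fun U => ?_, fun lam hl => ?_⟩
  · have h := hB.re_inner_le ⟨U, U.2⟩
    change (⟪B ⟨U, U.2⟩ - (p.bound : ℂ) • U.1, U.1⟫_ℂ).re ≤ 0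
    rw [inner_sub_left, inner_smul_left, Complex.sub_re, Complex.conj_ofReal, Complex.re_ofReal_mul]
    have e : (⟪U.1, U.1⟫_ℂ).re = ‖U.1‖ ^ 2 := inner_self_eq_norm_sq (𝕜 := ℂ) U.1
    rw [e]
    linarith
  · have e : ((LinearMap.range (subOp (shiftOp B p.bound) lam)).topologicalClosure) = ⊤ := by
      rw [Submodule.topologicalClosure_eq_top_iff, Submodule.eq_bot_iff]
      intro Y hY
      refine hB.eq_zero_of_adjoint (lam := lam + p.bound) (by linarith) fun U => ?_
      have h := (Submodule.mem_orthogonal _ _).1 hY _ ⟨(U : (shiftOp B p.bound).domain), rfl⟩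
      change ⟪(lam : ℂ) • U.1 - (B U - (p.bound : ℂ) • U.1), Y⟫_ℂ = 0 at h
      rw [inner_sub_left, inner_sub_left, inner_smul_left, inner_smul_left, Complex.conj_ofReal,
        Complex.conj_ofReal] at h
      push_cast
      linear_combination -h
    exact Submodule.dense_iff_topologicalClosure_eq_top.2 e

end IsWaveOp

end WaveData

/-! ### Square-summable sequences and convolutions -/

section Kernel

theorem rpow_mul_exp_neg_le {x r : ℝ} (hx : 0 ≤ x) (hr : 0 ≤ r) (hr2 : r ≤ 2) :
    x ^ r * Real.exp (-x) ≤ 2 := by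
  have h1 : x ^ r ≤ 1 + x ^ 2 := by
    rcases le_total x 1 with h | h
    · exact (Real.rpow_le_one hx h hr).trans (by nlinarith)
    · have : x ^ r ≤ x ^ (2 : ℝ) := Real.rpow_le_rpow_of_exponent_le h hr2
      rw [Real.rpow_two] at this
      linarith
  have h2 := Real.quadratic_le_exp_of_nonneg hx
  rw [Real.exp_neg, ← div_eq_mul_inv, div_le_iff₀ (Real.exp_pos x)]
  nlinarith

/-- The parabolic smoothing bound: powers of the rate are traded for negative powers of time,
uniformly in the mode. The constant 2 comes from x^r ≤ 1 + x² ≤ 2eˣ. -/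
theorem rpow_mul_exp_neg_mul_le {a r σ : ℝ} (ha : 0 ≤ a) (hσ : 0 < σ) (hr : 0 ≤ r) (hr2 : r ≤ 2) :
    a ^ r * Real.exp (-(a * σ)) ≤ 2 * σ ^ (-r) := by
  have h := rpow_mul_exp_neg_le (mul_nonneg ha hσ.le) hr hr2
  rw [Real.mul_rpow ha hσ.le] at h
  rw [Real.rpow_neg hσ.le, ← div_eq_mul_inv, le_div_iff₀ (Real.rpow_pos_of_pos hσ r)]
  linarith

/-- Variation of constants. -/
theorem eq_add_integral_of_hasDerivAt {y h : ℝ → ℂ} {a t : ℝ} (ht : 0 ≤ t)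
    (hy : ContinuousOn y (Icc 0 t)) (hh : ContinuousOn h (Icc 0 t))
    (hd : ∀ s ∈ Ioo 0 t, HasDerivAt y (-(a * y s) + a * h s) s) :
    y t = Real.exp (-(a * t)) * y 0 +
      ∫ σ in (0 : ℝ)..t, ((a * Real.exp (-(a * σ)) : ℝ) : ℂ) * h (t - σ) := by
  have hm : MapsTo (fun σ => t - σ) (Icc 0 t) (Icc 0 t) := fun σ hσ =>
    ⟨by linarith [hσ.2], by linarith [hσ.1]⟩
  have hcy : ContinuousOn (fun σ => y (t - σ)) (Icc 0 t) := hy.comp (by fun_prop) hm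
  have hch : ContinuousOn (fun σ => h (t - σ)) (Icc 0 t) := hh.comp (by fun_prop) hm
  have key := intervalIntegral.integral_eq_sub_of_hasDerivAt_of_le ht
    (f := fun σ => ((Real.exp (-(a * σ)) : ℝ) : ℂ) * y (t - σ))
    (f' := fun σ => -(((a * Real.exp (-(a * σ)) : ℝ) : ℂ) * h (t - σ)))
    (ContinuousOn.mul (by fun_prop) hcy) (fun σ hσ => ?_) ?_
  · rw [intervalIntegral.integral_neg] at key
    simp only [sub_self, sub_zero, mul_zero, neg_zero, Real.exp_zero, Complex.ofReal_one,
      one_mul] at key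
    linear_combination key
  · have h1 : HasDerivAt (fun σ => Real.exp (-(a * σ))) (Real.exp (-(a * σ)) * -a) σ := by
      simpa using (((hasDerivAt_id σ).const_mul a).neg).exp
    have h2 : HasDerivAt (fun σ => y (t - σ)) (-(-(a * y (t - σ)) + a * h (t - σ))) σ :=
      (hd (t - σ) ⟨by linarith [hσ.2], by linarith [hσ.1]⟩).comp_const_sub t σ
    refine (h1.ofReal_comp.mul h2).congr_deriv ?_
    push_cast
    ring
  · refine ContinuousOn.intervalIntegrable ?_
    rw [uIcc_of_le ht]
    exact (ContinuousOn.mul (by fun_prop) hch).neg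

/-- Integration by parts in the variation of constants formula. -/
theorem integral_kernel_deriv {w h : ℝ → ℂ} {a t : ℝ} (ht : 0 ≤ t)
    (hw : ContinuousOn w (Icc 0 t)) (hh : ContinuousOn h (Icc 0 t))
    (hd : ∀ s ∈ Ioo 0 t, HasDerivAt w (h s) s) :
    ∫ σ in (0 : ℝ)..t, ((a * Real.exp (-(a * σ)) : ℝ) : ℂ) * h (t - σ) =
      ((a * Real.exp (-(a * t)) : ℝ) : ℂ) * (w t - w 0) +
      ∫ σ in (0 : ℝ)..t, ((a ^ 2 * Real.exp (-(a * σ)) : ℝ) : ℂ) * (w t - w (t - σ)) := by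
  have hm : MapsTo (fun σ => t - σ) (Icc 0 t) (Icc 0 t) := fun σ hσ =>
    ⟨by linarith [hσ.2], by linarith [hσ.1]⟩
  have hcw : ContinuousOn (fun σ => w (t - σ)) (Icc 0 t) := hw.comp (by fun_prop) hm
  have hch : ContinuousOn (fun σ => h (t - σ)) (Icc 0 t) := hh.comp (by fun_prop) hm
  have hi1 : IntervalIntegrable (fun σ => ((a * Real.exp (-(a * σ)) : ℝ) : ℂ) * h (t - σ))
      volume 0 t := by
    refine ContinuousOn.intervalIntegrable ?_
    rw [uIcc_of_le ht]
    exact ContinuousOn.mul (by fun_prop) hch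
  have hi2 : IntervalIntegrable (fun σ => ((a ^ 2 * Real.exp (-(a * σ)) : ℝ) : ℂ) *
      (w t - w (t - σ))) volume 0 t := by
    refine ContinuousOn.intervalIntegrable ?_
    rw [uIcc_of_le ht]
    exact ContinuousOn.mul (by fun_prop) (continuousOn_const.sub hcw)
  have key := intervalIntegral.integral_eq_sub_of_hasDerivAt_of_le ht
    (f := fun σ => ((a * Real.exp (-(a * σ)) : ℝ) : ℂ) * (w t - w (t - σ)))
    (f' := fun σ => ((a * Real.exp (-(a * σ)) : ℝ) : ℂ) * h (t - σ) -
      ((a ^ 2 * Real.exp (-(a * σ)) : ℝ) : ℂ) * (w t - w (t - σ)))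
    (ContinuousOn.mul (by fun_prop) (continuousOn_const.sub hcw)) (fun σ hσ => ?_) (hi1.sub hi2)
  · rw [intervalIntegral.integral_sub hi1 hi2] at key
    simp only [sub_self, sub_zero, mul_zero] at key
    linear_combination key
  · have h1 : HasDerivAt (fun σ => a * Real.exp (-(a * σ))) (a * (Real.exp (-(a * σ)) * -a)) σ := by
      refine HasDerivAt.const_mul a ?_
      simpa using (((hasDerivAt_id σ).const_mul a).neg).exp
    have h2 : HasDerivAt (fun σ => w t - w (t - σ)) (h (t - σ)) σ := by
      have := ((hd (t - σ) ⟨by linarith [hσ.2], by linarith [hσ.1]⟩).comp_const_sub t σ).const_sub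
        (w t)
      rwa [neg_neg] at this
    refine (h1.ofReal_comp.mul h2).congr_deriv ?_
    push_cast
    ring

end Kernel

/-! ### Square summability of the convolutions in Duhamel's formula -/

section SqSum

/-- Square summable sequences. -/
def SqSum (x : ℕ → ℂ) : Prop := Summable fun n => ‖x n‖ ^ 2

theorem SqSum.of_sum_le {x : ℕ → ℂ} {C : ℝ} (h : ∀ S : Finset ℕ, ∑ n ∈ S, ‖x n‖ ^ 2 ≤ C) :
    SqSum x := summable_of_sum_le (fun _ => by positivity) h

theorem SqSum.mono {x y : ℕ → ℂ} (hx : SqSum x) {C : ℝ} (h : ∀ n, ‖y n‖ ≤ C * ‖x n‖) : SqSum y := by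
  refine Summable.of_nonneg_of_le (fun _ => by positivity) (fun n => ?_) (Summable.mul_left (C ^ 2) hx)
  rw [← mul_pow]
  exact pow_le_pow_left₀ (norm_nonneg _) (h n) 2

theorem norm_add_sq_le_two {x y : ℂ} : ‖x + y‖ ^ 2 ≤ 2 * ‖x‖ ^ 2 + 2 * ‖y‖ ^ 2 := by
  have h := norm_add_le x y
  nlinarith [norm_nonneg (x + y), sq_nonneg (‖x‖ - ‖y‖), norm_nonneg x, norm_nonneg y]

theorem SqSum.add {x y : ℕ → ℂ} (hx : SqSum x) (hy : SqSum y) : SqSum fun n => x n + y n :=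
  Summable.of_nonneg_of_le (fun _ => by positivity) (fun _ => norm_add_sq_le_two)
    ((Summable.mul_left 2 hx).add (Summable.mul_left 2 hy))

theorem SqSum.const_mul {x : ℕ → ℂ} (hx : SqSum x) (c : ℂ) : SqSum fun n => c * x n :=
  hx.mono (C := ‖c‖) fun n => (norm_mul _ _).le

theorem SqSum.zero : SqSum fun _ => 0 := by simp [SqSum, summable_zero]

theorem SqSum.neg {x : ℕ → ℂ} (hx : SqSum x) : SqSum fun n => -x n :=
  hx.mono (C := 1) fun n => by simp

theorem SqSum.sum {κ : Type*} {s : Finset κ} {x : κ → ℕ → ℂ} (hx : ∀ k, SqSum (x k)) :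
    SqSum fun n => ∑ k ∈ s, x k n := by
  classical
  induction s using Finset.induction_on with
  | empty => simpa using SqSum.zero
  | insert k s hk ih => simpa [Finset.sum_insert hk] using (hx k).add ih

variable {H : Type*} [NormedAddCommGroup H] [InnerProductSpace ℂ H]

theorem sqSum_coef (e : HilbertBasis ℕ ℂ H) (u : H) : SqSum fun n => ⟪e n, u⟫_ℂ :=
  summable_sq_coef e u

theorem sum_sq_coef_le (e : HilbertBasis ℕ ℂ H) (u : H) (S : Finset ℕ) :
    ∑ n ∈ S, ‖⟪e n, u⟫_ℂ‖ ^ 2 ≤ ‖u‖ ^ 2 :=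
  sum_le_hasSum S (fun _ _ => by positivity) (hasSum_sq_coef e u)

variable [CompleteSpace H]

/-- Minkowski's integral inequality for sequences. -/
theorem sum_sq_integral_le (e : HilbertBasis ℕ ℂ H) {t : ℝ} (ht : 0 ≤ t) {k : ℕ → ℝ → ℝ}
    (hk : ∀ n, Continuous (k n)) {G : ℝ → H} (hG : ContinuousOn G (Icc 0 t)) {β : ℝ → ℝ}
    (hβ : IntervalIntegrable β volume 0 t) (S : Finset ℕ)
    (h0 : ∀ σ ∈ Ioc 0 t, 0 ≤ β σ)
    (h : ∀ σ ∈ Ioc 0 t, ∑ n ∈ S, (k n σ * ‖⟪e n, G σ⟫_ℂ‖) ^ 2 ≤ β σ ^ 2) :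
    ∑ n ∈ S, ‖∫ σ in (0 : ℝ)..t, (k n σ : ℂ) * ⟪e n, G σ⟫_ℂ‖ ^ 2 ≤
      (∫ σ in (0 : ℝ)..t, β σ) ^ 2 := by
  have hcoef : ∀ n, ContinuousOn (fun σ => (k n σ : ℂ) * ⟪e n, G σ⟫_ℂ) (Icc 0 t) := fun n =>
    ContinuousOn.mul (Complex.continuous_ofReal.comp (hk n)).continuousOn
      (ContinuousOn.inner continuousOn_const hG)
  -- Collecting the finitely many scalar integrands into one H-valued function reduces the
  -- inequality to ‖∫ F‖ ≤ ∫ ‖F‖.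
  set F : ℝ → H := fun σ => ∑ n ∈ S, ((k n σ : ℂ) * ⟪e n, G σ⟫_ℂ) • e n with hF
  have hFc : ContinuousOn F (Icc 0 t) :=
    continuousOn_finsetSum _ fun n _ => (hcoef n).smul continuousOn_const
  have hFi : IntervalIntegrable F volume 0 t := by
    refine ContinuousOn.intervalIntegrable ?_
    rwa [uIcc_of_le ht]
  have hin : ∀ σ, ∀ m ∈ S, ⟪e m, F σ⟫_ℂ = (k m σ : ℂ) * ⟪e m, G σ⟫_ℂ := by
    intro σ m hm
    simp only [hF, inner_sum, inner_smul_right, orthonormal_iff_ite.1 e.orthonormal m]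
    simp [hm]
  have hnorm : ∀ σ ∈ Ioc 0 t, ‖F σ‖ ≤ β σ := by
    intro σ hσ
    rw [← sq_le_sq₀ (norm_nonneg _) (h0 σ hσ)]
    refine le_trans (le_of_eq ?_) (h σ hσ)
    have h1 : ⟪F σ, F σ⟫_ℂ = _ :=
      e.orthonormal.inner_sum (fun n => (k n σ : ℂ) * ⟪e n, G σ⟫_ℂ) _ S
    rw [← inner_self_eq_norm_sq (𝕜 := ℂ), h1, map_sum]
    refine Finset.sum_congr rfl fun n _ => ?_
    rw [Complex.conj_mul', norm_mul, Complex.norm_real, Real.norm_eq_abs, mul_pow, ← sq_abs (k n σ),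
      ← mul_pow]
    norm_cast
  have hint : ∀ m ∈ S, ⟪e m, ∫ σ in (0 : ℝ)..t, F σ⟫_ℂ =
      ∫ σ in (0 : ℝ)..t, (k m σ : ℂ) * ⟪e m, G σ⟫_ℂ := by
    intro m hm
    have := (innerSL ℂ (e m)).intervalIntegral_comp_comm hFi
    rw [innerSL_apply_apply] at this
    rw [← this]
    exact intervalIntegral.integral_congr fun σ _ => hin σ m hm
  calc _ = ∑ n ∈ S, ‖⟪e n, ∫ σ in (0 : ℝ)..t, F σ⟫_ℂ‖ ^ 2 :=
        Finset.sum_congr rfl fun n hn => by rw [hint n hn]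
    _ ≤ ‖∫ σ in (0 : ℝ)..t, F σ‖ ^ 2 := sum_sq_coef_le e _ S
    _ ≤ _ := by
        refine pow_le_pow_left₀ (norm_nonneg _) ?_ 2
        exact intervalIntegral.norm_integral_le_of_norm_le ht
          (Eventually.of_forall fun σ hσ => hnorm σ hσ) hβ

/-- The convolution `∫₀ᵗ a e^{-aσ} g(t - σ) dσ`, in coefficients. -/
noncomputable def conv (e : HilbertBasis ℕ ℂ H) (a : ℕ → ℝ) (g : ℝ → H) (t : ℝ) (n : ℕ) : ℂ :=
  ∫ σ in (0 : ℝ)..t, ((a n * Real.exp (-(a n * σ)) : ℝ) : ℂ) * ⟪e n, g (t - σ)⟫_ℂ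

theorem continuousOn_comp_sub {E : Type*} [TopologicalSpace E] {g : ℝ → E} {t : ℝ}
    (hg : ContinuousOn g (Icc 0 t)) : ContinuousOn (fun σ => g (t - σ)) (Icc 0 t) :=
  hg.comp (by fun_prop) fun σ hσ => ⟨by linarith [hσ.2], by linarith [hσ.1]⟩

theorem intervalIntegrable_conv (e : HilbertBasis ℕ ℂ H) (a : ℕ → ℝ) {g : ℝ → H} {t : ℝ}
    (ht : 0 ≤ t) (hg : ContinuousOn g (Icc 0 t)) (n : ℕ) : IntervalIntegrable
      (fun σ => ((a n * Real.exp (-(a n * σ)) : ℝ) : ℂ) * ⟪e n, g (t - σ)⟫_ℂ) volume 0 t := by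
  refine ContinuousOn.intervalIntegrable ?_
  rw [uIcc_of_le ht]
  exact ContinuousOn.mul (by fun_prop)
    (ContinuousOn.inner continuousOn_const (continuousOn_comp_sub hg))

theorem conv_add (e : HilbertBasis ℕ ℂ H) (a : ℕ → ℝ) {g h : ℝ → H} {t : ℝ} (ht : 0 ≤ t)
    (hg : ContinuousOn g (Icc 0 t)) (hh : ContinuousOn h (Icc 0 t)) (n : ℕ) :
    conv e a (fun s => g s + h s) t n = conv e a g t n + conv e a h t n := by
  rw [conv, conv, conv, ← intervalIntegral.integral_add (intervalIntegrable_conv e a ht hg n)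
    (intervalIntegrable_conv e a ht hh n)]
  simp only [inner_add_right, mul_add]

theorem conv_smul (e : HilbertBasis ℕ ℂ H) (a : ℕ → ℝ) (g : ℝ → H) (c : ℂ) (t : ℝ) (n : ℕ) :
    conv e a (fun s => c • g s) t n = c * conv e a g t n := by
  rw [conv, conv, ← intervalIntegral.integral_const_mul]
  simp only [inner_smul_right]
  congr 1; ext σ; ring

theorem conv_sum (e : HilbertBasis ℕ ℂ H) (a : ℕ → ℝ) {κ : Type*} (s : Finset κ) {g : κ → ℝ → H}
    {t : ℝ} (ht : 0 ≤ t) (hg : ∀ k, ContinuousOn (g k) (Icc 0 t)) (n : ℕ) :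
    conv e a (fun r => ∑ k ∈ s, g k r) t n = ∑ k ∈ s, conv e a (g k) t n := by
  simp only [conv]
  rw [← intervalIntegral.integral_finsetSum fun k _ => intervalIntegrable_conv e a ht (hg k) n]
  simp only [inner_sum, Finset.mul_sum]

/-- Splitting a = a^r a^{1-r} gives a e^{-aσ} ≤ 2 a^r σ^{r-1}. A weight d that compensates a^r for
some r > 0 thus leaves an integrable singularity, and boundedness of g is enough. The case r = 0,
without any loss, is the one that fails. -/
theorem sum_sq_conv_le (e : HilbertBasis ℕ ℂ H) {a : ℕ → ℝ} (ha : ∀ n, 0 ≤ a n) {g : ℝ → H} {t C : ℝ}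
    (ht : 0 ≤ t) (hg : ContinuousOn g (Icc 0 t)) (hC : ∀ s ∈ Icc 0 t, ‖g s‖ ≤ C) {d : ℕ → ℝ}
    (hd : ∀ n, 0 ≤ d n) {r K : ℝ} (hr : 0 < r) (hr1 : r ≤ 1) (hdK : ∀ n, d n * a n ^ r ≤ K)
    (S : Finset ℕ) : ∑ n ∈ S, (d n * ‖conv e a g t n‖) ^ 2 ≤ (2 * K * C * (t ^ r / r)) ^ 2 := by
  have hC0 : 0 ≤ C := (norm_nonneg _).trans (hC 0 (left_mem_Icc.2 ht))
  have hK0 : 0 ≤ K := (mul_nonneg (hd 0) (Real.rpow_nonneg (ha 0) r)).trans (hdK 0)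
  have hint : ∫ σ in (0 : ℝ)..t, 2 * K * C * σ ^ (r - 1) = 2 * K * C * (t ^ r / r) := by
    rw [intervalIntegral.integral_const_mul, integral_rpow (Or.inl (by linarith))]
    simp [Real.zero_rpow hr.ne']
  have h := sum_sq_integral_le e ht (k := fun n σ => d n * (a n * Real.exp (-(a n * σ))))
    (fun n => by fun_prop) (continuousOn_comp_sub hg) (β := fun σ => 2 * K * C * σ ^ (r - 1))
    ((intervalIntegral.intervalIntegrable_rpow' (by linarith)).const_mul _) S
    (fun σ hσ => by have := Real.rpow_nonneg hσ.1.le (r - 1); positivity) (fun σ hσ => ?_)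
  · rw [hint] at h
    refine le_trans (le_of_eq ?_) h
    refine Finset.sum_congr rfl fun n _ => ?_
    have e1 : ∫ σ in (0 : ℝ)..t, ((d n * (a n * Real.exp (-(a n * σ))) : ℝ) : ℂ) *
        ⟪e n, g (t - σ)⟫_ℂ = d n * conv e a g t n := by
      rw [conv, ← intervalIntegral.integral_const_mul]
      congr 1; ext σ
      push_cast
      ring
    rw [e1, norm_mul, Complex.norm_of_nonneg (hd n)]
  · have hb : ∀ n, d n * (a n * Real.exp (-(a n * σ))) ≤ 2 * K * σ ^ (r - 1) := by
      intro n
      have h1 := rpow_mul_exp_neg_mul_le (r := 1 - r) (ha n) hσ.1 (by linarith) (by linarith)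
      rw [neg_sub] at h1
      have h2 : a n ≤ a n ^ r * a n ^ (1 - r) := by
        rcases (ha n).eq_or_lt with h | h
        · rw [← h, Real.zero_rpow hr.ne', zero_mul]
        · rw [← Real.rpow_add h]; simp
      calc d n * (a n * Real.exp (-(a n * σ)))
          ≤ d n * (a n ^ r * a n ^ (1 - r) * Real.exp (-(a n * σ))) := by
            have := hd n
            gcongr
        _ = (d n * a n ^ r) * (a n ^ (1 - r) * Real.exp (-(a n * σ))) := by ring
        _ ≤ K * (2 * σ ^ (r - 1)) := by
            refine mul_le_mul (hdK n) h1 ?_ hK0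
            have := Real.rpow_nonneg (ha n) (1 - r)
            positivity
        _ = _ := by ring
    have hσ0 := Real.rpow_nonneg hσ.1.le (r - 1)
    calc _ ≤ ∑ n ∈ S, (2 * K * σ ^ (r - 1)) ^ 2 * ‖⟪e n, g (t - σ)⟫_ℂ‖ ^ 2 := by
          refine Finset.sum_le_sum fun n _ => ?_
          rw [mul_pow]
          have := mul_nonneg (hd n) (mul_nonneg (ha n) (Real.exp_pos (-(a n * σ))).le)
          exact mul_le_mul_of_nonneg_right (pow_le_pow_left₀ this (hb n) 2) (by positivity)
      _ ≤ (2 * K * σ ^ (r - 1)) ^ 2 * C ^ 2 := by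
          rw [← Finset.mul_sum]
          gcongr
          refine (sum_sq_coef_le e _ S).trans ?_
          gcongr
          exact hC _ ⟨by linarith [hσ.2], by linarith [hσ.1]⟩
      _ = _ := by ring

/-- The convolution with a Lipschitz function. -/
theorem sqSum_conv_lipschitz (e : HilbertBasis ℕ ℂ H) {a : ℕ → ℝ} (ha : ∀ n, 0 ≤ a n) {g : ℝ → H}
    {t C : ℝ} (ht : 0 ≤ t) (hg : ContinuousOn g (Icc 0 t))
    (hC : ∀ σ ∈ Icc 0 t, ‖g t - g (t - σ)‖ ≤ C * σ) : SqSum (conv e a g t) := by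
  have hc : ContinuousOn (fun σ => g t - g (t - σ)) (Icc 0 t) :=
    continuousOn_const.sub (continuousOn_comp_sub hg)
  -- The value of g at time t is split off. The constant part has the bounded multiplier 1 -
  -- e^{-at}; on the remainder, a e^{-aσ} ≤ 2/σ is compensated by the Lipschitz factor σ.
  have hsplit : ∀ n, conv e a g t n = ((1 - Real.exp (-(a n * t)) : ℝ) : ℂ) * ⟪e n, g t⟫_ℂ
      + -∫ σ in (0 : ℝ)..t, ((a n * Real.exp (-(a n * σ)) : ℝ) : ℂ) *
        ⟪e n, g t - g (t - σ)⟫_ℂ := by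
    intro n
    have h1 : ∫ σ in (0 : ℝ)..t, ((a n * Real.exp (-(a n * σ)) : ℝ) : ℂ) * ⟪e n, g t⟫_ℂ =
        ((1 - Real.exp (-(a n * t)) : ℝ) : ℂ) * ⟪e n, g t⟫_ℂ := by
      rw [intervalIntegral.integral_mul_const, intervalIntegral.integral_ofReal]
      congr 2
      have hd : ∀ σ, HasDerivAt (fun σ => -Real.exp (-(a n * σ)))
          (a n * Real.exp (-(a n * σ))) σ := by
        intro σ
        have : HasDerivAt (fun σ => Real.exp (-(a n * σ))) (Real.exp (-(a n * σ)) * -a n) σ := by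
          simpa using (((hasDerivAt_id σ).const_mul (a n)).neg).exp
        exact this.neg.congr_deriv (by ring)
      rw [intervalIntegral.integral_eq_sub_of_hasDerivAt (fun σ _ => hd σ)
        ((by fun_prop : Continuous _).intervalIntegrable _ _)]
      simp; ring
    rw [← h1, conv, ← sub_eq_add_neg, ← intervalIntegral.integral_sub]
    · congr 1; ext σ
      rw [inner_sub_right]; ring
    · exact ((by fun_prop : Continuous _).intervalIntegrable _ _)
    · refine ContinuousOn.intervalIntegrable ?_
      rw [uIcc_of_le ht]
      exact ContinuousOn.mul (by fun_prop) (ContinuousOn.inner continuousOn_const hc)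
  have e1 : conv e a g t = fun n => _ := funext hsplit
  rw [e1]
  refine SqSum.add ?_ (SqSum.neg ?_)
  · refine (sqSum_coef e (g t)).mono (C := 1) fun n => ?_
    rw [norm_mul]
    gcongr
    rw [Complex.norm_real, Real.norm_eq_abs, abs_le]
    have h1 : Real.exp (-(a n * t)) ≤ 1 := Real.exp_le_one_iff.2 (by
      have := mul_nonneg (ha n) ht; linarith)
    have h2 := Real.exp_pos (-(a n * t))
    constructor <;> linarith
  · have hC0 : ∀ σ ∈ Ioc 0 t, 0 ≤ C := fun σ hσ => by
      have := (norm_nonneg _).trans (hC σ ⟨hσ.1.le, hσ.2⟩)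
      exact nonneg_of_mul_nonneg_left this hσ.1
    refine SqSum.of_sum_le fun S => sum_sq_integral_le e ht
      (k := fun n σ => a n * Real.exp (-(a n * σ))) (fun n => by fun_prop) hc
      (β := fun σ => 2 * C) intervalIntegrable_const S
      (fun σ hσ => by have := hC0 σ hσ; positivity) fun σ hσ => ?_
    have hb : ∀ n, a n * Real.exp (-(a n * σ)) ≤ 2 * σ⁻¹ := by
      intro n
      have := rpow_mul_exp_neg_mul_le (r := 1) (ha n) hσ.1 zero_le_one one_le_two
      rwa [Real.rpow_one, Real.rpow_neg_one] at this
    have hσ := hσ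
    calc _ ≤ ∑ n ∈ S, (2 * σ⁻¹) ^ 2 * ‖⟪e n, g t - g (t - σ)⟫_ℂ‖ ^ 2 := by
          refine Finset.sum_le_sum fun n _ => ?_
          rw [mul_pow]
          have := mul_nonneg (ha n) (Real.exp_pos (-(a n * σ))).le
          exact mul_le_mul_of_nonneg_right (pow_le_pow_left₀ this (hb n) 2) (by positivity)
      _ ≤ (2 * σ⁻¹) ^ 2 * (C * σ) ^ 2 := by
          rw [← Finset.mul_sum]
          gcongr
          refine (sum_sq_coef_le e _ S).trans ?_
          gcongr
          exact hC _ ⟨hσ.1.le, hσ.2⟩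
      _ = _ := by
          have := hσ.1.ne'
          field_simp

/-- The convolution with the derivative of a function that is Hölder continuous in time with values
in a fractional domain. -/
theorem sqSum_conv_deriv (e : HilbertBasis ℕ ℂ H) {a : ℕ → ℝ} (ha : ∀ n, 0 < a n) {g w : ℝ → H}
    {t K q ζ : ℝ} (ht : 0 < t) (hg : ContinuousOn g (Icc 0 t)) (hw : ContinuousOn w (Icc 0 t))
    (hd : ∀ s ∈ Ioo 0 t, HasDerivAt w (g s) s) (hK : 0 ≤ K) (hq : 0 ≤ q) (hq2 : q ≤ 2) (hζ : ζ < q)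
    (hW : ∀ σ ∈ Ioc 0 t, ∀ S : Finset ℕ, ∑ n ∈ S, (a n ^ q * ‖⟪e n, w t - w (t - σ)⟫_ℂ‖) ^ 2 ≤
      (K * σ ^ (1 - ζ)) ^ 2) : SqSum (conv e a g t) := by
  have hc : ContinuousOn (fun σ => w t - w (t - σ)) (Icc 0 t) :=
    continuousOn_const.sub (continuousOn_comp_sub hw)
  have hsplit : ∀ n, conv e a g t n = ((a n * Real.exp (-(a n * t)) : ℝ) : ℂ) * ⟪e n, w t - w 0⟫_ℂ
      + ∫ σ in (0 : ℝ)..t, ((a n ^ 2 * Real.exp (-(a n * σ)) : ℝ) : ℂ) *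
        ⟪e n, w t - w (t - σ)⟫_ℂ := by
    intro n
    have h := integral_kernel_deriv (a := a n) ht.le (w := fun s => ⟪e n, w s⟫_ℂ)
      (h := fun s => ⟪e n, g s⟫_ℂ) (ContinuousOn.inner continuousOn_const hw)
      (ContinuousOn.inner continuousOn_const hg)
      (fun s hs => ((innerSL ℂ (e n)).restrictScalars ℝ).hasFDerivAt.comp_hasDerivAt s (hd s hs))
    rw [conv, h]
    simp only [inner_sub_right]
  have e1 : conv e a g t = fun n => _ := funext hsplit
  rw [e1]
  refine SqSum.add ?_ ?_
  · refine (sqSum_coef e (w t - w 0)).mono (C := 2 * t⁻¹) fun n => ?_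
    rw [norm_mul]
    gcongr
    rw [Complex.norm_of_nonneg (mul_nonneg (ha n).le (Real.exp_pos _).le)]
    have := rpow_mul_exp_neg_mul_le (r := 1) (ha n).le ht zero_le_one one_le_two
    rwa [Real.rpow_one, Real.rpow_neg_one] at this
  · refine SqSum.of_sum_le fun S => sum_sq_integral_le e ht.le
      (k := fun n σ => a n ^ 2 * Real.exp (-(a n * σ))) (fun n => by fun_prop) hc
      (β := fun σ => 2 * K * σ ^ (q - ζ - 1))
      ((intervalIntegral.intervalIntegrable_rpow' (by linarith)).const_mul _) S
      (fun σ hσ => by have := Real.rpow_nonneg hσ.1.le (q - ζ - 1); positivity) fun σ hσ => ?_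
    -- The factor a^q is spent on the increment of w, which is O(σ^{1-ζ}) in that norm. The rest,
    -- a^{2-q} e^{-aσ}, costs σ^{q-2}, and the total exponent q - ζ - 1 exceeds -1 because ζ < q.
    have hb : ∀ n, a n ^ 2 * Real.exp (-(a n * σ)) ≤ 2 * σ ^ (q - 2) * a n ^ q := by
      intro n
      have h1 := rpow_mul_exp_neg_mul_le (r := 2 - q) (ha n).le hσ.1 (by linarith) (by linarith)
      rw [neg_sub] at h1
      have h2 : a n ^ 2 = a n ^ q * a n ^ (2 - q) := by
        rw [← Real.rpow_add (ha n), ← Real.rpow_two]; ring_nf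
      rw [h2, mul_assoc, mul_comm]
      exact mul_le_mul_of_nonneg_right h1 (Real.rpow_nonneg (ha n).le q)
    have hσ0 := Real.rpow_nonneg hσ.1.le (q - 2)
    calc _ ≤ ∑ n ∈ S, (2 * σ ^ (q - 2)) ^ 2 *
            (a n ^ q * ‖⟪e n, w t - w (t - σ)⟫_ℂ‖) ^ 2 := by
          refine Finset.sum_le_sum fun n _ => ?_
          rw [← mul_pow, ← mul_assoc]
          have := mul_nonneg (pow_nonneg (ha n).le 2) (Real.exp_pos (-(a n * σ))).le
          exact pow_le_pow_left₀ (mul_nonneg this (norm_nonneg _))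
            (mul_le_mul_of_nonneg_right (hb n) (norm_nonneg _)) 2
      _ ≤ (2 * σ ^ (q - 2)) ^ 2 * (K * σ ^ (1 - ζ)) ^ 2 := by
          rw [← Finset.mul_sum]
          gcongr
          exact hW σ hσ S
      _ = _ := by
          rw [← mul_pow]
          congr 1
          have : σ ^ (q - ζ - 1) = σ ^ (q - 2) * σ ^ (1 - ζ) := by
            rw [← Real.rpow_add hσ.1]; ring_nf
          rw [this]; ring

/-- Split at the frequency M = σ^{-2/y}: below M the bound A σ in norm is used, above M the bound C
in the stronger norm. This M makes both contributions of order σ^{2-2p/y}. -/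
theorem interpolation (e : HilbertBasis ℕ ℂ H) {X : H} {A C σ p y : ℝ} (hσ : 0 < σ) (hp : 0 ≤ p)
    (hpy : p ≤ y) (hy : 0 < y) (hA : ‖X‖ ≤ A * σ) {S : Finset ℕ}
    (hC : ∑ n ∈ S, ((n : ℝ) + 1) ^ y * ‖⟪e n, X⟫_ℂ‖ ^ 2 ≤ C) :
    ∑ n ∈ S, ((n : ℝ) + 1) ^ p * ‖⟪e n, X⟫_ℂ‖ ^ 2 ≤ (A ^ 2 + C) * σ ^ (2 - 2 * p / y) := by
  set M : ℝ := σ ^ (-2 / y) with hM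
  have hM0 : 0 < M := Real.rpow_pos_of_pos hσ _
  have h1 : ∀ n : ℕ, ((n : ℝ) + 1) ^ p ≤ M ^ p + M ^ (p - y) * ((n : ℝ) + 1) ^ y := by
    intro n
    have hn : (0 : ℝ) < (n : ℝ) + 1 := by positivity
    rcases le_total ((n : ℝ) + 1) M with h | h
    · have := Real.rpow_le_rpow hn.le h hp
      have : 0 ≤ M ^ (p - y) * ((n : ℝ) + 1) ^ y := by positivity
      linarith
    · have h2 : ((n : ℝ) + 1) ^ (p - y) ≤ M ^ (p - y) :=
        Real.rpow_le_rpow_of_nonpos hM0 h (by linarith)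
      have h3 : ((n : ℝ) + 1) ^ p = ((n : ℝ) + 1) ^ (p - y) * ((n : ℝ) + 1) ^ y := by
        rw [← Real.rpow_add hn]; ring_nf
      have : 0 ≤ M ^ p := by positivity
      have h4 := mul_le_mul_of_nonneg_right h2 (Real.rpow_nonneg hn.le y)
      linarith
  have hMp : M ^ p = σ ^ (-(2 * p / y)) := by
    rw [hM, ← Real.rpow_mul hσ.le]; ring_nf
  have hMpy : M ^ (p - y) = σ ^ (2 - 2 * p / y) := by
    rw [hM, ← Real.rpow_mul hσ.le]
    congr 1
    field_simp
    ring
  have hσ2 : σ ^ (2 - 2 * p / y) = σ ^ (-(2 * p / y)) * σ ^ 2 := by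
    rw [← Real.rpow_two, ← Real.rpow_add hσ]; ring_nf
  have hX : ∑ n ∈ S, ‖⟪e n, X⟫_ℂ‖ ^ 2 ≤ (A * σ) ^ 2 :=
    (sum_sq_coef_le e X S).trans (pow_le_pow_left₀ (norm_nonneg _) hA 2)
  have hs0 : 0 ≤ σ ^ (-(2 * p / y)) := Real.rpow_nonneg hσ.le _
  calc _ ≤ ∑ n ∈ S, (M ^ p * ‖⟪e n, X⟫_ℂ‖ ^ 2 +
          M ^ (p - y) * (((n : ℝ) + 1) ^ y * ‖⟪e n, X⟫_ℂ‖ ^ 2)) := by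
        refine Finset.sum_le_sum fun n _ => ?_
        rw [← mul_assoc, ← add_mul]
        exact mul_le_mul_of_nonneg_right (h1 n) (by positivity)
    _ ≤ M ^ p * (A * σ) ^ 2 + M ^ (p - y) * C := by
        rw [Finset.sum_add_distrib, ← Finset.mul_sum, ← Finset.mul_sum]
        gcongr
    _ = _ := by
        rw [hMp, hMpy, add_mul, hσ2]; ring

end SqSum

/-! ### The isometry `D` -/

theorem sum_rpow_neg_half_le (k : ℕ) :
    ∑ n ∈ Finset.range k, ((n : ℝ) + 1) ^ (-(1 / 2) : ℝ) ≤ 2 * (k : ℝ) ^ (1 / 2 : ℝ) := by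
  induction k with
  | zero => simp
  | succ k ih =>
    rw [Finset.sum_range_succ, Nat.cast_succ]
    have hk : (0 : ℝ) ≤ k := by positivity
    have e : ((k : ℝ) + 1) ^ (-(1 / 2) : ℝ) = (√((k : ℝ) + 1))⁻¹ := by
      rw [Real.rpow_neg (by positivity), ← Real.sqrt_eq_rpow]
    rw [e]
    rw [← Real.sqrt_eq_rpow] at ih ⊢
    set x := √(k : ℝ)
    set y := √((k : ℝ) + 1)
    have hx : x ^ 2 = k := Real.sq_sqrt hk
    have hy : y ^ 2 = k + 1 := Real.sq_sqrt (by positivity)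
    have hy0 : 0 < y := Real.sqrt_pos.2 (by positivity)
    have hxy : y⁻¹ ≤ 2 * y - 2 * x := by
      rw [inv_le_iff_one_le_mul₀ hy0]
      nlinarith [sq_nonneg (x - y)]
    linarith

theorem sum_inv_sq_tail_le (S : Finset ℕ) (M : ℕ) (hM : 1 ≤ M) :
    ∑ m ∈ S with M ≤ m + 1, (((m : ℝ) + 1) ^ 2)⁻¹ ≤ 2 / (M : ℝ) := by
  obtain ⟨R, hR⟩ := S.exists_nat_subset_range
  have h := sum_Ioo_inv_sq_le (α := ℝ) (M - 1) (R + 1)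
  have e : ((M - 1 : ℕ) : ℝ) + 1 = M := by rw [← Nat.cast_succ]; congr 1; omega
  rw [e] at h
  refine le_trans ?_ h
  have hinj : Set.InjOn (fun m : ℕ => m + 1) (S.filter fun m => M ≤ m + 1) :=
    (add_left_injective 1).injOn
  have : ∑ m ∈ S with M ≤ m + 1, (((m : ℝ) + 1) ^ 2)⁻¹ =
      ∑ i ∈ (S.filter fun m => M ≤ m + 1).image (fun m : ℕ => (m + 1 : ℕ)), (((i : ℕ) : ℝ) ^ 2)⁻¹ := by
    rw [Finset.sum_image hinj]
    exact Finset.sum_congr rfl fun m _ => by push_cast; rfl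
  rw [this]
  refine Finset.sum_le_sum_of_subset_of_nonneg ?_ fun _ _ _ => by positivity
  intro i hi
  obtain ⟨m, hm, rfl⟩ := Finset.mem_image.1 hi
  obtain ⟨h1, h2⟩ := Finset.mem_filter.1 hm
  have := Finset.mem_range.1 (hR h1)
  exact Finset.mem_Ioo.2 ⟨by omega, by omega⟩

namespace WaveData

variable {ι H : Type*} [Fintype ι] [NormedAddCommGroup H] [InnerProductSpace ℂ H] [CompleteSpace H]

/-- Every mode n kept by the truncation satisfies 2(n+1) ≤ M ≤ m+1, so `decay` applies to each
overlap. The sum is then bounded by Cauchy-Schwarz with weights (n+1)^{±1/2}. -/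
theorem norm_coef_D_trunc_le (p : WaveData ι H) {X : H} {K : ℝ}
    (hK : ∀ S : Finset ℕ, ∑ n ∈ S, ((n : ℝ) + 1) ^ (1 / 2 : ℝ) * ‖⟪p.e n, X⟫_ℂ‖ ^ 2 ≤ K)
    {m M : ℕ} (hM : M ≤ m + 1) :
    ‖⟪p.e m, p.D (trunc p.e (M / 2) X)⟫_ℂ‖ ^ 2 ≤
      8 * K * (M : ℝ) ^ (1 / 2 : ℝ) * (((m : ℝ) + 1) ^ 2)⁻¹ := by
  have hD : ∀ n, p.D (p.e n) = p.f n := by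
    intro n
    have h := hasSum_basisMap p.e p.orthonormal (p.e n)
    refine h.unique ((hasSum_ite_eq n (p.f n)).congr_fun fun k => ?_)
    rw [orthonormal_iff_ite.1 p.e.orthonormal]
    split_ifs with h
    · rw [h, one_smul]
    · rw [zero_smul]
  have h1 : ⟪p.e m, p.D (trunc p.e (M / 2) X)⟫_ℂ =
      ∑ n ∈ Finset.range (M / 2), ⟪p.e n, X⟫_ℂ * ⟪p.e m, p.f n⟫_ℂ := by
    rw [trunc_apply, map_sum, inner_sum]
    exact Finset.sum_congr rfl fun n _ => by rw [map_smul, inner_smul_right, hD]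
  have h2 : ‖⟪p.e m, p.D (trunc p.e (M / 2) X)⟫_ℂ‖ ≤
      2 / (m + 1) * ∑ n ∈ Finset.range (M / 2), ‖⟪p.e n, X⟫_ℂ‖ := by
    rw [h1, Finset.mul_sum]
    refine norm_sum_le_of_le _ fun n hn => ?_
    rw [norm_mul, mul_comm]
    have := Finset.mem_range.1 hn
    exact mul_le_mul_of_nonneg_right (p.decay m n (by omega)) (norm_nonneg _)
  have h3 : (∑ n ∈ Finset.range (M / 2), ‖⟪p.e n, X⟫_ℂ‖) ^ 2 ≤
      (2 * (M : ℝ) ^ (1 / 2 : ℝ)) * K := by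
    have hcs := Finset.sum_sq_le_sum_mul_sum_of_sq_le_mul (Finset.range (M / 2))
      (r := fun n => ‖⟪p.e n, X⟫_ℂ‖) (f := fun n : ℕ => ((n : ℝ) + 1) ^ (-(1 / 2) : ℝ))
      (g := fun n : ℕ => ((n : ℝ) + 1) ^ (1 / 2 : ℝ) * ‖⟪p.e n, X⟫_ℂ‖ ^ 2)
      (fun n _ => by positivity) (fun n _ => by positivity) (fun n _ => by
        rw [← mul_assoc, ← Real.rpow_add (by positivity)]; simp)
    refine hcs.trans (mul_le_mul ?_ (hK _) (Finset.sum_nonneg fun _ _ => by positivity)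
      (by positivity))
    refine (sum_rpow_neg_half_le _).trans ?_
    gcongr
    exact Nat.div_le_self M 2
  calc _ ≤ (2 / (m + 1) * ∑ n ∈ Finset.range (M / 2), ‖⟪p.e n, X⟫_ℂ‖) ^ 2 :=
        pow_le_pow_left₀ (norm_nonneg _) h2 2
    _ = 4 * (((m : ℝ) + 1) ^ 2)⁻¹ * (∑ n ∈ Finset.range (M / 2), ‖⟪p.e n, X⟫_ℂ‖) ^ 2 := by
        rw [mul_pow, div_pow, div_eq_mul_inv]; norm_num
    _ ≤ 4 * (((m : ℝ) + 1) ^ 2)⁻¹ * ((2 * (M : ℝ) ^ (1 / 2 : ℝ)) * K) := by gcongr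
    _ = _ := by ring

theorem norm_sub_trunc_le (e : HilbertBasis ℕ ℂ H) {X : H} {K : ℝ}
    (hK : ∀ S : Finset ℕ, ∑ n ∈ S, ((n : ℝ) + 1) ^ (1 / 2 : ℝ) * ‖⟪e n, X⟫_ℂ‖ ^ 2 ≤ K)
    {M : ℕ} (hM : 1 ≤ M) :
    ‖X - trunc e (M / 2) X‖ ^ 2 ≤ 2 * K * (M : ℝ) ^ (-(1 / 2) : ℝ) := by
  have hM0 : (0 : ℝ) < M := by exact_mod_cast hM
  refine le_of_tendsto' (hasSum_sq_coef e (X - trunc e (M / 2) X)) fun S => ?_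
  have h1 : ∀ n : ℕ, ‖⟪e n, X - trunc e (M / 2) X⟫_ℂ‖ ^ 2 ≤
      2 * (M : ℝ) ^ (-(1 / 2) : ℝ) * (((n : ℝ) + 1) ^ (1 / 2 : ℝ) * ‖⟪e n, X⟫_ℂ‖ ^ 2) := by
    intro n
    rw [inner_sub_right, inner_trunc]
    split_ifs with h
    · rw [sub_self, norm_zero, zero_pow two_ne_zero]; positivity
    · rw [sub_zero, ← mul_assoc]
      refine le_mul_of_one_le_left (by positivity) ?_
      have h2 : (M : ℝ) ≤ 2 * ((n : ℝ) + 1) := by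
        have : M ≤ 2 * (n + 1) := by omega
        exact_mod_cast this
      rw [Real.rpow_neg hM0.le, mul_assoc, mul_comm, mul_assoc, inv_mul_eq_div, ← div_mul_eq_mul_div₀,
        div_mul_eq_mul_div, le_div_iff₀ (by positivity), one_mul]
      have h3 := Real.rpow_le_rpow hM0.le h2 (by norm_num : (0 : ℝ) ≤ 1 / 2)
      rw [Real.mul_rpow (by norm_num) (by positivity)] at h3
      have h4 : (2 : ℝ) ^ (1 / 2 : ℝ) ≤ 2 := by
        have := Real.rpow_le_rpow_of_exponent_le (by norm_num : (1 : ℝ) ≤ 2)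
          (by norm_num : (1 / 2 : ℝ) ≤ 1)
        rwa [Real.rpow_one] at this
      have h5 : (0 : ℝ) ≤ ((n : ℝ) + 1) ^ (1 / 2 : ℝ) := by positivity
      nlinarith
  refine (Finset.sum_le_sum fun n _ => h1 n).trans ?_
  rw [← Finset.mul_sum]
  calc _ ≤ 2 * (M : ℝ) ^ (-(1 / 2) : ℝ) * K := by
        gcongr
        exact hK S
    _ = _ := by ring

/-- Split X at frequency M/2. Low modes reach the output modes above M only through small overlaps;
high modes are small in norm and D is an isometry. Both parts are O(M^{-1/2}), and 36 = 2·16 + 2·2.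
-/
theorem sum_tail_D_le (p : WaveData ι H) {X : H} {K : ℝ}
    (hK : ∀ S : Finset ℕ, ∑ n ∈ S, ((n : ℝ) + 1) ^ (1 / 2 : ℝ) * ‖⟪p.e n, X⟫_ℂ‖ ^ 2 ≤ K)
    (S : Finset ℕ) {M : ℕ} (hM : 1 ≤ M) :
    ∑ m ∈ S with M ≤ m + 1, ‖⟪p.e m, p.D X⟫_ℂ‖ ^ 2 ≤ 36 * K * (M : ℝ) ^ (-(1 / 2) : ℝ) := by
  have hM0 : (0 : ℝ) < M := by exact_mod_cast hM
  have hK0 : 0 ≤ K := by simpa using hK ∅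
  have hsplit : ∀ m : ℕ, ‖⟪p.e m, p.D X⟫_ℂ‖ ^ 2 ≤
      2 * ‖⟪p.e m, p.D (trunc p.e (M / 2) X)⟫_ℂ‖ ^ 2 +
      2 * ‖⟪p.e m, p.D (X - trunc p.e (M / 2) X)⟫_ℂ‖ ^ 2 := by
    intro m
    have h := norm_add_sq_le_two (x := ⟪p.e m, p.D (trunc p.e (M / 2) X)⟫_ℂ)
      (y := ⟪p.e m, p.D (X - trunc p.e (M / 2) X)⟫_ℂ)
    rwa [← inner_add_right, ← map_add, add_sub_cancel] at h
  have hlow : ∑ m ∈ S with M ≤ m + 1, ‖⟪p.e m, p.D (trunc p.e (M / 2) X)⟫_ℂ‖ ^ 2 ≤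
      16 * K * (M : ℝ) ^ (-(1 / 2) : ℝ) := by
    calc _ ≤ ∑ m ∈ S with M ≤ m + 1,
          8 * K * (M : ℝ) ^ (1 / 2 : ℝ) * (((m : ℝ) + 1) ^ 2)⁻¹ :=
          Finset.sum_le_sum fun m hm => p.norm_coef_D_trunc_le hK (Finset.mem_filter.1 hm).2
      _ ≤ 8 * K * (M : ℝ) ^ (1 / 2 : ℝ) * (2 / M) := by
          rw [← Finset.mul_sum]
          have := sum_inv_sq_tail_le S M hM
          gcongr
      _ = _ := by
          have : (M : ℝ) ^ (-(1 / 2) : ℝ) = (M : ℝ) ^ (1 / 2 : ℝ) * (M : ℝ) ^ (-1 : ℝ) := by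
            rw [← Real.rpow_add hM0]; norm_num
          rw [this, Real.rpow_neg_one, div_eq_mul_inv]; ring
  have hhigh : ∑ m ∈ S with M ≤ m + 1, ‖⟪p.e m, p.D (X - trunc p.e (M / 2) X)⟫_ℂ‖ ^ 2 ≤
      2 * K * (M : ℝ) ^ (-(1 / 2) : ℝ) := by
    refine (sum_sq_coef_le p.e _ _).trans ?_
    rw [D, norm_basisMap]
    exact norm_sub_trunc_le p.e hK hM
  calc _ ≤ ∑ m ∈ S with M ≤ m + 1, (2 * ‖⟪p.e m, p.D (trunc p.e (M / 2) X)⟫_ℂ‖ ^ 2 +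
        2 * ‖⟪p.e m, p.D (X - trunc p.e (M / 2) X)⟫_ℂ‖ ^ 2) :=
        Finset.sum_le_sum fun m _ => hsplit m
    _ ≤ _ := by
        rw [Finset.sum_add_distrib, ← Finset.mul_sum, ← Finset.mul_sum]
        linarith

/-- `D` maps fractional domains of small order to fractional domains. -/
theorem exists_sum_D_le (p : WaveData ι H) {r : ℝ} (hr : r < 1 / 2) : ∃ C : ℝ, 0 ≤ C ∧
    ∀ (X : H) (K : ℝ),
      (∀ S : Finset ℕ, ∑ n ∈ S, ((n : ℝ) + 1) ^ (1 / 2 : ℝ) * ‖⟪p.e n, X⟫_ℂ‖ ^ 2 ≤ K) →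
      ∀ S : Finset ℕ, ∑ m ∈ S, ((m : ℝ) + 1) ^ r * ‖⟪p.e m, p.D X⟫_ℂ‖ ^ 2 ≤ C * K := by
  have hsum : Summable fun n : ℕ => (n : ℝ) ^ (r - 1 - 1 / 2) :=
    Real.summable_nat_rpow.2 (by linarith)
  have hpos : ∀ n : ℕ, 0 ≤ (n : ℝ) ^ (r - 1 - 1 / 2) := fun n => by positivity
  refine ⟨36 * ∑' n : ℕ, (n : ℝ) ^ (r - 1 - 1 / 2),
    mul_nonneg (by norm_num) (tsum_nonneg hpos), fun X K hK S => ?_⟩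
  have hK0 : 0 ≤ K := by simpa using hK ∅
  obtain ⟨R, hR⟩ := S.exists_nat_subset_range
  -- Summation by layers: (m+1)^r is m+1 copies of (m+1)^{r-1} ≤ M^{r-1}. After exchanging the sums,
  -- the tail bound leaves ∑ M^{r-1-1/2}, convergent since r < 1/2.
  have hw : ∀ m ∈ S, ((m : ℝ) + 1) ^ r ≤
      ∑ M ∈ Finset.Icc 1 R with M ≤ m + 1, (M : ℝ) ^ (r - 1) := by
    intro m hm
    have hmR := Finset.mem_range.1 (hR hm)
    have e : (Finset.Icc 1 R).filter (fun M => M ≤ m + 1) = Finset.Icc 1 (m + 1) := by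
      ext M; simp only [Finset.mem_filter, Finset.mem_Icc]; omega
    rw [e]
    calc ((m : ℝ) + 1) ^ r = ∑ _M ∈ Finset.Icc 1 (m + 1), ((m : ℝ) + 1) ^ (r - 1) := by
          rw [Finset.sum_const, Nat.card_Icc, nsmul_eq_mul]
          simp only [add_tsub_cancel_right]
          rw [Real.rpow_sub_one (by positivity)]
          push_cast
          field_simp
      _ ≤ _ := by
          refine Finset.sum_le_sum fun M hM => ?_
          obtain ⟨h1, h2⟩ := Finset.mem_Icc.1 hM
          refine Real.rpow_le_rpow_of_nonpos (by exact_mod_cast h1) (by exact_mod_cast h2)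
            (by linarith)
  calc _ ≤ ∑ m ∈ S, ∑ M ∈ Finset.Icc 1 R with M ≤ m + 1,
          (M : ℝ) ^ (r - 1) * ‖⟪p.e m, p.D X⟫_ℂ‖ ^ 2 := by
        refine Finset.sum_le_sum fun m hm => ?_
        rw [← Finset.sum_mul]
        exact mul_le_mul_of_nonneg_right (hw m hm) (by positivity)
    _ = ∑ M ∈ Finset.Icc 1 R, (M : ℝ) ^ (r - 1) *
          ∑ m ∈ S with M ≤ m + 1, ‖⟪p.e m, p.D X⟫_ℂ‖ ^ 2 := by
        simp_rw [Finset.sum_filter, Finset.mul_sum]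
        rw [Finset.sum_comm]
        refine Finset.sum_congr rfl fun M _ => Finset.sum_congr rfl fun m _ => ?_
        split_ifs <;> simp
    _ ≤ ∑ M ∈ Finset.Icc 1 R, 36 * K * (M : ℝ) ^ (r - 1 - 1 / 2) := by
        refine Finset.sum_le_sum fun M hM => ?_
        have h1 := (Finset.mem_Icc.1 hM).1
        have hM0 : (0 : ℝ) < M := by exact_mod_cast h1
        have h2 := p.sum_tail_D_le hK S h1
        calc _ ≤ (M : ℝ) ^ (r - 1) * (36 * K * (M : ℝ) ^ (-(1 / 2) : ℝ)) := by gcongr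
          _ = _ := by rw [sub_eq_add_neg (r - 1), Real.rpow_add hM0]; ring
    _ ≤ 36 * K * ∑' n : ℕ, (n : ℝ) ^ (r - 1 - 1 / 2) := by
        rw [← Finset.mul_sum]
        gcongr
        exact hsum.sum_le_tsum _ fun n _ => hpos n
    _ = _ := by ring

end WaveData

/-! ### Continuously differentiable orbits -/

/-- The form of `sqSum_conv_deriv` for polynomial rates: the squared weight a_n^{2q} is a constant
times (n+1)^{4ηq}. -/
theorem sqSum_conv_fractional {H : Type*} [NormedAddCommGroup H] [InnerProductSpace ℂ H]
    [CompleteSpace H] (e : HilbertBasis ℕ ℂ H) {a : ℕ → ℝ} {a₀ η : ℝ} (ha₀ : 0 < a₀)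
    (ha : ∀ n : ℕ, a n = a₀ * ((n : ℝ) + 1) ^ (2 * η)) {g w : ℝ → H} {t K q ζ : ℝ} (ht : 0 < t)
    (hg : ContinuousOn g (Icc 0 t)) (hw : ContinuousOn w (Icc 0 t))
    (hd : ∀ s ∈ Ioo 0 t, HasDerivAt w (g s) s) (hK : 0 ≤ K) (hq : 0 ≤ q) (hq2 : q ≤ 2) (hζ : ζ < q)
    (hW : ∀ σ ∈ Ioc 0 t, ∀ S : Finset ℕ,
      ∑ n ∈ S, ((n : ℝ) + 1) ^ (4 * η * q) * ‖⟪e n, w t - w (t - σ)⟫_ℂ‖ ^ 2 ≤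
        K * σ ^ (2 - 2 * ζ)) : SqSum (conv e a g t) := by
  refine sqSum_conv_deriv e (fun n => by rw [ha]; positivity) ht hg hw hd
    (K := a₀ ^ q * √K) (by positivity) hq hq2 hζ fun σ hσ S => ?_
  have e1 : (a₀ ^ q * √K * σ ^ (1 - ζ)) ^ 2 = (a₀ ^ q) ^ 2 * (K * σ ^ (2 - 2 * ζ)) := by
    rw [mul_pow, mul_pow, Real.sq_sqrt hK, mul_assoc, ← Real.rpow_mul_natCast hσ.1.le]
    congr 3
    push_cast; ring
  rw [e1]
  refine le_trans (le_of_eq ?_) (mul_le_mul_of_nonneg_left (hW σ hσ S) (by positivity))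
  rw [Finset.mul_sum]
  refine Finset.sum_congr rfl fun n _ => ?_
  rw [ha, mul_pow, Real.mul_rpow ha₀.le (by positivity), mul_pow, mul_assoc,
    ← Real.rpow_mul (by positivity), ← Real.rpow_mul_natCast (x := (n : ℝ) + 1) (by positivity),
    show 2 * η * q * (2 : ℕ) = 4 * η * q by push_cast; ring]

namespace WaveData

variable {ι H : Type*} [Fintype ι] [NormedAddCommGroup H] [InnerProductSpace ℂ H]

/-- Continuously differentiable solutions of the system, in coefficients; `z = u'`. -/
structure IsOrbit (p : WaveData ι H) (u z : ℝ → PiLp 2 (fun _ : ι ⊕ ι => H)) : Prop where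
  cont : ContinuousOn u (Ici 0)
  cont' : ContinuousOn z (Ici 0)
  deriv : ∀ t ∈ Ici (0 : ℝ), HasDerivWithinAt u (z t) (Ici 0) t
  coef_inl : ∀ t ∈ Ici (0 : ℝ), ∀ (j : ι) (n : ℕ), ⟪p.e n, z t (Sum.inl j)⟫_ℂ =
    p.α j * (p.om n * ⟪p.e n, u t (Sum.inr j)⟫_ℂ)
  coef_inr : ∀ t ∈ Ici (0 : ℝ), ∀ (j : ι) (n : ℕ), ⟪p.e n, z t (Sum.inr j)⟫_ℂ =
    -(p.α j * (p.om n * ⟪p.e n, u t (Sum.inl j)⟫_ℂ))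
      - p.c j * (p.damp j n * ⟪p.e n, u t (Sum.inr j)⟫_ℂ)
      - ∑ k, p.ε j k * (p.om n * ⟪p.f n, u t (Sum.inr k)⟫_ℂ) + ⟪p.e n, p.Q j (u t)⟫_ℂ

/-- The rates at which the slow modes decay. -/
noncomputable def rate (p : WaveData ι H) (j : ι) (n : ℕ) : ℝ :=
  p.α j ^ 2 * p.om n ^ 2 / (p.c j * p.damp j n)

theorem rate_pos (p : WaveData ι H) (j : ι) (n : ℕ) : 0 < p.rate j n :=
  div_pos (mul_pos (pow_pos (p.α_pos j) 2) (pow_pos (p.om_pos n) 2))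
    (mul_pos (p.c_pos j) (p.damp_pos j n))

/-- The constant in `rate`. -/
noncomputable def rate₀ (p : WaveData ι H) (j : ι) : ℝ :=
  p.α j ^ 2 / p.c j * p.freq ^ (2 * (1 - p.s j))

theorem rate₀_pos (p : WaveData ι H) (j : ι) : 0 < p.rate₀ j :=
  mul_pos (div_pos (pow_pos (p.α_pos j) 2) (p.c_pos j)) (Real.rpow_pos_of_pos p.freq_pos _)

theorem rate_eq (p : WaveData ι H) (j : ι) (n : ℕ) :
    p.rate j n = p.rate₀ j * ((n : ℝ) + 1) ^ (2 * (1 - p.s j)) := by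
  have hc := (p.c_pos j).ne'
  rw [rate₀, mul_assoc, ← Real.mul_rpow p.freq_pos.le (by positivity), rate, damp, ← om]
  have : p.om n ^ (2 * (1 - p.s j)) = p.om n ^ 2 / p.om n ^ (2 * p.s j) := by
    rw [mul_sub, mul_one, Real.rpow_sub (p.om_pos n), Real.rpow_two]
  rw [this]
  have := (Real.rpow_pos_of_pos (p.om_pos n) (2 * p.s j)).ne'
  field_simp

variable [CompleteSpace H]

/-- The source term in the equation for the slow modes. -/
noncomputable def source (p : WaveData ι H) (u z : ℝ → PiLp 2 (fun _ : ι ⊕ ι => H)) (j : ι) (t : ℝ) :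
    H :=
  ((-1 : ℂ) • z t (Sum.inr j) + ∑ k, (p.ε j k : ℂ) • p.D (((p.α k)⁻¹ : ℂ) • z t (Sum.inl k)))
    + p.Q j (u t)

/-! ### Duhamel's formula for the positions and its first consequences -/

namespace IsOrbit

variable {p : WaveData ι H} {u z : ℝ → PiLp 2 (fun _ : ι ⊕ ι => H)} (h : p.IsOrbit u z)

omit [CompleteSpace H] in
theorem _root_.Timoshenko.continuousOn_piLp_apply {s : Set ℝ} {u : ℝ → PiLp 2 (fun _ : ι ⊕ ι => H)}
    (hu : ContinuousOn u s) (i : ι ⊕ ι) : ContinuousOn (fun t => u t i) s :=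
  (PiLp.proj (𝕜 := ℂ) 2 (fun _ : ι ⊕ ι => H) i).continuous.comp_continuousOn hu

include h

theorem isDiag {t : ℝ} (ht : 0 ≤ t) (j : ι) :
    IsDiag p.e p.om (u t (Sum.inr j)) (((p.α j)⁻¹ : ℂ) • z t (Sum.inl j)) := fun n => by
  have hα : (p.α j : ℂ) ≠ 0 := by exact_mod_cast (p.α_pos j).ne'
  rw [inner_smul_right, h.coef_inl t ht, ← mul_assoc, inv_mul_cancel₀ hα, one_mul]

/-- The velocity equation solved for the damping term. Both v' and ∂ₓv = D(x'/α) are continuous in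
time along a C¹ orbit, so they count as source terms. -/
theorem damp_eq {t : ℝ} (ht : 0 ≤ t) (j : ι) (n : ℕ) :
    p.c j * (p.damp j n * ⟪p.e n, u t (Sum.inr j)⟫_ℂ) =
      -(p.α j * (p.om n * ⟪p.e n, u t (Sum.inl j)⟫_ℂ)) + ⟪p.e n, p.source u z j t⟫_ℂ := by
  have h1 := h.coef_inr t ht j n
  simp only [source, inner_add_right, inner_smul_right, inner_sum, p.coef_D (h.isDiag ht _)]
  rw [h1]
  simp only [mul_neg, Finset.sum_neg_distrib]
  ring

theorem continuousOn_source (j : ι) : ContinuousOn (p.source u z j) (Ici 0) := by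
  have h1 := fun i => continuousOn_piLp_apply h.cont' i
  refine (((h1 _).const_smul _).add (continuousOn_finsetSum _ fun k _ => ?_)).add
    ((p.Q j).continuous.comp_continuousOn h.cont)
  exact (p.D.continuous.comp_continuousOn ((h1 _).const_smul _)).const_smul _

theorem hasDerivAt_apply {t : ℝ} (ht : 0 < t) (i : ι ⊕ ι) :
    HasDerivAt (fun t => u t i) (z t i) t :=
  ((PiLp.proj (𝕜 := ℂ) 2 (fun _ : ι ⊕ ι => H) i).restrictScalars ℝ).hasFDerivAt.comp_hasDerivAt t
    ((h.deriv t ht.le).hasDerivAt (Ici_mem_nhds ht))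

/-- Eliminating v between x' = α A^{1/2} v and `damp_eq` gives a scalar relaxation equation with
rate a_n = α²ω_n²/(c ω_n^{2s}) for each coefficient of A^{1/2} x; this is its variation of constants
formula. -/
theorem om_mul_coef_eq {t : ℝ} (ht : 0 ≤ t) (j : ι) (n : ℕ) :
    p.om n * ⟪p.e n, u t (Sum.inl j)⟫_ℂ =
      Real.exp (-(p.rate j n * t)) * (p.om n * ⟪p.e n, u 0 (Sum.inl j)⟫_ℂ) +
        ((p.α j)⁻¹ : ℂ) * conv p.e (p.rate j) (p.source u z j) t n := by
  have hα : (p.α j : ℂ) ≠ 0 := by exact_mod_cast (p.α_pos j).ne'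
  have hc : (p.c j : ℂ) ≠ 0 := by exact_mod_cast (p.c_pos j).ne'
  have hda : (p.damp j n : ℂ) ≠ 0 := by exact_mod_cast (p.damp_pos j n).ne'
  have hsub : Icc 0 t ⊆ Ici 0 := Icc_subset_Ici_self
  have key := eq_add_integral_of_hasDerivAt (a := p.rate j n) ht
    (y := fun t => (p.om n : ℂ) * ⟪p.e n, u t (Sum.inl j)⟫_ℂ)
    (h := fun t => ((p.α j)⁻¹ : ℂ) * ⟪p.e n, p.source u z j t⟫_ℂ)
    (continuousOn_const.mul (ContinuousOn.inner continuousOn_const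
      ((continuousOn_piLp_apply h.cont _).mono hsub)))
    (continuousOn_const.mul (ContinuousOn.inner continuousOn_const
      ((h.continuousOn_source j).mono hsub))) (fun s hs => ?_)
  · rw [key, conv, ← intervalIntegral.integral_const_mul]
    congr 2; ext σ; ring
  · have h1 : HasDerivAt (fun s => (p.om n : ℂ) * ⟪p.e n, u s (Sum.inl j)⟫_ℂ)
        (p.om n * ⟪p.e n, z s (Sum.inl j)⟫_ℂ) s :=
      HasDerivAt.const_mul _ (((innerSL ℂ (p.e n)).restrictScalars ℝ).hasFDerivAt.comp_hasDerivAt s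
        (h.hasDerivAt_apply hs.1 (Sum.inl j)))
    refine h1.congr_deriv ?_
    have h2 := h.damp_eq hs.1.le j n
    rw [h.coef_inl s hs.1.le, rate]
    push_cast
    field_simp
    linear_combination (p.om n : ℂ) ^ 2 * h2

theorem exists_bound (t : ℝ) : ∃ C : ℝ, 0 ≤ C ∧ (∀ s ∈ Icc 0 t, ‖u s‖ ≤ C) ∧
    (∀ s ∈ Icc 0 t, ‖z s‖ ≤ C) ∧ ∀ j, ∀ s ∈ Icc 0 t, ‖p.source u z j s‖ ≤ C := by
  have hsub : Icc 0 t ⊆ Ici 0 := Icc_subset_Ici_self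
  obtain ⟨C₁, h1⟩ := isCompact_Icc.exists_bound_of_continuousOn (h.cont.mono hsub)
  obtain ⟨C₂, h2⟩ := isCompact_Icc.exists_bound_of_continuousOn (h.cont'.mono hsub)
  choose C₃ h3 using fun j =>
    isCompact_Icc.exists_bound_of_continuousOn ((h.continuousOn_source j).mono hsub)
  have hle : ∀ j, |C₃ j| ≤ ∑ j, |C₃ j| := fun j =>
    Finset.single_le_sum (f := fun j => |C₃ j|) (fun _ _ => abs_nonneg _) (Finset.mem_univ j)
  have hs0 : 0 ≤ ∑ j, |C₃ j| := Finset.sum_nonneg fun _ _ => abs_nonneg _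
  refine ⟨|C₁| + |C₂| + ∑ j, |C₃ j|, by positivity, fun s hs => ?_, fun s hs => ?_,
    fun j s hs => ?_⟩
  · have := h1 s hs; have := le_abs_self C₁; have := abs_nonneg C₂; linarith
  · have := h2 s hs; have := le_abs_self C₂; have := abs_nonneg C₁; linarith
  · have := h3 j s hs; have := le_abs_self (C₃ j); have := hle j
    have := abs_nonneg C₁; have := abs_nonneg C₂; linarith

theorem norm_sub_le {t C : ℝ} (hC : ∀ s ∈ Icc 0 t, ‖z s‖ ≤ C) {σ : ℝ} (hσ : σ ∈ Icc 0 t) :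
    ‖u t - u (t - σ)‖ ≤ C * σ := by
  have h0 : 0 ≤ t := hσ.1.trans hσ.2
  have := Convex.norm_image_sub_le_of_norm_hasDerivWithin_le (s := Icc 0 t) (x := t - σ) (y := t)
    (fun s hs => (h.deriv s hs.1).mono Icc_subset_Ici_self) hC (convex_Icc 0 t)
    ⟨by linarith [hσ.2], by linarith [hσ.1]⟩ ⟨h0, le_rfl⟩
  rwa [sub_sub_cancel, Real.norm_of_nonneg hσ.1] at this

/-- The positions lie in the domains of all powers of `A^{1/2}` less than the first. -/
theorem exists_sum_le (h0 : ∀ j, SqSum fun n => (p.om n : ℂ) * ⟪p.e n, u 0 (Sum.inl j)⟫_ℂ)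
    (t : ℝ) {y : ℝ} (hy : 0 ≤ y) (hy2 : y < 2) (j : ι) : ∃ C : ℝ, 0 ≤ C ∧ ∀ s ∈ Icc 0 t,
      ∀ S : Finset ℕ, ∑ n ∈ S, ((n : ℝ) + 1) ^ y * ‖⟪p.e n, u s (Sum.inl j)⟫_ℂ‖ ^ 2 ≤ C := by
  obtain ⟨C, hC0, -, -, hC⟩ := h.exists_bound t
  -- With this r the weight d_n a_n^r grows with exponent (y/2 - 1) + (1-s)(1 - y/2) = -s(1 - y/2) ≤
  -- 0, whatever s is.
  set r : ℝ := (1 - y / 2) / 2 with hr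
  have hr0 : 0 < r := by rw [hr]; linarith
  set d : ℕ → ℝ := fun n => ((n : ℝ) + 1) ^ (y / 2 - 1) with hd
  have hd0 : ∀ n, 0 ≤ d n := fun n => by simp only [hd]; positivity
  have hd1 : ∀ n, d n ≤ 1 := fun n =>
    Real.rpow_le_one_of_one_le_of_nonpos (by simp) (by linarith)
  have hdK : ∀ n, d n * p.rate j n ^ r ≤ p.rate₀ j ^ r := by
    intro n
    rw [p.rate_eq, Real.mul_rpow (p.rate₀_pos j).le (by positivity), mul_left_comm,
      ← Real.rpow_mul (by positivity), hd, ← Real.rpow_add (by positivity)]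
    refine mul_le_of_le_one_right (Real.rpow_nonneg (p.rate₀_pos j).le _) ?_
    refine Real.rpow_le_one_of_one_le_of_nonpos (by simp) ?_
    have := p.s_nonneg j
    rw [hr]
    nlinarith
  set M : ℝ := 2 * p.rate₀ j ^ r * C * (|t| ^ r / r) with hM
  have hM0 : 0 ≤ M := by
    have := Real.rpow_nonneg (p.rate₀_pos j).le r
    positivity
  set T : ℝ := ∑' n, ‖(p.om n : ℂ) * ⟪p.e n, u 0 (Sum.inl j)⟫_ℂ‖ ^ 2 with hT
  have hT0 : 0 ≤ T := tsum_nonneg fun _ => by positivity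
  have hα := p.α_pos j
  have hf := p.freq_pos
  refine ⟨(p.freq ^ 2)⁻¹ * (2 * T + 2 * ((p.α j)⁻¹ ^ 2 * M ^ 2)), by positivity, fun s hs S => ?_⟩
  have hterm : ∀ n : ℕ, ((n : ℝ) + 1) ^ y * ‖⟪p.e n, u s (Sum.inl j)⟫_ℂ‖ ^ 2 ≤
      (p.freq ^ 2)⁻¹ * (2 * ‖(p.om n : ℂ) * ⟪p.e n, u 0 (Sum.inl j)⟫_ℂ‖ ^ 2 + 2 *
        ((p.α j)⁻¹ ^ 2 * (d n * ‖conv p.e (p.rate j) (p.source u z j) s n‖) ^ 2)) := by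
    intro n
    have e1 : ((n : ℝ) + 1) ^ y * ‖⟪p.e n, u s (Sum.inl j)⟫_ℂ‖ ^ 2 =
        (p.freq ^ 2)⁻¹ * (d n ^ 2 * ‖(p.om n : ℂ) * ⟪p.e n, u s (Sum.inl j)⟫_ℂ‖ ^ 2) := by
      rw [norm_mul, Complex.norm_of_nonneg (p.om_pos n).le, om, mul_pow, mul_pow]
      have : d n ^ 2 * ((n : ℝ) + 1) ^ 2 = ((n : ℝ) + 1) ^ y := by
        simp only [hd]
        rw [← Real.rpow_two, ← Real.rpow_two, ← Real.rpow_mul (by positivity),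
          ← Real.rpow_add (by positivity)]
        congr 1; ring
      rw [← this]
      field_simp
    rw [e1]
    refine mul_le_mul_of_nonneg_left ?_ (by positivity)
    rw [h.om_mul_coef_eq hs.1]
    refine (mul_le_mul_of_nonneg_left norm_add_sq_le_two (by positivity)).trans ?_
    rw [mul_add]
    refine add_le_add ?_ (le_of_eq ?_)
    · rw [norm_mul (Real.exp _ : ℂ), mul_pow, mul_left_comm]
      refine mul_le_mul_of_nonneg_left ?_ zero_le_two
      rw [← mul_assoc]
      refine mul_le_of_le_one_left (by positivity) ?_
      rw [← mul_pow]
      refine pow_le_one₀ (mul_nonneg (hd0 n) (norm_nonneg _)) ?_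
      refine mul_le_one₀ (hd1 n) (norm_nonneg _) ?_
      rw [Complex.norm_of_nonneg (Real.exp_pos _).le]
      exact Real.exp_le_one_iff.2 (by
        have := mul_nonneg (p.rate_pos j n).le hs.1; linarith)
    · rw [norm_mul, norm_inv, Complex.norm_of_nonneg hα.le]
      ring
  have hT1 : ∑ n ∈ S, ‖(p.om n : ℂ) * ⟪p.e n, u 0 (Sum.inl j)⟫_ℂ‖ ^ 2 ≤ T :=
    (h0 j).sum_le_tsum S fun _ _ => by positivity
  have hM1 : ∑ n ∈ S, (d n * ‖conv p.e (p.rate j) (p.source u z j) s n‖) ^ 2 ≤ M ^ 2 := by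
    refine (sum_sq_conv_le p.e (fun n => (p.rate_pos j n).le) hs.1
      ((h.continuousOn_source j).mono Icc_subset_Ici_self)
      (fun r hr => hC j r ⟨hr.1, hr.2.trans hs.2⟩) hd0 hr0 (by rw [hr]; linarith) hdK S).trans ?_
    have h1 := Real.rpow_nonneg (p.rate₀_pos j).le r
    have h2 : s ^ r ≤ |t| ^ r :=
      Real.rpow_le_rpow hs.1 (hs.2.trans (le_abs_self t)) hr0.le
    have h3 := Real.rpow_nonneg hs.1 r
    rw [hM]
    gcongr
  refine (Finset.sum_le_sum fun n _ => hterm n).trans ?_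
  rw [← Finset.mul_sum, Finset.sum_add_distrib, ← Finset.mul_sum, ← Finset.mul_sum,
    ← Finset.mul_sum]
  gcongr

end IsOrbit

end WaveData

/-! ### Invariance of the domain -/

namespace WaveData

variable {ι H : Type*} [Fintype ι] [NormedAddCommGroup H] [InnerProductSpace ℂ H] [CompleteSpace H]

namespace IsOrbit

variable {p : WaveData ι H} {u z : ℝ → PiLp 2 (fun _ : ι ⊕ ι => H)} (h : p.IsOrbit u z)

theorem _root_.Timoshenko.sum_sq_coef_sub_le {H : Type*} [NormedAddCommGroup H]
    [InnerProductSpace ℂ H] (e : HilbertBasis ℕ ℂ H) {x y : H} {a : ℕ → ℝ} (ha : ∀ n, 0 ≤ a n)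
    {C : ℝ} {S : Finset ℕ} (hx : ∑ n ∈ S, a n * ‖⟪e n, x⟫_ℂ‖ ^ 2 ≤ C)
    (hy : ∑ n ∈ S, a n * ‖⟪e n, y⟫_ℂ‖ ^ 2 ≤ C) :
    ∑ n ∈ S, a n * ‖⟪e n, x - y⟫_ℂ‖ ^ 2 ≤ 4 * C := by
  have : ∀ n ∈ S, a n * ‖⟪e n, x - y⟫_ℂ‖ ^ 2 ≤
      2 * (a n * ‖⟪e n, x⟫_ℂ‖ ^ 2) + 2 * (a n * ‖⟪e n, y⟫_ℂ‖ ^ 2) := by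
    intro n _
    have h1 := norm_add_sq_le_two (x := ⟪e n, x⟫_ℂ) (y := -⟪e n, y⟫_ℂ)
    rw [← sub_eq_add_neg, ← inner_sub_right, norm_neg] at h1
    have := mul_le_mul_of_nonneg_left h1 (ha n)
    linarith
  refine (Finset.sum_le_sum this).trans ?_
  rw [Finset.sum_add_distrib, ← Finset.mul_sum, ← Finset.mul_sum]
  linarith

include h

/-- As x' = α A^{1/2} v, a bound for the derivative of the orbit is a bound for v in D(A^{1/2}). -/
theorem sum_om_sq_le {C : ℝ} {t : ℝ} (ht : 0 ≤ t) (hC : ‖z t‖ ≤ C) (j : ι) (S : Finset ℕ) :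
    ∑ n ∈ S, ((n : ℝ) + 1) ^ (2 : ℝ) * ‖⟪p.e n, u t (Sum.inr j)⟫_ℂ‖ ^ 2 ≤
      ((p.freq * p.α j)⁻¹ * C) ^ 2 := by
  have hf := p.freq_pos
  have hα := p.α_pos j
  have e1 : ∀ n : ℕ, ((n : ℝ) + 1) ^ (2 : ℝ) * ‖⟪p.e n, u t (Sum.inr j)⟫_ℂ‖ ^ 2 =
      (p.freq * p.α j)⁻¹ ^ 2 * ‖⟪p.e n, z t (Sum.inl j)⟫_ℂ‖ ^ 2 := by
    intro n
    rw [h.coef_inl t ht, norm_mul, norm_mul, Complex.norm_of_nonneg hα.le,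
      Complex.norm_of_nonneg (p.om_pos n).le, om, Real.rpow_two]
    field_simp
  rw [Finset.sum_congr rfl fun n _ => e1 n, ← Finset.mul_sum, mul_pow]
  refine mul_le_mul_of_nonneg_left ((sum_sq_coef_le _ _ _).trans ?_) (by positivity)
  exact pow_le_pow_left₀ (norm_nonneg _) ((PiLp.norm_apply_le _ _).trans hC) 2

/-- Here w = v is Lipschitz in L² and bounded in D(A^{1/2}). Interpolation in the norm weighted by
the full rate (q = 1) gives the loss ζ = 2(1-s), and ζ < 1 is exactly s > 1/2. -/
theorem sqSum_conv_inr {t : ℝ} (ht : 0 < t) (j : ι) (hs : 1 / 2 < p.s j) :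
    SqSum (conv p.e (p.rate j) (fun s => z s (Sum.inr j)) t) := by
  obtain ⟨C, hC0, -, hC, -⟩ := h.exists_bound t
  have hsub : Icc 0 t ⊆ Ici 0 := Icc_subset_Ici_self
  have hsle := p.s_le j
  refine sqSum_conv_fractional p.e (p.rate₀_pos j) (p.rate_eq j) (w := fun s => u s (Sum.inr j))
    (K := C ^ 2 + 4 * ((p.freq * p.α j)⁻¹ * C) ^ 2) (q := 1) (ζ := 2 * (1 - p.s j)) ht
    ((continuousOn_piLp_apply h.cont' _).mono hsub) ((continuousOn_piLp_apply h.cont _).mono hsub)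
    (fun s hs => h.hasDerivAt_apply hs.1 _) (by positivity) zero_le_one one_le_two (by linarith)
    fun σ hσ S => ?_
  have := interpolation p.e (X := u t (Sum.inr j) - u (t - σ) (Sum.inr j)) (A := C) hσ.1
    (p := 4 * (1 - p.s j)) (y := 2) (by linarith) (by linarith) two_pos
    ((PiLp.norm_apply_le (u t - u (t - σ)) (Sum.inr j)).trans (h.norm_sub_le hC ⟨hσ.1.le, hσ.2⟩))
    (S := S) (sum_sq_coef_sub_le p.e (fun n => by positivity)
      (h.sum_om_sq_le ht.le (hC t (right_mem_Icc.2 ht.le)) j S)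
      (h.sum_om_sq_le (by linarith [hσ.2]) (hC _ ⟨by linarith [hσ.2], by linarith [hσ.1]⟩) j S))
  convert this using 3
  · rw [mul_one]
  · ring

theorem sqSum_conv_D (h0 : ∀ j, SqSum fun n => (p.om n : ℂ) * ⟪p.e n, u 0 (Sum.inl j)⟫_ℂ)
    {t : ℝ} (ht : 0 < t) (j k : ι) (hs : 1 / 2 < p.s j) :
    SqSum (conv p.e (p.rate j) (fun s => p.D (((p.α k)⁻¹ : ℂ) • z s (Sum.inl k))) t) := by
  obtain ⟨C, hC0, -, hC, -⟩ := h.exists_bound t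
  have hsub : Icc 0 t ⊆ Ici 0 := Icc_subset_Ici_self
  have hsle := p.s_le j
  have hα := p.α_pos k
  set η : ℝ := 1 - p.s j with hη
  have hη0 : 0 ≤ η := by linarith
  have hη1 : η < 1 / 2 := by linarith
  -- Three constraints must hold: y < 2 for `exists_sum_le`, 4ηq < 1/2 for the bound on D, and ζ =
  -- 1/(2y) < q for `sqSum_conv_deriv`. With these y and q each of them is equivalent to 2η < 1. The
  -- loss ζ comes from interpolating x at the weight exponent 1/2 that D requires.
  set y : ℝ := (3 + 2 * η) / 2 with hy
  set q : ℝ := 1 / (2 * (1 + 2 * η)) with hq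
  have hq1 : q ≤ 1 / 2 := by
    rw [hq]; exact one_div_le_one_div_of_le two_pos (by linarith)
  obtain ⟨C₁, hC₁, hx⟩ := h.exists_sum_le h0 t (y := y) (by linarith) (by linarith) k
  obtain ⟨C₂, hC₂, hD⟩ := p.exists_sum_D_le (r := 4 * η * q) (by
    rw [hq, mul_one_div, div_lt_iff₀ (by positivity)]; linarith)
  set T : H →L[ℂ] H := p.D ∘L (((p.α k)⁻¹ : ℂ) • ContinuousLinearMap.id ℂ H)
  refine sqSum_conv_fractional p.e (p.rate₀_pos j) (p.rate_eq j)
    (w := fun s => T (u s (Sum.inl k))) (g := fun s => T (z s (Sum.inl k)))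
    (K := C₂ * ((p.α k)⁻¹ ^ 2 * (C ^ 2 + 4 * C₁))) (q := q) (ζ := 1 / (2 * y)) ht
    (T.continuous.comp_continuousOn ((continuousOn_piLp_apply h.cont' _).mono hsub))
    (T.continuous.comp_continuousOn ((continuousOn_piLp_apply h.cont _).mono hsub))
    (fun s hs => (T.restrictScalars ℝ).hasFDerivAt.comp_hasDerivAt s (h.hasDerivAt_apply hs.1 _))
    (by positivity) (by positivity) (by linarith) ?_ fun σ hσ S => ?_
  · rw [hq]; exact one_div_lt_one_div_of_lt (by positivity) (by rw [hy]; linarith)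
  rw [← map_sub]
  refine (hD (((p.α k)⁻¹ : ℂ) • (u t (Sum.inl k) - u (t - σ) (Sum.inl k)))
    ((p.α k)⁻¹ ^ 2 * ((C ^ 2 + 4 * C₁) * σ ^ (2 - 2 * (1 / 2) / y))) (fun S => ?_) S).trans
    (le_of_eq ?_)
  · have := interpolation p.e (X := u t (Sum.inl k) - u (t - σ) (Sum.inl k)) (A := C) hσ.1
      (p := 1 / 2) (y := y) (by norm_num) (by linarith) (by linarith)
      ((PiLp.norm_apply_le (u t - u (t - σ)) (Sum.inl k)).trans
        (h.norm_sub_le hC ⟨hσ.1.le, hσ.2⟩))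
      (S := S) (sum_sq_coef_sub_le p.e (fun n => by positivity)
        (hx t (right_mem_Icc.2 ht.le) S)
        (hx _ ⟨by linarith [hσ.2], by linarith [hσ.1]⟩ S))
    refine le_trans (le_of_eq ?_) (mul_le_mul_of_nonneg_left this (sq_nonneg (p.α k)⁻¹))
    rw [Finset.mul_sum]
    refine Finset.sum_congr rfl fun n _ => ?_
    rw [inner_smul_right, norm_mul, norm_inv, Complex.norm_of_nonneg hα.le]
    ring
  · rw [show 2 - 2 * (1 / 2) / y = 2 - 2 * (1 / (2 * y)) by field_simp]
    ring

theorem sqSum_conv_Q {t : ℝ} (ht : 0 < t) (j : ι) :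
    SqSum (conv p.e (p.rate j) (fun s => p.Q j (u s)) t) := by
  obtain ⟨C, hC0, -, hC, -⟩ := h.exists_bound t
  refine sqSum_conv_lipschitz p.e (fun n => (p.rate_pos j n).le) ht.le
    ((p.Q j).continuous.comp_continuousOn (h.cont.mono Icc_subset_Ici_self)) (C := ‖p.Q j‖ * C)
    fun σ hσ => ?_
  rw [← map_sub, mul_assoc]
  exact ((p.Q j).le_opNorm _).trans
    (mul_le_mul_of_nonneg_left (h.norm_sub_le hC hσ) (norm_nonneg _))

theorem sqSum_om_inr {t : ℝ} (ht : 0 ≤ t) (j : ι) :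
    SqSum fun n => (p.om n : ℂ) * ⟪p.e n, u t (Sum.inr j)⟫_ℂ := by
  refine (sqSum_coef p.e (((p.α j)⁻¹ : ℂ) • z t (Sum.inl j))).mono (C := 1) fun n => ?_
  rw [h.isDiag ht j n, one_mul]

/-- In the velocity equation the source is in L², so the elastic and the damping term are in L²
together; this lemma and the next are the two directions. -/
theorem sqSum_damp_of_om {t : ℝ} (ht : 0 ≤ t) {j : ι}
    (h1 : SqSum fun n => (p.om n : ℂ) * ⟪p.e n, u t (Sum.inl j)⟫_ℂ) :
    SqSum fun n => (p.damp j n : ℂ) * ⟪p.e n, u t (Sum.inr j)⟫_ℂ := by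
  have hc : (p.c j : ℂ) ≠ 0 := by exact_mod_cast (p.c_pos j).ne'
  have := (((h1.const_mul (p.α j)).neg.add (sqSum_coef p.e (p.source u z j t))).const_mul
    (p.c j : ℂ)⁻¹).mono (C := 1)
    (y := fun n => (p.damp j n : ℂ) * ⟪p.e n, u t (Sum.inr j)⟫_ℂ) fun n => by
      rw [← h.damp_eq ht j n, inv_mul_cancel_left₀ hc, one_mul]
  exact this

theorem sqSum_om_of_damp {t : ℝ} (ht : 0 ≤ t) {j : ι}
    (h1 : SqSum fun n => (p.damp j n : ℂ) * ⟪p.e n, u t (Sum.inr j)⟫_ℂ) :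
    SqSum fun n => (p.om n : ℂ) * ⟪p.e n, u t (Sum.inl j)⟫_ℂ := by
  have hα : (p.α j : ℂ) ≠ 0 := by exact_mod_cast (p.α_pos j).ne'
  have := (((h1.const_mul (p.c j)).neg.add (sqSum_coef p.e (p.source u z j t))).const_mul
    (p.α j : ℂ)⁻¹).mono (C := 1)
    (y := fun n => (p.om n : ℂ) * ⟪p.e n, u t (Sum.inl j)⟫_ℂ) fun n => by
      rw [h.damp_eq ht j n, neg_add, neg_neg, add_assoc, neg_add_cancel, add_zero,
        inv_mul_cancel_left₀ hα, one_mul]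
  exact this

/-- The decisive part of the invariance of D(B): the velocities lie in D(A^{1/2}) for free, and the
damping term then follows from the velocity equation. -/
theorem sqSum_om_inl (h0 : ∀ j, SqSum fun n => (p.om n : ℂ) * ⟪p.e n, u 0 (Sum.inl j)⟫_ℂ)
    {t : ℝ} (ht : 0 ≤ t) (j : ι) : SqSum fun n => (p.om n : ℂ) * ⟪p.e n, u t (Sum.inl j)⟫_ℂ := by
  rcases ht.eq_or_lt with rfl | htpos
  · exact h0 j
  rcases le_or_gt (p.s j) (1 / 2) with hs | hs
  · refine h.sqSum_om_of_damp ht ?_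
    -- For s ≤ 1/2 the damping is no stronger than A^{1/2}, so it is in L² together with A^{1/2} v.
    -- The constant is the value of ω^{2s-1} at the lower bound `p.freq` of the frequencies.
    have hf := p.freq_pos
    refine (h.sqSum_om_inr ht j).mono (C := p.freq ^ (2 * p.s j - 1)) fun n => ?_
    rw [norm_mul, norm_mul, Complex.norm_of_nonneg (p.om_pos n).le,
      Complex.norm_of_nonneg (p.damp_pos j n).le, ← mul_assoc]
    refine mul_le_mul_of_nonneg_right ?_ (norm_nonneg _)
    have e1 : p.damp j n = p.om n ^ (2 * p.s j - 1) * p.om n := by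
      rw [damp, Real.rpow_sub_one (p.om_pos n).ne', div_mul_cancel₀ _ (p.om_pos n).ne']
    rw [e1]
    refine mul_le_mul_of_nonneg_right ?_ (p.om_pos n).le
    refine Real.rpow_le_rpow_of_nonpos hf ?_ (by linarith)
    rw [om]
    exact le_mul_of_one_le_right hf.le (by simp)
  have hsub : Icc 0 t ⊆ Ici 0 := Icc_subset_Ici_self
  have c1 := fun i => (continuousOn_piLp_apply h.cont' i).mono hsub
  have c2 : ∀ k, ContinuousOn (fun s => (p.ε j k : ℂ) • p.D (((p.α k)⁻¹ : ℂ) • z s (Sum.inl k)))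
      (Icc 0 t) := fun k =>
    (p.D.continuous.comp_continuousOn ((c1 _).const_smul _)).const_smul _
  have hsrc : SqSum (conv p.e (p.rate j) (p.source u z j) t) := by
    have : conv p.e (p.rate j) (p.source u z j) t = fun n =>
        ((-1 : ℂ) * conv p.e (p.rate j) (fun s => z s (Sum.inr j)) t n + ∑ k, (p.ε j k : ℂ) *
          conv p.e (p.rate j) (fun s => p.D (((p.α k)⁻¹ : ℂ) • z s (Sum.inl k))) t n) +
          conv p.e (p.rate j) (fun s => p.Q j (u s)) t n := by
      ext n
      unfold source
      have c3 : ContinuousOn (fun s => (-1 : ℂ) • z s (Sum.inr j)) (Icc 0 t) :=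
        (c1 _).const_smul _
      have c4 : ContinuousOn (fun s => ∑ k, (p.ε j k : ℂ) •
          p.D (((p.α k)⁻¹ : ℂ) • z s (Sum.inl k))) (Icc 0 t) :=
        continuousOn_finsetSum _ fun k _ => c2 k
      have c5 : ContinuousOn (fun s => (-1 : ℂ) • z s (Sum.inr j) + ∑ k, (p.ε j k : ℂ) •
          p.D (((p.α k)⁻¹ : ℂ) • z s (Sum.inl k))) (Icc 0 t) := c3.add c4
      have c6 : ContinuousOn (fun s => p.Q j (u s)) (Icc 0 t) :=
        (p.Q j).continuous.comp_continuousOn (h.cont.mono hsub)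
      rw [conv_add _ _ ht c5 c6, conv_add _ _ ht c3 c4, conv_sum _ _ _ ht c2, conv_smul]
      simp only [conv_smul]
    rw [this]
    exact (((h.sqSum_conv_inr htpos j hs).const_mul _).add
      (SqSum.sum fun k => (h.sqSum_conv_D h0 htpos j k hs).const_mul _)).add
      (h.sqSum_conv_Q htpos j)
  refine (((h0 j).mono (C := 1)
    (y := fun n => (Real.exp (-(p.rate j n * t)) : ℂ) * (p.om n * ⟪p.e n, u 0 (Sum.inl j)⟫_ℂ))
    fun n => ?_).add (hsrc.const_mul ((p.α j)⁻¹ : ℂ))).mono (C := 1) fun n => ?_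
  · rw [norm_mul]
    refine mul_le_mul_of_nonneg_right ?_ (norm_nonneg _)
    rw [Complex.norm_of_nonneg (Real.exp_pos _).le]
    exact Real.exp_le_one_iff.2 (by have := mul_nonneg (p.rate_pos j n).le ht; linarith)
  · rw [h.om_mul_coef_eq ht j n, one_mul]

end IsOrbit

theorem _root_.Timoshenko.sqSum_ofReal_mul_iff {a : ℕ → ℝ} {x : ℕ → ℂ} :
    (SqSum fun n => (a n : ℂ) * x n) ↔ Summable fun n => a n ^ 2 * ‖x n‖ ^ 2 := by
  simp [SqSum, mul_pow]

theorem IsWaveOp.mem_graph_of_isOrbit {p : WaveData ι H}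
    {B : PiLp 2 (fun _ : ι ⊕ ι => H) →ₗ.[ℂ] PiLp 2 (fun _ : ι ⊕ ι => H)} (hB : p.IsWaveOp B)
    {u z : ℝ → PiLp 2 (fun _ : ι ⊕ ι => H)} (h : p.IsOrbit u z) (h0 : u 0 ∈ B.domain) {t : ℝ}
    (ht : 0 ≤ t) : (u t, z t) ∈ B.graph := by
  have hinit : ∀ j, SqSum fun n => (p.om n : ℂ) * ⟪p.e n, u 0 (Sum.inl j)⟫_ℂ := fun j =>
    sqSum_ofReal_mul_iff.2 ((hB.mem_domain _).1 h0 j).1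
  have hx := fun j => h.sqSum_om_inl hinit ht j
  have hmem : u t ∈ B.domain := (hB.mem_domain _).2 fun j =>
    ⟨sqSum_ofReal_mul_iff.1 (hx j), sqSum_ofReal_mul_iff.1 (h.sqSum_om_inr ht j),
      sqSum_ofReal_mul_iff.1 (h.sqSum_damp_of_om ht (hx j))⟩
  refine (LinearPMap.mem_graph_iff _).2 ⟨⟨u t, hmem⟩, rfl, ?_⟩
  refine PiLp.ext fun i => ext_coef p.e fun n => ?_
  rcases i with j | j
  · rw [hB.coef_inl, h.coef_inl t ht]
  · rw [hB.coef_inr, h.coef_inr t ht]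

/-- Each coefficient of B U is a bounded functional of U, because the derivative in the coupling has
been moved to the f_n. These are test pairs for the weak equation, so the coefficient equations hold
along the orbit before it is known to stay in the domain. -/
theorem IsWaveOp.isOrbit {p : WaveData ι H}
    {B : PiLp 2 (fun _ : ι ⊕ ι => H) →ₗ.[ℂ] PiLp 2 (fun _ : ι ⊕ ι => H)} (hB : p.IsWaveOp B)
    {S : ℝ → PiLp 2 (fun _ : ι ⊕ ι => H) →L[ℂ] PiLp 2 (fun _ : ι ⊕ ι => H)}
    (hS : IsSolutionOp B S) (x : B.domain) :
    p.IsOrbit (fun t => S t x) (fun t => S t (B x)) := by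
  have key : ∀ ℓ m : PiLp 2 (fun _ : ι ⊕ ι => H) →L[ℂ] ℂ, (∀ y : B.domain, ℓ (B y) = m y) →
      ∀ t ∈ Ici (0 : ℝ), ℓ (S t (B x)) = m (S t x) := fun ℓ m hℓ t ht =>
    (uniqueDiffOn_Ici 0 t ht).eq_deriv _
      ((ℓ.restrictScalars ℝ).hasFDerivAt.comp_hasDerivWithinAt t (hS.hasDeriv x t ht))
      ((hS.weak x).hasDeriv ℓ m hℓ t ht)
  let π := PiLp.proj (𝕜 := ℂ) 2 (fun _ : ι ⊕ ι => H)
  refine ⟨(hS.weak x).continuousOn, (hS.weak _).continuousOn, hS.hasDeriv x, fun t ht j n => ?_,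
    fun t ht j n => ?_⟩
  · exact key (innerSL ℂ (p.e n) ∘L π (Sum.inl j))
      ((p.α j : ℂ) • (p.om n : ℂ) • innerSL ℂ (p.e n) ∘L π (Sum.inr j))
      (fun y => hB.coef_inl y j n) t ht
  · have := key (innerSL ℂ (p.e n) ∘L π (Sum.inr j))
      (-((p.α j : ℂ) • (p.om n : ℂ) • innerSL ℂ (p.e n) ∘L π (Sum.inl j))
        - (p.c j : ℂ) • (p.damp j n : ℂ) • innerSL ℂ (p.e n) ∘L π (Sum.inr j)
        - ∑ k, (p.ε j k : ℂ) • (p.om n : ℂ) • innerSL ℂ (p.f n) ∘L π (Sum.inr k)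
        + innerSL ℂ (p.e n) ∘L p.Q j)
      (fun y => (hB.coef_inr y j n).trans (by simp [π])) t ht
    simpa [π] using this

/-- The domain of the operator is invariant under the solution operators. -/
theorem IsWaveOp.mem_graph {p : WaveData ι H}
    {B : PiLp 2 (fun _ : ι ⊕ ι => H) →ₗ.[ℂ] PiLp 2 (fun _ : ι ⊕ ι => H)} (hB : p.IsWaveOp B)
    {S : ℝ → PiLp 2 (fun _ : ι ⊕ ι => H) →L[ℂ] PiLp 2 (fun _ : ι ⊕ ι => H)}
    (hS : IsSolutionOp B S) (x : B.domain) {t : ℝ} (ht : 0 ≤ t) :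
    (S t x, S t (B x)) ∈ B.graph :=
  hB.mem_graph_of_isOrbit (hB.isOrbit hS x) (by
    have h : S 0 x = x := (hS.weak x).initial
    change S 0 x ∈ B.domain
    rw [h]; exact x.2) ht

end WaveData

/-! ### Sines and cosines -/

theorem memLp_ofReal (L : ℝ) {f : ℝ → ℝ} (hf : Continuous f) :
    MemLp (fun x => (f x : ℂ)) 2 (volume.restrict (Ioo 0 L)) := by
  obtain ⟨C, hC⟩ := isCompact_Icc.exists_bound_of_continuousOn (hf.continuousOn (s := Icc 0 L))
  refine MemLp.of_bound (by fun_prop) C ?_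
  filter_upwards [ae_restrict_mem measurableSet_Ioo] with x hx
  simpa using hC x (Ioo_subset_Icc_self hx)

/-- A continuous real function as an element of `L²(0, L)`. -/
noncomputable def realL2 (L : ℝ) (f : ℝ → ℝ) (hf : Continuous f) : L2 L := (memLp_ofReal L hf).toLp

theorem coeFn_realL2 (L : ℝ) {f : ℝ → ℝ} (hf : Continuous f) :
    (realL2 L f hf : ℝ → ℂ) =ᵐ[volume.restrict (Ioo 0 L)] fun x => (f x : ℂ) :=
  (memLp_ofReal L hf).coeFn_toLp

theorem inner_realL2_left (L : ℝ) {f : ℝ → ℝ} (hf : Continuous f) (u : L2 L) :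
    ⟪realL2 L f hf, u⟫_ℂ = ∫ x in Ioo 0 L, (f x : ℂ) * u x := by
  rw [L2.inner_def]
  refine integral_congr_ae ?_
  filter_upwards [coeFn_realL2 L hf] with x hx
  rw [hx]
  simp [mul_comm]

theorem inner_realL2 {L : ℝ} (hL : 0 ≤ L) {f g : ℝ → ℝ} (hf : Continuous f) (hg : Continuous g) :
    ⟪realL2 L f hf, realL2 L g hg⟫_ℂ = ((∫ x in (0 : ℝ)..L, f x * g x : ℝ) : ℂ) := by
  rw [inner_realL2_left, intervalIntegral.integral_of_le hL, integral_Ioc_eq_integral_Ioo,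
    ← integral_complex_ofReal]
  refine integral_congr_ae ?_
  filter_upwards [coeFn_realL2 L hg] with x hx
  rw [hx]; push_cast; rfl

theorem continuous_sin_mul (c a : ℝ) : Continuous fun x => c * Real.sin (a * x) := by fun_prop

theorem continuous_cos_mul (c a : ℝ) : Continuous fun x => c * Real.cos (a * x) := by fun_prop

/-- The normalized eigenfunctions of the Dirichlet Laplacian. -/
noncomputable def sinFn (L : ℝ) (n : ℕ) : L2 L :=
  realL2 L (fun x => √(2 / L) * Real.sin (Real.pi / L * (n + 1) * x)) (continuous_sin_mul _ _)

/-- The normalized derivatives of the eigenfunctions. -/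
noncomputable def cosFn (L : ℝ) (n : ℕ) : L2 L :=
  realL2 L (fun x => √(2 / L) * Real.cos (Real.pi / L * (n + 1) * x)) (continuous_cos_mul _ _)

theorem integral_cos_int {L : ℝ} (hL : 0 < L) (k : ℤ) :
    ∫ x in (0 : ℝ)..L, Real.cos (Real.pi / L * k * x) = if k = 0 then L else 0 := by
  split_ifs with h
  · simp [h]
  · have hk : (k : ℝ) ≠ 0 := by exact_mod_cast h
    have hc : Real.pi / L * k ≠ 0 := by positivity
    rw [intervalIntegral.integral_comp_mul_left _ hc, integral_cos,
      show Real.pi / L * k * L = k * Real.pi by field_simp, Real.sin_int_mul_pi]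
    simp

theorem integral_sin_int {L : ℝ} (hL : 0 < L) (k : ℤ) :
    ∫ x in (0 : ℝ)..L, Real.sin (Real.pi / L * k * x) =
      L / Real.pi * ((1 - (-1) ^ k) / k) := by
  rcases eq_or_ne k 0 with rfl | h
  · simp
  · have hk : (k : ℝ) ≠ 0 := by exact_mod_cast h
    have hc : Real.pi / L * k ≠ 0 := by positivity
    rw [intervalIntegral.integral_comp_mul_left _ hc, integral_sin,
      show Real.pi / L * k * L = k * Real.pi by field_simp, Real.cos_int_mul_pi]
    simp
    field_simp

theorem sq_sqrt_two_div {L : ℝ} (hL : 0 < L) : √(2 / L) * √(2 / L) = 2 / L :=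
  Real.mul_self_sqrt (by positivity)

theorem inner_sinFn {L : ℝ} (hL : 0 < L) (m n : ℕ) :
    ⟪sinFn L m, sinFn L n⟫_ℂ = if m = n then 1 else 0 := by
  have e : ∀ x : ℝ, √(2 / L) * Real.sin (Real.pi / L * (m + 1) * x) *
      (√(2 / L) * Real.sin (Real.pi / L * (n + 1) * x)) =
      1 / L * Real.cos (Real.pi / L * ((m - n : ℤ) : ℝ) * x) -
      1 / L * Real.cos (Real.pi / L * ((m + n + 2 : ℤ) : ℝ) * x) := by
    intro x
    rw [show Real.pi / L * ((m - n : ℤ) : ℝ) * x = Real.pi / L * (m + 1) * x -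
        Real.pi / L * (n + 1) * x by push_cast; ring,
      show Real.pi / L * ((m + n + 2 : ℤ) : ℝ) * x = Real.pi / L * (m + 1) * x +
        Real.pi / L * (n + 1) * x by push_cast; ring, Real.cos_sub, Real.cos_add, mul_mul_mul_comm,
      sq_sqrt_two_div hL]
    ring
  rw [sinFn, sinFn, inner_realL2 hL.le]
  simp only [e]
  rw [intervalIntegral.integral_sub ((by fun_prop : Continuous _).intervalIntegrable _ _)
      ((by fun_prop : Continuous _).intervalIntegrable _ _),
    intervalIntegral.integral_const_mul, intervalIntegral.integral_const_mul, integral_cos_int hL,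
    integral_cos_int hL, if_neg (show (m + n + 2 : ℤ) ≠ 0 by omega)]
  by_cases h : m = n
  · simp [h, hL.ne']
  · rw [if_neg (by omega), if_neg h]; simp

theorem inner_cosFn {L : ℝ} (hL : 0 < L) (m n : ℕ) :
    ⟪cosFn L m, cosFn L n⟫_ℂ = if m = n then 1 else 0 := by
  have e : ∀ x : ℝ, √(2 / L) * Real.cos (Real.pi / L * (m + 1) * x) *
      (√(2 / L) * Real.cos (Real.pi / L * (n + 1) * x)) =
      1 / L * Real.cos (Real.pi / L * ((m - n : ℤ) : ℝ) * x) +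
      1 / L * Real.cos (Real.pi / L * ((m + n + 2 : ℤ) : ℝ) * x) := by
    intro x
    rw [show Real.pi / L * ((m - n : ℤ) : ℝ) * x = Real.pi / L * (m + 1) * x -
        Real.pi / L * (n + 1) * x by push_cast; ring,
      show Real.pi / L * ((m + n + 2 : ℤ) : ℝ) * x = Real.pi / L * (m + 1) * x +
        Real.pi / L * (n + 1) * x by push_cast; ring, Real.cos_sub, Real.cos_add, mul_mul_mul_comm,
      sq_sqrt_two_div hL]
    ring
  rw [cosFn, cosFn, inner_realL2 hL.le]
  simp only [e]
  rw [intervalIntegral.integral_add ((by fun_prop : Continuous _).intervalIntegrable _ _)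
      ((by fun_prop : Continuous _).intervalIntegrable _ _),
    intervalIntegral.integral_const_mul, intervalIntegral.integral_const_mul, integral_cos_int hL,
    integral_cos_int hL, if_neg (show (m + n + 2 : ℤ) ≠ 0 by omega)]
  by_cases h : m = n
  · simp [h, hL.ne']
  · rw [if_neg (by omega), if_neg h]; simp

/-- For m = n the factor 1 - (-1)^{m+n} vanishes, so the default value of 1/(m - n) is harmless. -/
theorem inner_sinFn_cosFn {L : ℝ} (hL : 0 < L) (m n : ℕ) : ⟪sinFn L m, cosFn L n⟫_ℂ =
    (((1 - (-1) ^ (m + n)) / Real.pi * (1 / (m - n) + 1 / (m + n + 2)) : ℝ) : ℂ) := by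
  have e : ∀ x : ℝ, √(2 / L) * Real.sin (Real.pi / L * (m + 1) * x) *
      (√(2 / L) * Real.cos (Real.pi / L * (n + 1) * x)) =
      1 / L * Real.sin (Real.pi / L * ((m - n : ℤ) : ℝ) * x) +
      1 / L * Real.sin (Real.pi / L * ((m + n + 2 : ℤ) : ℝ) * x) := by
    intro x
    rw [show Real.pi / L * ((m - n : ℤ) : ℝ) * x = Real.pi / L * (m + 1) * x -
        Real.pi / L * (n + 1) * x by push_cast; ring,
      show Real.pi / L * ((m + n + 2 : ℤ) : ℝ) * x = Real.pi / L * (m + 1) * x +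
        Real.pi / L * (n + 1) * x by push_cast; ring, Real.sin_sub, Real.sin_add, mul_mul_mul_comm,
      sq_sqrt_two_div hL]
    ring
  have s1 : ((-1 : ℝ)) ^ (m - n : ℤ) = (-1) ^ (m + n) := by
    rw [zpow_sub₀ (by norm_num), zpow_natCast, zpow_natCast, pow_add, div_eq_mul_inv, ← inv_pow]
    norm_num
  have s2 : ((-1 : ℝ)) ^ (m + n + 2 : ℤ) = (-1) ^ (m + n) := by
    rw [zpow_add₀ (by norm_num), zpow_add₀ (by norm_num), zpow_natCast, zpow_natCast, pow_add]
    norm_num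
  rw [sinFn, cosFn, inner_realL2 hL.le]
  simp only [e]
  rw [intervalIntegral.integral_add ((by fun_prop : Continuous _).intervalIntegrable _ _)
      ((by fun_prop : Continuous _).intervalIntegrable _ _),
    intervalIntegral.integral_const_mul, intervalIntegral.integral_const_mul, integral_sin_int hL,
    integral_sin_int hL, s1, s2]
  have := hL.ne'
  congr 1
  push_cast
  field_simp

theorem orthonormal_sinFn {L : ℝ} (hL : 0 < L) : Orthonormal ℂ (sinFn L) :=
  orthonormal_iff_ite.2 (inner_sinFn hL)

theorem orthonormal_cosFn {L : ℝ} (hL : 0 < L) : Orthonormal ℂ (cosFn L) :=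
  orthonormal_iff_ite.2 (inner_cosFn hL)

theorem inner_cosFn_sinFn {L : ℝ} (hL : 0 < L) (m n : ℕ) :
    ((m + 1 : ℝ) : ℂ) * ⟪cosFn L m, sinFn L n⟫_ℂ =
      -(((n + 1 : ℝ) : ℂ) * ⟪sinFn L m, cosFn L n⟫_ℂ) := by
  rw [← inner_conj_symm, inner_sinFn_cosFn hL, inner_sinFn_cosFn hL, Complex.conj_ofReal]
  rw [← Complex.ofReal_mul, ← Complex.ofReal_mul, ← Complex.ofReal_neg, add_comm n m]
  congr 1
  rcases eq_or_ne m n with rfl | h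
  · rw [← two_mul, pow_mul]; norm_num
  · have h1 : (m : ℝ) - n ≠ 0 := sub_ne_zero.2 (by exact_mod_cast h)
    have h2 : (n : ℝ) - m ≠ 0 := sub_ne_zero.2 (by exact_mod_cast h.symm)
    have h3 : (m : ℝ) + n + 2 ≠ 0 := by positivity
    have h4 : (n : ℝ) + m + 2 ≠ 0 := by positivity
    have h5 : (1 : ℝ) / (n - m) = -(1 / (m - n)) := by
      rw [← neg_sub, one_div_neg_eq_neg_one_div]
    rw [h5, add_comm (n : ℝ) m]
    field_simp
    ring

/-- With a = m+1 and b = n+1 ≤ a/2, the bracket is 2a/(a² - b²) ≤ 8/(3a), and the prefactor is at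
most 2/π < 2/3. -/
theorem norm_inner_sinFn_cosFn_le {L : ℝ} (hL : 0 < L) (m n : ℕ) (h : 2 * (n + 1) ≤ m + 1) :
    ‖⟪sinFn L m, cosFn L n⟫_ℂ‖ ≤ 2 / (m + 1) := by
  have hmn : 2 * ((n : ℝ) + 1) ≤ m + 1 := by exact_mod_cast h
  have hn : (0 : ℝ) ≤ n := n.cast_nonneg
  have hπ := Real.pi_gt_three
  have h1 : 0 < (m : ℝ) - n := by linarith
  have h2 : (0 : ℝ) ≤ 1 - (-1) ^ (m + n) ∧ (1 : ℝ) - (-1) ^ (m + n) ≤ 2 := by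
    rcases neg_one_pow_eq_or ℝ (m + n) with h | h <;> rw [h] <;> norm_num
  have h3 : (1 : ℝ) / (m - n) + 1 / (m + n + 2) ≤ 8 / (3 * (m + 1)) := by
    rw [div_add_div _ _ h1.ne' (by positivity), div_le_div_iff₀ (by positivity) (by positivity)]
    nlinarith
  have h4 : (0 : ℝ) ≤ 1 / (m - n) + 1 / (m + n + 2) := by positivity
  rw [inner_sinFn_cosFn hL, Complex.norm_of_nonneg
    (mul_nonneg (div_nonneg h2.1 Real.pi_pos.le) h4)]
  calc (1 - (-1) ^ (m + n)) / Real.pi * (1 / ((m : ℝ) - n) + 1 / (m + n + 2))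
      ≤ 2 / 3 * (8 / (3 * (m + 1))) := by
        refine mul_le_mul (div_le_div₀ (by norm_num) h2.2 (by norm_num) hπ.le) h3 h4 (by norm_num)
    _ ≤ 2 / (m + 1) := by
        rw [div_mul_div_comm, div_le_div_iff₀ (by positivity) (by positivity)]
        nlinarith

/-! ### Completeness of the sines -/

/-- The odd extension of an element of `L²(0, L)`. -/
noncomputable def oddExt {L : ℝ} (g : L2 L) (x : ℝ) : ℂ :=
  (Ioo 0 L).indicator g x - (Ioo 0 L).indicator g (-x)

theorem memLp_indicator {L : ℝ} (g : L2 L) : MemLp ((Ioo 0 L).indicator g) 2 volume :=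
  (memLp_indicator_iff_restrict measurableSet_Ioo).2 (Lp.memLp g)

theorem memLp_oddExt {L : ℝ} (g : L2 L) : MemLp (oddExt g) 2 volume :=
  (memLp_indicator g).sub
    ((memLp_indicator g).comp_measurePreserving (Measure.measurePreserving_neg volume))

theorem integral_mul_oddExt {L : ℝ} (g : L2 L) {φ : ℝ → ℂ} (hφ : Continuous φ) {C : ℝ}
    (hC : ∀ x, ‖φ x‖ ≤ C) :
    ∫ x in (-L)..L, φ x * oddExt g x = ∫ x in Ioo 0 L, (φ x - φ (-x)) * g x := by
  rcases lt_or_ge L 0 with hL | hL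
  · have h0 : ∀ x, oddExt g x = 0 := fun x => by simp [oddExt, Ioo_eq_empty (not_lt.2 hL.le)]
    simp [h0, Ioo_eq_empty (not_lt.2 hL.le)]
  have hfin : IsFiniteMeasure (volume.restrict (Ioo (0 : ℝ) L)) := ⟨by simp⟩
  have hint : Integrable ((Ioo 0 L).indicator (g : ℝ → ℂ)) volume :=
    (integrable_indicator_iff measurableSet_Ioo).2 ((Lp.memLp g).integrable (by norm_num))
  have i1 : ∀ {ψ : ℝ → ℂ}, Continuous ψ → (∀ x, ‖ψ x‖ ≤ C) →
      Integrable (fun x => ψ x * (Ioo 0 L).indicator (g : ℝ → ℂ) x) volume := fun h1 h2 =>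
    hint.bdd_mul h1.aestronglyMeasurable (Eventually.of_forall h2)
  have i2 : Integrable (fun x => φ x * (Ioo 0 L).indicator (g : ℝ → ℂ) (-x)) volume := by
    have := (i1 (hφ.comp continuous_neg) fun x => hC (-x)).comp_neg
    simpa using this
  have e1 : ∫ x in (-L)..L, φ x * oddExt g x = ∫ x, φ x * oddExt g x := by
    rw [intervalIntegral.integral_of_le (by linarith)]
    refine setIntegral_eq_integral_of_forall_compl_eq_zero fun x hx => ?_
    have h1 : x ∉ Ioo 0 L := fun h => hx ⟨by linarith [h.1], h.2.le⟩
    have h3 : -x ∉ Ioo 0 L := fun h => hx ⟨by linarith [h.2], by linarith [h.1]⟩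
    simp [oddExt, indicator_of_notMem h1, indicator_of_notMem h3]
  have e2 : ∫ x, φ x * (Ioo 0 L).indicator (g : ℝ → ℂ) (-x) =
      ∫ x, φ (-x) * (Ioo 0 L).indicator (g : ℝ → ℂ) x := by
    rw [← integral_neg_eq_self (μ := volume)
      (fun x => φ x * (Ioo 0 L).indicator (g : ℝ → ℂ) (-x))]
    simp
  rw [e1]
  simp only [oddExt, mul_sub]
  have i3 : Integrable (fun x => φ (-x) * (Ioo 0 L).indicator (g : ℝ → ℂ) x) volume :=
    i1 (hφ.comp continuous_neg) fun x => hC (-x)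
  rw [integral_sub (i1 hφ hC) i2, e2, ← integral_sub (i1 hφ hC) i3, ← integral_indicator measurableSet_Ioo]
  refine integral_congr_ae (Eventually.of_forall fun x => ?_)
  by_cases hx : x ∈ Ioo 0 L
  · simp [indicator_of_mem hx, sub_mul]
  · simp [indicator_of_notMem hx]

/-- The Fourier coefficients on (-L, L) of the odd extension are multiples of the sine integrals, so
all of them vanish, and Parseval's identity finishes. -/
theorem eq_zero_of_inner_sinFn {L : ℝ} (hL : 0 < L) {g : L2 L} (h : ∀ n, ⟪sinFn L n, g⟫_ℂ = 0) :
    g = 0 := by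
  have hsin : ∀ n : ℕ, ∫ x in Ioo 0 L, (Real.sin (Real.pi / L * n * x) : ℂ) * g x = 0 := by
    intro n
    rcases n with _ | n
    · simp
    · have h1 := h n
      rw [sinFn, inner_realL2_left] at h1
      have hs : ((√(2 / L) : ℝ) : ℂ) ≠ 0 := by
        have : 0 < √(2 / L) := Real.sqrt_pos.2 (by positivity)
        exact_mod_cast this.ne'
      simp only [Complex.ofReal_mul, mul_assoc] at h1
      rw [integral_const_mul] at h1
      simpa [mul_assoc] using (mul_eq_zero.1 h1).resolve_left hs
  have hsinz : ∀ k : ℤ, ∫ x in Ioo 0 L, (Real.sin (Real.pi / L * k * x) : ℂ) * g x = 0 := by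
    intro k
    obtain ⟨n, rfl | rfl⟩ := k.eq_nat_or_neg
    · simpa using hsin n
    · have := hsin n
      simp only [Int.cast_neg, Int.cast_natCast, mul_neg, neg_mul, Real.sin_neg, Complex.ofReal_neg,
        integral_neg, this, neg_zero]
  have hab : -L < L := by linarith
  have hcoef : ∀ k : ℤ, fourierCoeffOn hab (oddExt g) k = 0 := by
    intro k
    rw [fourierCoeffOn_eq_integral]
    have e1 : ∀ x : ℝ, (fourier (-k) (x : AddCircle (L - -L)) : ℂ) =
        Complex.exp (((-(Real.pi / L * k * x) : ℝ) : ℂ) * Complex.I) := by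
      intro x
      rw [fourier_coe_apply]
      congr 1
      have : (L : ℂ) ≠ 0 := by exact_mod_cast hL.ne'
      push_cast
      field_simp
      ring
    simp only [e1, smul_eq_mul]
    rw [integral_mul_oddExt g (C := 1) (by fun_prop) fun x =>
      (Complex.norm_exp_ofReal_mul_I _).le]
    have e2 : ∀ x : ℝ, Complex.exp (((-(Real.pi / L * k * x) : ℝ) : ℂ) * Complex.I) -
        Complex.exp (((-(Real.pi / L * k * -x) : ℝ) : ℂ) * Complex.I) =
        (-2 * Complex.I) * (Real.sin (Real.pi / L * k * x) : ℂ) := by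
      intro x
      rw [show -(Real.pi / L * k * -x) = Real.pi / L * k * x by ring]
      simp only [Complex.exp_mul_I, Complex.ofReal_neg, Complex.cos_neg, Complex.sin_neg,
        Complex.ofReal_sin]
      ring
    simp only [e2]
    simp only [mul_assoc (-2 * Complex.I)]
    rw [integral_const_mul, hsinz k, mul_zero, smul_zero]
  have hpars := hasSum_sq_fourierCoeffOn hab (f := oddExt g) ((memLp_oddExt g).restrict _)
  simp only [hcoef, norm_zero, zero_pow two_ne_zero] at hpars
  have h0 : ∫ x in (-L)..L, ‖oddExt g x‖ ^ 2 = 0 := by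
    have h1 := hpars.unique hasSum_zero
    have h2 : (L - -L)⁻¹ ≠ 0 := inv_ne_zero (by linarith)
    exact (smul_eq_zero.1 h1).resolve_left h2
  rw [intervalIntegral.integral_of_le hab.le, integral_eq_zero_iff_of_nonneg
    (fun _ => by positivity) (((memLp_oddExt g).restrict _).integrable_norm_pow two_ne_zero)] at h0
  refine (Lp.eq_zero_iff_ae_eq_zero).2 ?_
  have hsub : Ioo 0 L ⊆ Ioc (-L) L := fun x hx => ⟨by linarith [hx.1], hx.2.le⟩
  filter_upwards [ae_restrict_of_ae_restrict_of_subset hsub h0, ae_restrict_mem measurableSet_Ioo]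
    with x h1 h2
  have h3 : -x ∉ Ioo 0 L := fun h => by linarith [h.1, h2.1]
  have h4 : oddExt g x = g x := by simp [oddExt, indicator_of_mem h2, indicator_of_notMem h3]
  rw [← h4]
  simpa using h1

/-- The Hilbert basis of eigenfunctions. -/
noncomputable def sinBasis {L : ℝ} (hL : 0 < L) : HilbertBasis ℕ ℂ (L2 L) :=
  HilbertBasis.mkOfOrthogonalEqBot (orthonormal_sinFn hL) <| by
    refine (Submodule.eq_bot_iff _).2 fun g hg => eq_zero_of_inner_sinFn hL fun n => ?_
    exact (Submodule.mem_orthogonal _ _).1 hg _ (Submodule.subset_span ⟨n, rfl⟩)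

theorem sinBasis_apply {L : ℝ} (hL : 0 < L) (n : ℕ) : sinBasis hL n = sinFn L n := by
  rw [sinBasis, HilbertBasis.coe_mkOfOrthogonalEqBot]

/-! ### Approximation by test functions -/

theorem realL2_sub (L : ℝ) {f g : ℝ → ℝ} (hf : Continuous f) (hg : Continuous g) :
    realL2 L f hf - realL2 L g hg = realL2 L (fun x => f x - g x) (hf.sub hg) := by
  rw [realL2, realL2, realL2, ← MemLp.toLp_sub]
  exact MemLp.toLp_congr _ _ (Eventually.of_forall fun x => by simp)

theorem realL2_const_mul (L c : ℝ) {f : ℝ → ℝ} (hf : Continuous f) :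
    realL2 L (fun x => c * f x) (hf.const_mul c) = (c : ℂ) • realL2 L f hf := by
  rw [realL2, realL2, ← MemLp.toLp_const_smul]
  exact MemLp.toLp_congr _ _ (Eventually.of_forall fun x => by simp)

theorem norm_realL2_sq {L : ℝ} (hL : 0 ≤ L) {f : ℝ → ℝ} (hf : Continuous f) :
    ‖realL2 L f hf‖ ^ 2 = ∫ x in (0 : ℝ)..L, f x * f x := by
  have h := inner_realL2 hL hf hf
  rw [inner_self_eq_norm_sq_to_K] at h
  refine Complex.ofReal_injective (Eq.trans ?_ h)
  push_cast; rfl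

theorem tendsto_realL2 {L : ℝ} (hL : 0 ≤ L) {f : ℕ → ℝ → ℝ} {g : ℝ → ℝ} (hf : ∀ k, Continuous (f k))
    (hg : Continuous g) {C : ℝ} (hC : ∀ k, ∀ x ∈ Ioo 0 L, |f k x - g x| ≤ C)
    (h : ∀ x ∈ Ioo 0 L, Tendsto (fun k => f k x) atTop (𝓝 (g x))) :
    Tendsto (fun k => realL2 L (f k) (hf k)) atTop (𝓝 (realL2 L g hg)) := by
  rw [tendsto_iff_norm_sub_tendsto_zero]
  have h2 : Tendsto (fun k => ∫ x in (0 : ℝ)..L, (f k x - g x) * (f k x - g x)) atTop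
      (𝓝 (∫ _ in (0 : ℝ)..L, (0 : ℝ))) := by
    simp only [intervalIntegral.integral_of_le hL, integral_Ioc_eq_integral_Ioo]
    refine tendsto_integral_of_dominated_convergence (fun _ => C * C)
      (fun k => (((hf k).sub hg).mul ((hf k).sub hg)).aestronglyMeasurable)
      (integrable_const _)
      (fun k => ?_) ?_
    · filter_upwards [ae_restrict_mem measurableSet_Ioo] with x hx
      rw [Real.norm_eq_abs, abs_mul]
      have := hC k x hx
      exact mul_le_mul this this (abs_nonneg _) ((abs_nonneg _).trans this)
    · filter_upwards [ae_restrict_mem measurableSet_Ioo] with x hx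
      have := (h x hx).sub_const (g x)
      simpa using this.mul this
  rw [intervalIntegral.integral_zero] at h2
  have h3 := h2.sqrt
  rw [Real.sqrt_zero] at h3
  refine h3.congr fun k => ?_
  rw [realL2_sub, ← Real.sqrt_sq (norm_nonneg (realL2 L _ _)), norm_realL2_sq hL]

theorem realL2_mem_weakDerivGraph (L : ℝ) {f f' : ℝ → ℝ} (hf : Continuous f) (hf' : Continuous f')
    (hd : ∀ x, HasDerivAt f (f' x) x) : (realL2 L f hf, realL2 L f' hf') ∈ weakDerivGraph L := by
  intro η
  have hvan : ∀ x, x ∉ Ioo 0 L → η.toFun x = 0 := fun x hx =>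
    image_eq_zero_of_notMem_tsupport fun h => hx (η.supp h)
  have hcd : Continuous (deriv η.toFun) := η.smooth.continuous_deriv (by simp)
  have hvan' : ∀ x, x ∉ Ioo 0 L → deriv η.toFun x = 0 := fun x hx =>
    image_eq_zero_of_notMem_tsupport fun h => hx (η.supp (tsupport_deriv_subset h))
  have hcs : HasCompactSupport (fun x => star (η.toFun x)) :=
    η.compact.comp_left (g := star) (by simp)
  have hcs' : HasCompactSupport (fun x => star (deriv η.toFun x)) :=
    η.compact.deriv.comp_left (g := star) (by simp)
  have cf : Continuous fun x => (f x : ℂ) := by fun_prop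
  have cf' : Continuous fun x => (f' x : ℂ) := by fun_prop
  have hibp := integral_mul_deriv_eq_deriv_mul_of_integrable
    (u := fun x => star (η.toFun x)) (u' := fun x => star (deriv η.toFun x))
    (v := fun x => (f x : ℂ)) (v' := fun x => (f' x : ℂ))
    (fun x _ => ((η.smooth.differentiable (by simp)) x).hasDerivAt.star)
    (fun x _ => (hd x).ofReal_comp)
    (((continuous_star.comp η.smooth.continuous).mul cf').integrable_of_hasCompactSupport
      hcs.mul_right)
    (((continuous_star.comp hcd).mul cf).integrable_of_hasCompactSupport hcs'.mul_right)
    (((continuous_star.comp η.smooth.continuous).mul cf).integrable_of_hasCompactSupport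
      hcs.mul_right)
  have e1 : ⟪η.dx, realL2 L f hf⟫_ℂ = ∫ x, star (deriv η.toFun x) * (f x : ℂ) := by
    have hset : ∫ x in Ioo 0 L, star (deriv η.toFun x) * (f x : ℂ) =
        ∫ x, star (deriv η.toFun x) * (f x : ℂ) :=
      setIntegral_eq_integral_of_forall_compl_eq_zero fun x hx => by
        rw [hvan' x hx, star_zero, zero_mul]
    rw [L2.inner_def, ← hset]
    refine integral_congr_ae ?_
    filter_upwards [η.memLp_deriv.coeFn_toLp, coeFn_realL2 L hf] with x h1 h2
    have h1' : (η.dx : ℝ → ℂ) x = deriv η.toFun x := h1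
    rw [h1', h2]; simp [mul_comm]
  have e2 : ⟪η.fn, realL2 L f' hf'⟫_ℂ = ∫ x, star (η.toFun x) * (f' x : ℂ) := by
    have hset : ∫ x in Ioo 0 L, star (η.toFun x) * (f' x : ℂ) = ∫ x, star (η.toFun x) * (f' x : ℂ) :=
      setIntegral_eq_integral_of_forall_compl_eq_zero fun x hx => by
        rw [hvan x hx, star_zero, zero_mul]
    rw [L2.inner_def, ← hset]
    refine integral_congr_ae ?_
    filter_upwards [η.memLp.coeFn_toLp, coeFn_realL2 L hf'] with x h1 h2
    have h1' : (η.fn : ℝ → ℂ) x = η.toFun x := h1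
    rw [h1', h2]; simp [mul_comm]
  rw [e1, e2, hibp, neg_neg]

theorem isClosed_weakDerivGraph (L : ℝ) : IsClosed (weakDerivGraph L : Set (L2 L × L2 L)) := by
  have : (weakDerivGraph L : Set (L2 L × L2 L)) =
      ⋂ η : TestFn L, {p | ⟪η.dx, p.1⟫_ℂ = -⟪η.fn, p.2⟫_ℂ} := by
    ext p; simp only [Set.mem_iInter]; rfl
  rw [this]
  exact isClosed_iInter fun η => isClosed_eq (by fun_prop) (by fun_prop)

/-- Integration by parts for a function in `H¹₀` and a function in `H¹`. -/
theorem H01.inner_dx {L : ℝ} (V : H01 L) {p : L2 L × L2 L} (hp : p ∈ weakDerivGraph L) :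
    ⟪H01.dx L V, p.1⟫_ℂ = -⟪H01.fn L V, p.2⟫_ℂ := by
  let K : Submodule ℂ (L2 L × L2 L) :=
    { carrier := {q | ⟪p.1, q.2⟫_ℂ = -⟪p.2, q.1⟫_ℂ}
      add_mem' := fun {a b} ha hb => by
        simp only [mem_ofPred_eq, Prod.fst_add, Prod.snd_add, inner_add_right] at *
        rw [ha, hb]; ring
      zero_mem' := by simp
      smul_mem' := fun c a ha => by
        simp only [mem_ofPred_eq, Prod.smul_fst, Prod.smul_snd, inner_smul_right] at *
        rw [ha]; ring }
  have hK : IsClosed (K : Set (L2 L × L2 L)) := isClosed_eq (by fun_prop) (by fun_prop)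
  have hle : (testGraph L).topologicalClosure ≤ K := by
    refine Submodule.topologicalClosure_minimal _ (Submodule.span_le.2 ?_) hK
    rintro _ ⟨η, rfl⟩
    change ⟪p.1, η.dx⟫_ℂ = -⟪p.2, η.fn⟫_ℂ
    rw [← inner_conj_symm, hp η, map_neg, inner_conj_symm]
  have h : ⟪p.1, H01.dx L V⟫_ℂ = -⟪p.2, H01.fn L V⟫_ℂ := hle V.2
  rw [← inner_conj_symm, h, map_neg, inner_conj_symm]

theorem exists_abs_deriv_smoothTransition_le : ∃ M : ℝ, 0 ≤ M ∧
    (∀ y, |deriv Real.smoothTransition y| ≤ M) ∧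
    (∀ y, 1 < y → deriv Real.smoothTransition y = 0) := by
  have hc : Continuous (deriv Real.smoothTransition) :=
    (Real.smoothTransition.contDiff (n := 1)).continuous_deriv le_rfl
  obtain ⟨M, hM⟩ := isCompact_Icc.exists_bound_of_continuousOn (hc.continuousOn (s := Icc 0 1))
  have h1 : ∀ y, 1 < y → deriv Real.smoothTransition y = 0 := fun y hy => by
    have : Real.smoothTransition =ᶠ[𝓝 y] fun _ => 1 := by
      filter_upwards [lt_mem_nhds hy] with x hx
      exact Real.smoothTransition.one_of_one_le hx.le
    rw [this.deriv_eq, deriv_const]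
  refine ⟨M, (norm_nonneg _).trans (hM 0 (by simp)), fun y => ?_, h1⟩
  rcases lt_or_ge y 0 with h | h
  · have : Real.smoothTransition =ᶠ[𝓝 y] fun _ => 0 := by
      filter_upwards [gt_mem_nhds h] with x hx
      exact Real.smoothTransition.zero_of_nonpos hx.le
    rw [this.deriv_eq, deriv_const, abs_zero]
    exact (norm_nonneg _).trans (hM 0 (by simp))
  · rcases lt_or_ge 1 y with h' | h'
    · rw [h1 y h', abs_zero]
      exact (norm_nonneg _).trans (hM 0 (by simp))
    · exact hM y ⟨h, h'⟩

/-- A smooth cutoff function, vanishing within distance `1 / k` of the endpoints. -/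
noncomputable def cutoff (L k x : ℝ) : ℝ :=
  Real.smoothTransition (k * x - 1) * Real.smoothTransition (k * (L - x) - 1)

/-- The derivative of `cutoff`. -/
noncomputable def cutoff' (L k x : ℝ) : ℝ :=
  k * deriv Real.smoothTransition (k * x - 1) * Real.smoothTransition (k * (L - x) - 1) -
    Real.smoothTransition (k * x - 1) * (k * deriv Real.smoothTransition (k * (L - x) - 1))

theorem contDiff_cutoff (L k : ℝ) : ContDiff ℝ ∞ (cutoff L k) := by
  have h := Real.smoothTransition.contDiff (n := ⊤)
  exact (h.comp (by fun_prop)).mul (h.comp (by fun_prop))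

theorem hasDerivAt_cutoff (L k x : ℝ) : HasDerivAt (cutoff L k) (cutoff' L k x) x := by
  have h : ∀ y, HasDerivAt Real.smoothTransition (deriv Real.smoothTransition y) y := fun y =>
    ((Real.smoothTransition.contDiff (n := 1)).differentiable (by simp) y).hasDerivAt
  have h1 : HasDerivAt (fun x : ℝ => k * x - 1) k x := by
    simpa using ((hasDerivAt_id x).const_mul k).sub_const 1
  have h2 : HasDerivAt (fun x : ℝ => k * (L - x) - 1) (-k) x := by
    simpa using (((hasDerivAt_id x).const_sub L).const_mul k).sub_const 1
  refine (((h _).comp x h1).mul ((h _).comp x h2)).congr_deriv ?_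
  simp only [cutoff', Function.comp_apply]
  ring

theorem continuous_cutoff' (L k : ℝ) : Continuous (cutoff' L k) := by
  have h1 : Continuous (deriv Real.smoothTransition) :=
    (Real.smoothTransition.contDiff (n := 1)).continuous_deriv le_rfl
  have h2 := Real.smoothTransition.continuous
  unfold cutoff'
  fun_prop

theorem cutoff_eq_zero {L k x : ℝ} (h : k * x ≤ 1 ∨ k * (L - x) ≤ 1) : cutoff L k x = 0 := by
  rcases h with h | h
  · rw [cutoff, Real.smoothTransition.zero_of_nonpos (by linarith), zero_mul]
  · rw [cutoff, Real.smoothTransition.zero_of_nonpos (x := k * (L - x) - 1) (by linarith), mul_zero]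

theorem abs_cutoff_le_one (L k x : ℝ) : |cutoff L k x| ≤ 1 := by
  rw [cutoff, abs_of_nonneg (mul_nonneg (Real.smoothTransition.nonneg _)
    (Real.smoothTransition.nonneg _))]
  exact mul_le_one₀ (Real.smoothTransition.le_one _) (Real.smoothTransition.nonneg _)
    (Real.smoothTransition.le_one _)

/-- Multiply f by a cutoff at distance about 1/k from the endpoints. Its derivative is of size k,
but only where the distance to an endpoint is at most 2/k, and there |f| ≤ C · distance because f
vanishes at the endpoints. The products stay bounded and dominated convergence yields the limit in
H¹. -/
theorem realL2_mem_closure {L : ℝ} (hL : 0 ≤ L) {f f' : ℝ → ℝ} (hf : ContDiff ℝ ∞ f)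
    (hf' : Continuous f') (hd : ∀ x, HasDerivAt f (f' x) x) (h0 : f 0 = 0) (h1 : f L = 0) :
    (realL2 L f hf.continuous, realL2 L f' hf') ∈ (testGraph L).topologicalClosure := by
  obtain ⟨M, hM0, hM, hM1⟩ := exists_abs_deriv_smoothTransition_le
  obtain ⟨C, hC⟩ := isCompact_Icc.exists_bound_of_continuousOn (hf'.continuousOn (s := Icc 0 L))
  have hC0 : 0 ≤ C := (norm_nonneg _).trans (hC 0 (left_mem_Icc.2 hL))
  have hlip : ∀ x ∈ Icc 0 L, ∀ y ∈ Icc 0 L, |f y - f x| ≤ C * |y - x| := fun x hx y hy =>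
    Convex.norm_image_sub_le_of_norm_hasDerivWithin_le (fun z _ => (hd z).hasDerivWithinAt) hC
      (convex_Icc 0 L) hx hy
  have hb : ∀ (k : ℕ) (x d : ℝ), 0 ≤ d → |f x| ≤ C * d →
      |k * deriv Real.smoothTransition (k * d - 1) * f x| ≤ 2 * M * C := by
    intro k x d hd0 hfx
    have hk : (0 : ℝ) ≤ k := k.cast_nonneg
    rcases lt_or_ge 1 ((k : ℝ) * d - 1) with h | h
    · rw [hM1 _ h]; simp; positivity
    · rw [abs_mul, abs_mul, Nat.abs_cast]
      calc (k : ℝ) * |deriv Real.smoothTransition (k * d - 1)| * |f x|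
          ≤ k * M * (C * d) := by gcongr; exact hM _
        _ = (k * d) * (M * C) := by ring
        _ ≤ 2 * (M * C) := by gcongr; linarith
        _ = 2 * M * C := by ring
  have hb' : ∀ (k : ℕ), ∀ x ∈ Ioo 0 L, |cutoff' L k x * f x| ≤ 4 * M * C := by
    intro k x hx
    have hx' := Ioo_subset_Icc_self hx
    have l1 := hb k x x hx.1.le (by
      have := hlip 0 (left_mem_Icc.2 hL) x hx'
      rwa [h0, sub_zero, sub_zero, abs_of_pos hx.1] at this)
    have l2 := hb k x (L - x) (by linarith [hx.2]) (by
      have := hlip x hx' L (right_mem_Icc.2 hL)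
      rwa [h1, zero_sub, abs_neg, abs_of_nonneg (by linarith [hx.2] : 0 ≤ L - x)] at this)
    have s0 := Real.smoothTransition.nonneg
    have s1 := Real.smoothTransition.le_one
    have e : cutoff' L k x * f x =
        (k * deriv Real.smoothTransition (k * x - 1) * f x) *
          Real.smoothTransition (k * (L - x) - 1) -
        (k * deriv Real.smoothTransition (k * (L - x) - 1) * f x) *
          Real.smoothTransition (k * x - 1) := by rw [cutoff']; ring
    rw [e]
    refine (abs_sub _ _).trans ?_
    rw [abs_mul _ (Real.smoothTransition _), abs_mul _ (Real.smoothTransition (k * x - 1)),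
      abs_of_nonneg (s0 _), abs_of_nonneg (s0 _)]
    have m1 := mul_le_of_le_one_right (abs_nonneg
      ((k : ℝ) * deriv Real.smoothTransition (k * x - 1) * f x)) (s1 (k * (L - x) - 1))
    have m2 := mul_le_of_le_one_right (abs_nonneg
      ((k : ℝ) * deriv Real.smoothTransition (k * (L - x) - 1) * f x)) (s1 (k * x - 1))
    linarith
  have hev : ∀ x ∈ Ioo 0 L, ∀ᶠ k : ℕ in atTop, cutoff L k x = 1 ∧ cutoff' L k x = 0 := by
    intro x hx
    have t1 : ∀ d : ℝ, 0 < d → ∀ᶠ k : ℕ in atTop, 2 < (k : ℝ) * d := fun d hd =>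
      (tendsto_natCast_atTop_atTop.atTop_mul_const hd).eventually_gt_atTop 2
    filter_upwards [t1 x hx.1, t1 (L - x) (by linarith [hx.2])] with k a b
    rw [cutoff, cutoff', hM1 _ (by linarith : 1 < (k : ℝ) * x - 1),
      hM1 _ (by linarith : 1 < (k : ℝ) * (L - x) - 1),
      Real.smoothTransition.one_of_one_le (by linarith),
      Real.smoothTransition.one_of_one_le (by linarith)]
    simp
  have hbd : ∀ g : ℝ → ℝ, Continuous g → ∃ K, ∀ x ∈ Ioo 0 L, |g x| ≤ K := fun g hg => by
    obtain ⟨K, hK⟩ := isCompact_Icc.exists_bound_of_continuousOn (hg.continuousOn (s := Icc 0 L))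
    exact ⟨K, fun x hx => hK x (Ioo_subset_Icc_self hx)⟩
  obtain ⟨K₀, hK₀⟩ := hbd f hf.continuous
  obtain ⟨K₁, hK₁⟩ := hbd f' hf'
  have c1 : ∀ k : ℕ, Continuous fun x => cutoff L k x * f x := fun k =>
    (contDiff_cutoff L k).continuous.mul hf.continuous
  have c2 : ∀ k : ℕ, Continuous fun x => cutoff' L k x * f x + cutoff L k x * f' x := fun k =>
    ((continuous_cutoff' L k).mul hf.continuous).add ((contDiff_cutoff L k).continuous.mul hf')
  have hsub1 : ∀ k : ℕ, ∀ x, |cutoff L k x - 1| ≤ 1 := fun k x => by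
    have h := abs_le.1 (abs_cutoff_le_one L k x)
    have : 0 ≤ cutoff L k x := mul_nonneg (Real.smoothTransition.nonneg _)
      (Real.smoothTransition.nonneg _)
    rw [abs_le]; constructor <;> linarith [h.2]
  have T1 : Tendsto (fun k : ℕ => realL2 L _ (c1 k)) atTop (𝓝 (realL2 L f hf.continuous)) := by
    refine tendsto_realL2 hL c1 hf.continuous (C := K₀) (fun k x hx => ?_) fun x hx => ?_
    · rw [← sub_one_mul, abs_mul]
      exact (mul_le_of_le_one_left (abs_nonneg _) (hsub1 k x)).trans (hK₀ x hx)
    · refine tendsto_const_nhds.congr' ?_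
      filter_upwards [hev x hx] with k hk
      rw [hk.1, one_mul]
  have T2 : Tendsto (fun k : ℕ => realL2 L _ (c2 k)) atTop (𝓝 (realL2 L f' hf')) := by
    refine tendsto_realL2 hL c2 hf' (C := 4 * M * C + K₁) (fun k x hx => ?_) fun x hx => ?_
    · rw [add_sub_assoc, ← sub_one_mul]
      refine (abs_add_le _ _).trans (add_le_add (hb' k x hx) ?_)
      rw [abs_mul]
      exact (mul_le_of_le_one_left (abs_nonneg _) (hsub1 k x)).trans (hK₁ x hx)
    · refine tendsto_const_nhds.congr' ?_
      filter_upwards [hev x hx] with k hk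
      rw [hk.1, hk.2, one_mul, zero_mul, zero_add]
  refine mem_closure_of_tendsto (T1.prodMk_nhds T2) (Eventually.of_forall fun k => ?_)
  have hsupp : Function.support (fun x => ((cutoff L k x * f x : ℝ) : ℂ)) ⊆
      {x | 1 ≤ (k : ℝ) * x ∧ 1 ≤ (k : ℝ) * (L - x)} := by
    intro x hx
    by_contra hcon
    refine hx ?_
    have : (k : ℝ) * x ≤ 1 ∨ (k : ℝ) * (L - x) ≤ 1 := by
      by_contra hh
      push Not at hh
      exact hcon ⟨hh.1.le, hh.2.le⟩
    simp [cutoff_eq_zero this]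
  have hclosed : IsClosed {x : ℝ | 1 ≤ (k : ℝ) * x ∧ 1 ≤ (k : ℝ) * (L - x)} :=
    (isClosed_le (f := fun _ => (1 : ℝ)) (g := fun x => (k : ℝ) * x) (by fun_prop)
      (by fun_prop)).inter (isClosed_le (f := fun _ => (1 : ℝ)) (g := fun x => (k : ℝ) * (L - x))
      (by fun_prop) (by fun_prop))
  have hIoo : {x : ℝ | 1 ≤ (k : ℝ) * x ∧ 1 ≤ (k : ℝ) * (L - x)} ⊆ Ioo 0 L := fun x hx => by
    have hk : (0 : ℝ) ≤ k := k.cast_nonneg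
    have p1 := pos_of_mul_pos_right (lt_of_lt_of_le one_pos hx.1) hk
    have p2 := pos_of_mul_pos_right (lt_of_lt_of_le one_pos hx.2) hk
    exact ⟨p1, by linarith⟩
  let η : TestFn L :=
    { toFun := fun x => ((cutoff L k x * f x : ℝ) : ℂ)
      smooth := Complex.ofRealCLM.contDiff.comp ((contDiff_cutoff L k).mul hf)
      compact := HasCompactSupport.of_support_subset_isCompact
        (isCompact_Icc.of_isClosed_subset hclosed (hIoo.trans Ioo_subset_Icc_self)) hsupp
      supp := (closure_minimal hsupp hclosed).trans hIoo }
  refine Submodule.subset_span ⟨η, Prod.ext rfl ?_⟩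
  change η.memLp_deriv.toLp = (memLp_ofReal L (c2 k)).toLp
  refine MemLp.toLp_congr _ _ (Eventually.of_forall fun x => ?_)
  exact (((hasDerivAt_cutoff L k x).mul (hd x)).ofReal_comp).deriv

/-! ### The Dirichlet Laplacian in the eigenbasis -/

/-- The eigenvalues of `A^{1/2}`. -/
noncomputable def eigFreq (L : ℝ) (n : ℕ) : ℝ := Real.pi / L * (n + 1)

theorem eigFreq_pos {L : ℝ} (hL : 0 < L) (n : ℕ) : 0 < eigFreq L n := by
  have := Real.pi_pos
  unfold eigFreq; positivity

theorem eigFreq_injective {L : ℝ} (hL : 0 < L) : Function.Injective (eigFreq L) := fun m n h => by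
  have h1 : Real.pi / L ≠ 0 := by have := Real.pi_pos; positivity
  have := mul_left_cancel₀ h1 h
  exact_mod_cast add_right_cancel this

theorem sinFn_mem_closure {L : ℝ} (hL : 0 < L) (n : ℕ) :
    (sinFn L n, (eigFreq L n : ℂ) • cosFn L n) ∈ (testGraph L).topologicalClosure := by
  rw [cosFn, ← realL2_const_mul]
  refine realL2_mem_closure hL.le (by fun_prop) _ (fun x => ?_) (by simp) ?_
  · have h1 : HasDerivAt (fun x : ℝ => Real.pi / L * (n + 1) * x) (Real.pi / L * (n + 1)) x := by
      simpa using (hasDerivAt_id x).const_mul (Real.pi / L * (n + 1))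
    refine (h1.sin.const_mul √(2 / L)).congr_deriv ?_
    rw [eigFreq]; ring
  · have : Real.pi / L * (n + 1) * L = ((n + 1 : ℕ) : ℝ) * Real.pi := by push_cast; field_simp
    change √(2 / L) * Real.sin (Real.pi / L * (n + 1) * L) = 0
    rw [this, Real.sin_nat_mul_pi, mul_zero]

theorem cosFn_mem_weakDerivGraph (L : ℝ) (n : ℕ) :
    (cosFn L n, ((-eigFreq L n : ℝ) : ℂ) • sinFn L n) ∈ weakDerivGraph L := by
  rw [sinFn, ← realL2_const_mul]
  refine realL2_mem_weakDerivGraph L _ _ fun x => ?_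
  have h1 : HasDerivAt (fun x : ℝ => Real.pi / L * (n + 1) * x) (Real.pi / L * (n + 1)) x := by
    simpa using (hasDerivAt_id x).const_mul (Real.pi / L * (n + 1))
  refine (h1.cos.const_mul √(2 / L)).congr_deriv ?_
  rw [eigFreq]; ring

theorem inner_cosFn_dx {L : ℝ} (V : H01 L) (n : ℕ) :
    ⟪cosFn L n, H01.dx L V⟫_ℂ = eigFreq L n * ⟪sinFn L n, H01.fn L V⟫_ℂ := by
  have h := V.inner_dx (cosFn_mem_weakDerivGraph L n)
  rw [inner_smul_right, Complex.ofReal_neg, neg_mul, neg_neg] at h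
  rw [← inner_conj_symm, h, map_mul, Complex.conj_ofReal, inner_conj_symm]

/-- The boundary condition is carried by the sines, which lie in H¹₀; p may be any function in H¹,
such as φₓ + ψ. -/
theorem inner_dx_of_mem_weakDerivGraph {L : ℝ} (hL : 0 < L) {p : L2 L × L2 L}
    (hp : p ∈ weakDerivGraph L) (n : ℕ) :
    ⟪sinFn L n, p.2⟫_ℂ = -(eigFreq L n * ⟪cosFn L n, p.1⟫_ℂ) := by
  have h := H01.inner_dx (⟨_, sinFn_mem_closure hL n⟩ : H01 L) hp
  change ⟪(eigFreq L n : ℂ) • cosFn L n, p.1⟫_ℂ = -⟪sinFn L n, p.2⟫_ℂ at h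
  rw [inner_smul_left, Complex.conj_ofReal] at h
  rw [h, neg_neg]

section

variable {L : ℝ} (hL : 0 < L)

/-- The isometry of `L²(0, L)` mapping sines to cosines. -/
noncomputable def sinToCos : L2 L →L[ℂ] L2 L := basisMap (sinBasis hL) (orthonormal_cosFn hL)

/-- The derivative as a bounded operator on `H¹₀`. -/
noncomputable def H01.dxL (L : ℝ) : H01 L →L[ℂ] L2 L :=
  ⟨H01.dx L, continuous_snd.comp continuous_subtype_val⟩

theorem sinToCos_basis (n : ℕ) : sinToCos hL (sinFn L n) = cosFn L n := by
  have h := (hasSum_basisMap (sinBasis hL) (orthonormal_cosFn hL) (sinFn L n)).unique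
    (hasSum_single n fun m hm => ?_)
  · rw [sinToCos, h, sinBasis_apply, inner_sinFn hL, if_pos rfl, one_smul]
  · rw [sinBasis_apply, inner_sinFn hL, if_neg hm, zero_smul]

/-- The operator `A^{1/2}` on `H¹₀`. -/
noncomputable def sqrtAL : H01 L →L[ℂ] L2 L :=
  (ContinuousLinearMap.adjoint (sinToCos hL)) ∘L H01.dxL L

/-- The factorization ∂ₓ = D A^{1/2} with an isometry D gives A^{1/2} = D* ∂ₓ. -/
theorem isDiag_sqrtAL (V : H01 L) : IsDiag (sinBasis hL) (eigFreq L) (H01.fn L V) (sqrtAL hL V) := by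
  intro n
  rw [sqrtAL, ContinuousLinearMap.comp_apply, ContinuousLinearMap.adjoint_inner_right,
    sinBasis_apply, sinToCos_basis]
  exact inner_cosFn_dx V n

theorem sqrtAL_injective : Function.Injective (sqrtAL hL) := by
  refine (injective_iff_map_eq_zero _).2 fun V hV => H01.fn_injective L ?_
  rw [map_zero]
  refine ext_coef (sinBasis hL) fun n => ?_
  have h := isDiag_sqrtAL hL V n
  rw [hV, inner_zero_right] at h
  have h0 : (eigFreq L n : ℂ) ≠ 0 := by exact_mod_cast (eigFreq_pos hL n).ne'
  rw [inner_zero_right]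
  exact (mul_eq_zero.1 h.symm).resolve_left h0

include hL in
theorem inv_eigFreq_le (n : ℕ) : (eigFreq L n)⁻¹ ≤ L / Real.pi := by
  have := Real.pi_pos
  rw [eigFreq, mul_inv, inv_div]
  exact mul_le_of_le_one_right (by positivity) (inv_le_one_of_one_le₀ (by simp))

/-- The sine series of u = A^{-1/2} w and its termwise derivative, the cosine series of D w, both
converge in L². The identity for the derivative is recorded as well: D is not onto (it misses the
constants), so it cannot be recovered from D* ∂ₓ V = w by inverting D*. -/
theorem exists_sqrtAL_eq (w : L2 L) : ∃ V : H01 L, sqrtAL hL V = w ∧ H01.dx L V = sinToCos hL w := by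
  have hν := eigFreq_pos hL
  obtain ⟨u, hu⟩ := exists_isDiag (sinBasis hL) (a := fun n => (eigFreq L n)⁻¹) (u := w) (by
    refine Summable.of_nonneg_of_le (fun n => by positivity) (fun n => ?_)
      ((summable_sq_coef (sinBasis hL) w).mul_left ((L / Real.pi) ^ 2))
    exact mul_le_mul_of_nonneg_right (pow_le_pow_left₀ (inv_nonneg.2 (hν n).le)
      (inv_eigFreq_le hL n) 2) (by positivity))
  have h1 := (sinBasis hL).hasSum_repr u
  have h2 := hasSum_basisMap (sinBasis hL) (orthonormal_cosFn hL) w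
  have h3 : (u, sinToCos hL w) ∈ (testGraph L).topologicalClosure := by
    refine (Submodule.isClosed_topologicalClosure (testGraph L)).mem_of_tendsto (h1.prodMk h2)
      (Eventually.of_forall fun S => Submodule.sum_mem _ fun n _ => ?_)
    have := Submodule.smul_mem _ (⟪sinBasis hL n, u⟫_ℂ) (sinFn_mem_closure hL n)
    convert this using 1
    refine Prod.ext ?_ ?_
    · change (sinBasis hL).repr u n • sinBasis hL n = _
      rw [HilbertBasis.repr_apply_apply, sinBasis_apply]; rfl
    · change _ = ⟪sinBasis hL n, u⟫_ℂ • (eigFreq L n : ℂ) • cosFn L n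
      have h0 : (eigFreq L n : ℂ) ≠ 0 := by exact_mod_cast (hν n).ne'
      rw [hu n, smul_smul, Complex.ofReal_inv, mul_right_comm, inv_mul_cancel₀ h0, one_mul]
  refine ⟨⟨_, h3⟩, ext_coef (sinBasis hL) fun n => (isDiag_sqrtAL hL _ n).trans ?_, rfl⟩
  have h0 : (eigFreq L n : ℂ) ≠ 0 := by exact_mod_cast (hν n).ne'
  change (eigFreq L n : ℂ) * ⟪sinBasis hL n, u⟫_ℂ = _
  rw [hu n, Complex.ofReal_inv, mul_inv_cancel_left₀ h0]

/-- The isomorphism `A^{1/2} : H¹₀ → L²`. -/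
noncomputable def sqrtA : H01 L ≃L[ℂ] L2 L :=
  ContinuousLinearEquiv.ofBijective (sqrtAL hL) (LinearMap.ker_eq_bot.2 (sqrtAL_injective hL))
    (LinearMap.range_eq_top.2 fun w => (exists_sqrtAL_eq hL w).imp fun _ h => h.1)

theorem isDiag_sqrtA (V : H01 L) : IsDiag (sinBasis hL) (eigFreq L) (H01.fn L V) (sqrtA hL V) :=
  isDiag_sqrtAL hL V

theorem dx_eq_sinToCos (V : H01 L) : H01.dx L V = sinToCos hL (sqrtA hL V) := by
  obtain ⟨W, hW, hW'⟩ := exists_sqrtAL_eq hL (sqrtA hL V)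
  rw [← hW', sqrtAL_injective hL hW]

theorem IsDiag.unique_left {H : Type*} [NormedAddCommGroup H] [InnerProductSpace ℂ H]
    {e : HilbertBasis ℕ ℂ H} {a : ℕ → ℝ} {u v w : H} (ha : ∀ n, a n ≠ 0) (hu : IsDiag e a u w)
    (hv : IsDiag e a v w) : u = v := by
  refine ext_coef e fun n => ?_
  have h0 : (a n : ℂ) ≠ 0 := by exact_mod_cast ha n
  exact mul_left_cancel₀ h0 ((hu n).symm.trans (hv n))

theorem mem_h01Space_iff (u : L2 L) : u ∈ h01Space L ↔
    Summable fun n => eigFreq L n ^ 2 * ‖⟪sinBasis hL n, u⟫_ℂ‖ ^ 2 := by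
  constructor
  · rintro ⟨V, rfl⟩
    exact (isDiag_sqrtA hL V).summable
  · intro h
    obtain ⟨w, hw⟩ := exists_isDiag _ h
    refine ⟨(sqrtA hL).symm w, ?_⟩
    have := isDiag_sqrtA hL ((sqrtA hL).symm w)
    rw [ContinuousLinearEquiv.apply_symm_apply] at this
    exact this.unique_left (fun n => (eigFreq_pos hL n).ne') hw

theorem fn_mem_opA_iff (V : H01 L) :
    H01.fn L V ∈ (opA L).domain ↔ H01.dx L V ∈ (weakDeriv L).domain := by
  constructor
  · intro h
    have h' := weakDeriv_mem_of_h2 h.1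
    rwa [weakDeriv_apply_fn] at h'
  · intro h
    refine ⟨⟨⟨H01.fn L V, V.fn_mem⟩, ?_, rfl⟩, V, rfl⟩
    change weakDeriv L ⟨H01.fn L V, V.fn_mem⟩ ∈ (weakDeriv L).domain
    rwa [weakDeriv_apply_fn]

theorem opA_fn (V : H01 L) (h : H01.fn L V ∈ (opA L).domain) :
    opA L ⟨H01.fn L V, h⟩ = -weakDeriv L ⟨H01.dx L V, (fn_mem_opA_iff V).1 h⟩ := by
  change -weakDeriv L ⟨weakDeriv L ⟨H01.fn L V, _⟩, _⟩ = _
  congr 3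
  exact weakDeriv_apply_fn V

theorem weakDeriv_mem (L : ℝ) (u : (weakDeriv L).domain) :
    ((u : L2 L), weakDeriv L u) ∈ weakDerivGraph L := by
  rw [← weakDeriv_graph]; exact LinearPMap.mem_graph _ u

theorem coef_opA (u : (opA L).domain) (n : ℕ) :
    ⟪sinBasis hL n, opA L u⟫_ℂ = ((eigFreq L n ^ 2 : ℝ) : ℂ) * ⟪sinBasis hL n, (u : L2 L)⟫_ℂ := by
  obtain ⟨u, hu⟩ := u
  obtain ⟨V, rfl⟩ := hu.2
  rw [opA_fn, inner_neg_right, sinBasis_apply,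
    inner_dx_of_mem_weakDerivGraph hL (weakDeriv_mem L _), neg_neg]
  change _ * ⟪_, H01.dx L V⟫_ℂ = _
  rw [inner_cosFn_dx]
  push_cast; ring

/-- For the converse, the summability first puts u in H¹₀. The derivative is then a cosine series
whose termwise derivative converges to -w, with w the diagonal image of u, and the graph of the weak
derivative is closed. -/
theorem mem_opA_iff (u : L2 L) : u ∈ (opA L).domain ↔
    Summable fun n => (eigFreq L n ^ 2) ^ 2 * ‖⟪sinBasis hL n, u⟫_ℂ‖ ^ 2 := by
  constructor
  · intro h
    exact IsDiag.summable (w := opA L ⟨u, h⟩) fun n => coef_opA hL ⟨u, h⟩ n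
  · intro h
    have hν := eigFreq_pos hL
    have h1 : u ∈ h01Space L := (mem_h01Space_iff hL u).2 <| by
      refine Summable.of_nonneg_of_le (fun n => by positivity) (fun n => ?_)
        (h.mul_left ((L / Real.pi) ^ 2))
      have h2 : eigFreq L n ≤ L / Real.pi * eigFreq L n ^ 2 := by
        have := mul_le_mul_of_nonneg_right (inv_eigFreq_le hL n) (sq_nonneg (eigFreq L n))
        rwa [sq, inv_mul_cancel_left₀ (hν n).ne', ← sq] at this
      rw [← mul_assoc, ← mul_pow (L / Real.pi)]
      exact mul_le_mul_of_nonneg_right (pow_le_pow_left₀ (hν n).le h2 2) (by positivity)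
    obtain ⟨V, rfl⟩ := h1
    refine (fn_mem_opA_iff V).2 ?_
    obtain ⟨w, hw⟩ := exists_isDiag _ h
    refine LinearPMap.mem_domain_of_mem_graph (y := -w) ?_
    rw [weakDeriv_graph]
    have h1 := hasSum_basisMap (sinBasis hL) (orthonormal_cosFn hL) (sqrtA hL V)
    have h2 := ((sinBasis hL).hasSum_repr w).neg
    refine (isClosed_weakDerivGraph L).mem_of_tendsto ((dx_eq_sinToCos hL V ▸ h1).prodMk h2)
      (Eventually.of_forall fun S => Submodule.sum_mem _ fun n _ => ?_)
    have := Submodule.smul_mem _ (⟪sinBasis hL n, sqrtA hL V⟫_ℂ) (cosFn_mem_weakDerivGraph L n)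
    convert this using 1
    refine Prod.ext rfl ?_
    change -((sinBasis hL).repr w n • sinBasis hL n) = _ • _ • _
    rw [HilbertBasis.repr_apply_apply, hw n, isDiag_sqrtA hL V n, smul_smul, sinBasis_apply,
      ← neg_smul]
    congr 1
    push_cast; ring

/-! ### Powers of `A` -/

theorem mem_graph_opA_iff (u w : L2 L) :
    (u, w) ∈ (opA L).graph ↔ IsDiag (sinBasis hL) (fun n => eigFreq L n ^ 2) u w := by
  rw [LinearPMap.mem_graph_iff]
  constructor
  · rintro ⟨y, rfl, rfl⟩ n
    exact coef_opA hL y n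
  · intro h
    refine ⟨⟨u, (mem_opA_iff hL u).2 h.summable⟩, rfl, ext_coef (sinBasis hL) fun n => ?_⟩
    rw [h n]; exact coef_opA hL _ n

theorem inner_eigenspace_eq_zero {r : ℝ} {n : ℕ} (h : eigFreq L n ^ 2 ≠ r) {u : L2 L}
    (hu : u ∈ eigenspace (opA L) r) : ⟪sinBasis hL n, u⟫_ℂ = 0 := by
  have hK : IsClosed ((innerSL ℂ (sinBasis hL n)).ker : Set (L2 L)) :=
    (innerSL ℂ (sinBasis hL n)).isClosed_ker
  refine Submodule.topologicalClosure_minimal _ (fun v hv => ?_) hK hu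
  have h1 : (v, (r : ℂ) • v) ∈ (opA L).graph := hv
  have h2 := (mem_graph_opA_iff hL _ _).1 h1 n
  rw [inner_smul_right, ← sub_eq_zero, ← sub_mul] at h2
  have h3 : (r : ℂ) - ((eigFreq L n ^ 2 : ℝ) : ℂ) ≠ 0 := by
    rw [sub_ne_zero]; exact_mod_cast h.symm
  exact (mul_eq_zero.1 h2).resolve_left h3

theorem sinBasis_mem_eigenspace (n : ℕ) : sinBasis hL n ∈ eigenspace (opA L) (eigFreq L n ^ 2) := by
  refine Submodule.le_topologicalClosure _ ?_
  change (sinBasis hL n, ((eigFreq L n ^ 2 : ℝ) : ℂ) • sinBasis hL n) ∈ (opA L).graph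
  rw [mem_graph_opA_iff hL]
  intro m
  rw [inner_smul_right, sinBasis_apply, sinBasis_apply, inner_sinFn hL]
  split_ifs with h
  · rw [h]
  · simp

theorem coef_starProjection (r : ℝ) (u : L2 L) (n : ℕ) :
    ⟪sinBasis hL n, (eigenspace (opA L) r).starProjection u⟫_ℂ =
      if eigFreq L n ^ 2 = r then ⟪sinBasis hL n, u⟫_ℂ else 0 := by
  split_ifs with h
  · subst h
    have h1 := Submodule.sub_starProjection_mem_orthogonal
      (K := eigenspace (opA L) (eigFreq L n ^ 2)) u
    have h2 := (Submodule.mem_orthogonal _ _).1 h1 _ (sinBasis_mem_eigenspace hL n)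
    rw [inner_sub_right, sub_eq_zero] at h2
    exact h2.symm
  · exact inner_eigenspace_eq_zero hL h (Submodule.starProjection_apply_mem _ _)

include hL in
theorem sq_eigFreq_rpow (n : ℕ) (s : ℝ) : (eigFreq L n ^ 2) ^ s = eigFreq L n ^ (2 * s) := by
  rw [Real.rpow_mul (eigFreq_pos hL n).le, Real.rpow_two]

/-- Off the eigenvalues the projections vanish and the eigenvalues are simple, so the sum over all
real r is, along the injection n ↦ ω_n², the basis expansion of w. -/
theorem hasSum_opPow {s : ℝ} {u w : L2 L}
    (h : IsDiag (sinBasis hL) (fun n => eigFreq L n ^ (2 * s)) u w) :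
    HasSum (fun r : ℝ => ((r ^ s : ℝ) : ℂ) • (eigenspace (opA L) r).starProjection u) w := by
  have hinj : Function.Injective fun n => eigFreq L n ^ 2 := fun m n hmn =>
    eigFreq_injective hL ((sq_eq_sq₀ (eigFreq_pos hL m).le (eigFreq_pos hL n).le).1 hmn)
  refine (hinj.hasSum_iff fun r hr => ?_).1 ?_
  · have : (eigenspace (opA L) r).starProjection u = 0 := by
      refine ext_coef (sinBasis hL) fun n => ?_
      rw [coef_starProjection, if_neg fun h => hr ⟨n, h⟩, inner_zero_right]
    rw [this, smul_zero]
  · refine ((sinBasis hL).hasSum_repr w).congr_fun fun n => ?_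
    refine ext_coef (sinBasis hL) fun m => ?_
    rw [Function.comp_apply, HilbertBasis.repr_apply_apply, inner_smul_right, inner_smul_right,
      coef_starProjection, h n, sq_eigFreq_rpow hL, sinBasis_apply, sinBasis_apply, inner_sinFn hL]
    by_cases hmn : m = n
    · subst hmn; simp
    · rw [if_neg hmn, if_neg fun h => hmn (hinj h)]; simp

theorem coef_opPow {s : ℝ} (u : (opPow (opA L) s).domain) (n : ℕ) :
    ⟪sinBasis hL n, opPow (opA L) s u⟫_ℂ =
      ((eigFreq L n ^ (2 * s) : ℝ) : ℂ) * ⟪sinBasis hL n, (u : L2 L)⟫_ℂ := by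
  have h1 : HasSum (fun r : ℝ => ((r ^ s : ℝ) : ℂ) • (eigenspace (opA L) r).starProjection (u : L2 L))
    (opPow (opA L) s u) := Summable.hasSum u.2
  refine (h1.mapL (innerSL ℂ (sinBasis hL n))).unique ?_
  convert hasSum_single (eigFreq L n ^ 2) fun r hr => ?_ using 1
  · rw [innerSL_apply_apply, inner_smul_right, coef_starProjection, if_pos rfl, sq_eigFreq_rpow hL]
  · rw [innerSL_apply_apply, inner_smul_right, coef_starProjection, if_neg hr.symm, mul_zero]

theorem mem_opPow_iff (s : ℝ) (u : L2 L) : u ∈ (opPow (opA L) s).domain ↔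
    Summable fun n => (eigFreq L n ^ (2 * s)) ^ 2 * ‖⟪sinBasis hL n, u⟫_ℂ‖ ^ 2 := by
  constructor
  · intro h
    exact IsDiag.summable (w := opPow (opA L) s ⟨u, h⟩) fun n => coef_opPow hL ⟨u, h⟩ n
  · intro h
    obtain ⟨w, hw⟩ := exists_isDiag _ h
    exact (hasSum_opPow hL hw).summable

end

/-! ### The system in coefficients -/

/-- The inclusion `H¹₀ → L²` as a bounded operator. -/
noncomputable def H01.fnL (L : ℝ) : H01 L →L[ℂ] L2 L :=
  ⟨H01.fn L, continuous_fst.comp continuous_subtype_val⟩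

namespace Energy

/-- The positions `φ`, `ψ`, `θ`. -/
noncomputable def pos (L : ℝ) : Fin 3 → Energy L →L[ℂ] H01 L
  | 0 => ⟨phi L, continuous_fst⟩
  | 1 => ⟨psi L, continuous_fst.comp (continuous_snd.comp continuous_snd)⟩
  | 2 => ⟨theta L, continuous_fst.comp (continuous_snd.comp (continuous_snd.comp
      (continuous_snd.comp continuous_snd)))⟩

/-- The velocities `Φ`, `Ψ`, `Θ`. -/
noncomputable def vel (L : ℝ) : Fin 3 → Energy L →L[ℂ] L2 L
  | 0 => ⟨phiT L, continuous_fst.comp continuous_snd⟩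
  | 1 => ⟨psiT L, continuous_fst.comp (continuous_snd.comp (continuous_snd.comp continuous_snd))⟩
  | 2 => ⟨thetaT L, continuous_snd.comp (continuous_snd.comp (continuous_snd.comp
      (continuous_snd.comp continuous_snd)))⟩

theorem ext {L : ℝ} {U V : Energy L} (h : ∀ j, pos L j U = pos L j V)
    (h' : ∀ j, vel L j U = vel L j V) : U = V :=
  Prod.ext (h 0) (Prod.ext (h' 0) (Prod.ext (h 1) (Prod.ext (h' 1) (Prod.ext (h 2) (h' 2)))))

/-- The bounded linear map with the given components. -/
noncomputable def lift {L : ℝ} {X : Type*} [NormedAddCommGroup X] [NormedSpace ℂ X]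
    (f : Fin 3 → X →L[ℂ] H01 L) (g : Fin 3 → X →L[ℂ] L2 L) : X →L[ℂ] Energy L :=
  ⟨ofComponents L (f 0 : X →ₗ[ℂ] H01 L) (g 0 : X →ₗ[ℂ] L2 L) (f 1 : X →ₗ[ℂ] H01 L)
    (g 1 : X →ₗ[ℂ] L2 L) (f 2 : X →ₗ[ℂ] H01 L) (g 2 : X →ₗ[ℂ] L2 L),
    (f 0).continuous.prodMk ((g 0).continuous.prodMk ((f 1).continuous.prodMk
      ((g 1).continuous.prodMk ((f 2).continuous.prodMk (g 2).continuous))))⟩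

theorem pos_lift {L : ℝ} {X : Type*} [NormedAddCommGroup X] [NormedSpace ℂ X]
    (f : Fin 3 → X →L[ℂ] H01 L) (g : Fin 3 → X →L[ℂ] L2 L) (x : X) (j : Fin 3) :
    pos L j (lift f g x) = f j x := by
  fin_cases j <;> rfl

theorem vel_lift {L : ℝ} {X : Type*} [NormedAddCommGroup X] [NormedSpace ℂ X]
    (f : Fin 3 → X →L[ℂ] H01 L) (g : Fin 3 → X →L[ℂ] L2 L) (x : X) (j : Fin 3) :
    vel L j (lift f g x) = g j x := by
  fin_cases j <;> rfl

end Energy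

/-- The coefficients of the system
`p_j'' = -a_j A p_j - c_j A^{s_j} p_j' + ∑ k, d_jk ∂ₓ p_k' + R_j (p, p')`. -/
structure Coeffs where
  a : Fin 3 → ℝ
  c : Fin 3 → ℝ
  s : Fin 3 → ℝ
  w : Fin 3 → ℝ
  d : Fin 3 → Fin 3 → ℝ
  a_pos : ∀ j, 0 < a j
  c_pos : ∀ j, 0 < c j
  w_pos : ∀ j, 0 < w j
  s_nonneg : ∀ j, 0 ≤ s j
  s_le : ∀ j, s j ≤ 1
  symm : ∀ j k, w j * d j k = w k * d k j

namespace Coeffs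

variable (q : Coeffs) {L : ℝ} (hL : 0 < L)

/-- The operator of the system, in the coefficients of the eigenfunctions. -/
structure IsOp (R : Fin 3 → Energy L →L[ℂ] L2 L) (B : Energy L →ₗ.[ℂ] Energy L) : Prop where
  mem_domain : ∀ U, U ∈ B.domain ↔ ∀ j, H01.fn L (Energy.pos L j U) ∈ (opA L).domain ∧
    Energy.vel L j U ∈ h01Space L ∧ Energy.vel L j U ∈ (opPow (opA L) (q.s j)).domain
  pos_apply : ∀ (U : B.domain) (j : Fin 3), H01.fn L (Energy.pos L j (B U)) = Energy.vel L j U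
  coef_vel : ∀ (U : B.domain) (j : Fin 3) (n : ℕ), ⟪sinBasis hL n, Energy.vel L j (B U)⟫_ℂ =
    -(q.a j * ((eigFreq L n ^ 2 : ℝ) * ⟪sinBasis hL n, H01.fn L (Energy.pos L j U)⟫_ℂ))
      - q.c j * ((eigFreq L n ^ (2 * q.s j) : ℝ) * ⟪sinBasis hL n, Energy.vel L j U⟫_ℂ)
      - ∑ k, q.d j k * (eigFreq L n * ⟪cosFn L n, Energy.vel L k U⟫_ℂ)
      + ⟪sinBasis hL n, R j U⟫_ℂ

/-- The weights of the positions. -/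
noncomputable def posWeight (j : Fin 3) : ℂ := ((√(q.w j) * √(q.a j) : ℝ) : ℂ)

/-- The weights of the velocities. -/
noncomputable def velWeight (j : Fin 3) : ℂ := ((√(q.w j) : ℝ) : ℂ)

theorem velWeight_ne_zero (j : Fin 3) : q.velWeight j ≠ 0 :=
  Complex.ofReal_ne_zero.2 (Real.sqrt_pos.2 (q.w_pos j)).ne'

theorem posWeight_ne_zero (j : Fin 3) : q.posWeight j ≠ 0 :=
  Complex.ofReal_ne_zero.2
    (mul_pos (Real.sqrt_pos.2 (q.w_pos j)) (Real.sqrt_pos.2 (q.a_pos j))).ne'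

/-- The isomorphism of the energy space with `L²(0, L)⁶`. -/
noncomputable def equiv : Energy L ≃L[ℂ] PiLp 2 (fun _ : Fin 3 ⊕ Fin 3 => L2 L) :=
  ContinuousLinearEquiv.equivOfInverse
    ((PiLp.continuousLinearEquiv 2 ℂ fun _ : Fin 3 ⊕ Fin 3 => L2 L).symm.toContinuousLinearMap ∘L
      ContinuousLinearMap.pi (Sum.elim
        (fun j => q.posWeight j • (sqrtA hL : H01 L →L[ℂ] L2 L) ∘L Energy.pos L j)
        fun j => q.velWeight j • Energy.vel L j))
    (Energy.lift
      (fun j => (q.posWeight j)⁻¹ • ((sqrtA hL).symm : L2 L →L[ℂ] H01 L) ∘L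
        PiLp.proj (𝕜 := ℂ) 2 (fun _ : Fin 3 ⊕ Fin 3 => L2 L) (Sum.inl j))
      fun j => (q.velWeight j)⁻¹ • PiLp.proj (𝕜 := ℂ) 2 (fun _ : Fin 3 ⊕ Fin 3 => L2 L) (Sum.inr j))
    (fun U => Energy.ext
      (fun j => by
        rw [Energy.pos_lift]
        simp [inv_smul_smul₀ (q.posWeight_ne_zero j)])
      fun j => by
        rw [Energy.vel_lift]
        simp [inv_smul_smul₀ (q.velWeight_ne_zero j)])
    (fun X => PiLp.ext fun i => by
      rcases i with j | j
      · simp [Energy.pos_lift, smul_inv_smul₀ (q.posWeight_ne_zero j)]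
      · simp [Energy.vel_lift, smul_inv_smul₀ (q.velWeight_ne_zero j)])

theorem equiv_inl (U : Energy L) (j : Fin 3) :
    q.equiv hL U (Sum.inl j) = q.posWeight j • sqrtA hL (Energy.pos L j U) := rfl

theorem equiv_inr (U : Energy L) (j : Fin 3) :
    q.equiv hL U (Sum.inr j) = q.velWeight j • Energy.vel L j U := rfl

/-- The system of damped waves to which the system is equivalent. -/
noncomputable def waveData (R : Fin 3 → Energy L →L[ℂ] L2 L) : WaveData (Fin 3) (L2 L) where
  e := sinBasis hL
  f := cosFn L
  freq := Real.pi / L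
  -- The coefficients for x_j = √(w_j a_j) A^{1/2} p_j and v_j = √w_j p_j'. The conjugation by √w
  -- turns d into √w_j d_jk / √w_k, which is symmetric precisely because w_j d_jk is.
  α j := √(q.a j)
  c := q.c
  s := q.s
  ε j k := √(q.w j) * q.d j k / √(q.w k)
  Q j := q.velWeight j • R j ∘L ((q.equiv hL).symm : _ →L[ℂ] Energy L)
  orthonormal := orthonormal_cosFn hL
  freq_pos := div_pos Real.pi_pos hL
  α_pos j := Real.sqrt_pos.2 (q.a_pos j)
  c_pos := q.c_pos
  s_nonneg := q.s_nonneg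
  s_le := q.s_le
  symm j k := by
    have h := fun j => (Real.sqrt_pos.2 (q.w_pos j)).ne'
    have hs := fun j => Real.mul_self_sqrt (q.w_pos j).le
    rw [div_eq_div_iff (h k) (h j), mul_right_comm, hs, mul_right_comm, hs, q.symm]
  skew m n := by
    rw [sinBasis_apply, sinBasis_apply]
    exact inner_cosFn_sinFn hL m n
  decay m n h := by
    rw [sinBasis_apply]
    exact norm_inner_sinFn_cosFn_le hL m n h

variable {q hL} {R : Fin 3 → Energy L →L[ℂ] L2 L} {B : Energy L →ₗ.[ℂ] Energy L}

theorem _root_.Timoshenko.summable_norm_smul_iff {e : ℕ → L2 L} {v : ℂ} (hv : v ≠ 0) {a : ℕ → ℝ}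
    {x : L2 L} : (Summable fun n => a n ^ 2 * ‖⟪e n, v • x⟫_ℂ‖ ^ 2) ↔
      Summable fun n => a n ^ 2 * ‖⟪e n, x⟫_ℂ‖ ^ 2 := by
  simp only [inner_smul_right, norm_mul, mul_pow, mul_left_comm _ (‖v‖ ^ 2)]
  exact summable_mul_left_iff (by simpa using hv)

theorem IsOp.isWaveOp (h : q.IsOp hL R B) :
    (q.waveData hL R).IsWaveOp (conjOp B (q.equiv hL)) := by
  have hpos := fun j => Real.sqrt_pos.2 (q.w_pos j)
  have hom : ∀ n, (q.waveData hL R).om n = eigFreq L n := fun _ => rfl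
  have hdamp : ∀ j n, (q.waveData hL R).damp j n = eigFreq L n ^ (2 * q.s j) := fun _ _ => rfl
  have he : (q.waveData hL R).e = sinBasis hL := rfl
  have hf : (q.waveData hL R).f = cosFn L := rfl
  have hα : ∀ j, (q.waveData hL R).α j = √(q.a j) := fun _ => rfl
  have hc : ∀ j, (q.waveData hL R).c j = q.c j := fun _ => rfl
  have hε : ∀ j k, (q.waveData hL R).ε j k = √(q.w j) * q.d j k / √(q.w k) := fun _ _ => rfl
  have hQ : ∀ j X, (q.waveData hL R).Q j X = q.velWeight j • R j ((q.equiv hL).symm X) :=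
    fun _ _ => rfl
  refine ⟨fun X => ?_, fun X j n => ?_, fun X j n => ?_⟩
  · obtain ⟨U, rfl⟩ := (q.equiv hL).surjective X
    have e1 : q.equiv hL U ∈ (conjOp B (q.equiv hL)).domain ↔ U ∈ B.domain := by
      change (q.equiv hL).symm (q.equiv hL U) ∈ B.domain ↔ _
      rw [ContinuousLinearEquiv.symm_apply_apply]
    rw [e1, h.mem_domain]
    refine forall_congr' fun j => ?_
    simp only [equiv_inl, equiv_inr, hom, hdamp, he]
    rw [summable_norm_smul_iff (q.posWeight_ne_zero j), summable_norm_smul_iff (q.velWeight_ne_zero j),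
      summable_norm_smul_iff (q.velWeight_ne_zero j), mem_opA_iff hL, mem_h01Space_iff hL,
      mem_opPow_iff hL]
    refine and_congr_left fun _ => ?_
    refine summable_congr fun n => ?_
    rw [isDiag_sqrtA hL _ n, norm_mul, Complex.norm_of_nonneg (eigFreq_pos hL n).le]
    ring
  · obtain ⟨U, hU, rfl⟩ : ∃ U, ∃ hU : q.equiv hL U ∈ (conjOp B (q.equiv hL)).domain,
        X = ⟨q.equiv hL U, hU⟩ := by
      obtain ⟨U, hU⟩ := (q.equiv hL).surjective X.1
      exact ⟨U, hU ▸ X.2, Subtype.ext hU.symm⟩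
    have hU' : (q.equiv hL).symm (q.equiv hL U) ∈ B.domain := hU
    rw [conjOp_apply, equiv_inl, he, inner_smul_right, isDiag_sqrtA hL _ n, h.pos_apply, hα, hom,
      equiv_inr, inner_smul_right]
    simp only [ContinuousLinearEquiv.symm_apply_apply]
    rw [posWeight, velWeight]
    push_cast; ring
  · obtain ⟨U, hU, rfl⟩ : ∃ U, ∃ hU : q.equiv hL U ∈ (conjOp B (q.equiv hL)).domain,
        X = ⟨q.equiv hL U, hU⟩ := by
      obtain ⟨U, hU⟩ := (q.equiv hL).surjective X.1
      exact ⟨U, hU ▸ X.2, Subtype.ext hU.symm⟩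
    rw [conjOp_apply, equiv_inr, he, inner_smul_right, h.coef_vel]
    simp only [ContinuousLinearEquiv.symm_apply_apply, hα, hom, hc, hdamp, hε, hf, hQ, equiv_inl,
      equiv_inr, inner_smul_right]
    rw [isDiag_sqrtA hL _ n]
    have h1 : ∀ k, ((√(q.w j) * q.d j k / √(q.w k) : ℝ) : ℂ) *
        ((eigFreq L n : ℂ) * (q.velWeight k * ⟪cosFn L n, Energy.vel L k U⟫_ℂ)) =
        q.velWeight j * (q.d j k * (eigFreq L n * ⟪cosFn L n, Energy.vel L k U⟫_ℂ)) := by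
      intro k
      have := q.velWeight_ne_zero k
      rw [velWeight] at this
      rw [velWeight, velWeight]
      push_cast
      field_simp
    simp only [h1, ← Finset.mul_sum]
    have h2 : ((√(q.a j) : ℝ) : ℂ) * ((√(q.a j) : ℝ) : ℂ) = (q.a j : ℂ) := by
      rw [← Complex.ofReal_mul, Real.mul_self_sqrt (q.a_pos j).le]
    rw [posWeight, velWeight]
    push_cast
    rw [← h2]
    ring

/-- Existence, uniqueness and regularity of weak solutions. -/
theorem IsOp.exists_weakSolution (h : q.IsOp hL R B) (U₀ : Energy L) :
    ∃ U : ℝ → Energy L, IsWeakSolution B U₀ U ∧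
      (∀ V : ℝ → Energy L, IsWeakSolution B U₀ V → EqOn V U (Ici 0)) ∧
      ∀ k : ℕ, U₀ ∈ LinearMap.range (powDomain.incl B k) →
        ∀ j m : ℕ, m + j = k →
          ∃ W : ℝ → powDomain B j,
            ContDiffOn ℝ m W (Ici 0) ∧
            ∀ t ∈ Ici (0 : ℝ), powDomain.incl B j (W t) = U t := by
  have hW := h.isWaveOp
  obtain ⟨S, hS⟩ := hW.isPregenerator.exists_isSolutionOp
  have hS' := hS.of_shiftOp
  refine hS'.of_conjOp.exists_regular (fun x t ht => ?_) U₀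
  have hx : q.equiv hL x ∈ (conjOp B (q.equiv hL)).domain := by
    change (q.equiv hL).symm (q.equiv hL x) ∈ B.domain
    rw [ContinuousLinearEquiv.symm_apply_apply]; exact x.2
  have hg := hW.mem_graph hS' ⟨_, hx⟩ ht
  obtain ⟨y, hy1, hy2⟩ := (LinearPMap.mem_graph_iff _).1 hg
  refine (LinearPMap.mem_graph_iff _).2 ⟨⟨(q.equiv hL).symm y, y.2⟩, ?_, ?_⟩
  · change (q.equiv hL).symm y = _
    rw [hy1]; rfl
  · have h1 : B ⟨(q.equiv hL).symm y, y.2⟩ = (q.equiv hL).symm (conjOp B (q.equiv hL) y) := by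
      rw [conjOp_apply, ContinuousLinearEquiv.symm_apply_apply]
    have h2 : conjOp B (q.equiv hL) ⟨_, hx⟩ = q.equiv hL (B x) := by
      rw [conjOp_apply]
      congr 2
      exact Subtype.ext ((q.equiv hL).symm_apply_apply _)
    rw [h1, hy2, h2]; rfl

end Coeffs

/-! ### The two systems -/

theorem inner_real_smul {L : ℝ} (r : ℝ) (x y : L2 L) : ⟪x, r • y⟫_ℂ = (r : ℂ) * ⟪x, y⟫_ℂ := by
  rw [RCLike.real_smul_eq_coe_smul (K := ℂ), inner_smul_right]; rfl

namespace domB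

variable {L : ℝ} (hL : 0 < L) {τ σ ξ : ℝ}

theorem coef_dx (V : H01 L) (n : ℕ) :
    ⟪sinBasis hL n, H01.dx L V⟫_ℂ = -(eigFreq L n * ⟪cosFn L n, H01.fn L V⟫_ℂ) := by
  rw [sinBasis_apply]
  exact inner_dx_of_mem_weakDerivGraph hL V.mem_weakDerivGraph n

/-- φₓ + ψ satisfies no boundary condition; testing with sines still splits its derivative into -A
φ, the elastic term, and ψₓ, which is bounded in the energy norm. -/
theorem coef_shearX (U : domB L τ σ ξ) (n : ℕ) : ⟪sinBasis hL n, shearX L τ σ ξ U⟫_ℂ =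
    -((eigFreq L n ^ 2 : ℝ) * ⟪sinBasis hL n, H01.fn L (phi L τ σ ξ U)⟫_ℂ) +
      ⟪sinBasis hL n, H01.dx L (psi L τ σ ξ U)⟫_ℂ := by
  have h := inner_dx_of_mem_weakDerivGraph hL
    (weakDeriv_mem L ⟨shear L τ σ ξ U, shear_mem L τ σ ξ U⟩) n
  change ⟪sinFn L n, shearX L τ σ ξ U⟫_ℂ = -(_ * ⟪cosFn L n,
    H01.dx L (phi L τ σ ξ U) + H01.fn L (psi L τ σ ξ U)⟫_ℂ) at h
  rw [coef_dx, sinBasis_apply, h, inner_add_right, inner_cosFn_dx]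
  push_cast; ring

theorem coef_dx_liftH01 (u : h01Space L) (n : ℕ) : ⟪sinBasis hL n, H01.dx L (liftH01 L u)⟫_ℂ =
    -(eigFreq L n * ⟪cosFn L n, (u : L2 L)⟫_ℂ) := by
  rw [coef_dx, fn_liftH01]

theorem coef_phiTX (U : domB L τ σ ξ) (n : ℕ) : ⟪sinBasis hL n, phiTX L τ σ ξ U⟫_ℂ =
    -(eigFreq L n * ⟪cosFn L n, Energy.phiT L U⟫_ℂ) := coef_dx_liftH01 hL _ n

theorem coef_psiTX (U : domB L τ σ ξ) (n : ℕ) : ⟪sinBasis hL n, psiTX L τ σ ξ U⟫_ℂ =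
    -(eigFreq L n * ⟪cosFn L n, Energy.psiT L U⟫_ℂ) := coef_dx_liftH01 hL _ n

theorem coef_thetaTX (U : domB L τ σ ξ) (n : ℕ) : ⟪sinBasis hL n, thetaTX L τ σ ξ U⟫_ℂ =
    -(eigFreq L n * ⟪cosFn L n, Energy.thetaT L U⟫_ℂ) := coef_dx_liftH01 hL _ n

theorem coef_aPsi (U : domB L τ σ ξ) (n : ℕ) : ⟪sinBasis hL n, aPsi L τ σ ξ U⟫_ℂ =
    (eigFreq L n ^ 2 : ℝ) * ⟪sinBasis hL n, H01.fn L (psi L τ σ ξ U)⟫_ℂ := coef_opA hL _ n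

theorem coef_aTheta (U : domB L τ σ ξ) (n : ℕ) : ⟪sinBasis hL n, aTheta L τ σ ξ U⟫_ℂ =
    (eigFreq L n ^ 2 : ℝ) * ⟪sinBasis hL n, H01.fn L (theta L τ σ ξ U)⟫_ℂ := coef_opA hL _ n

theorem coef_powPhiT (U : domB L τ σ ξ) (n : ℕ) : ⟪sinBasis hL n, powPhiT L τ σ ξ U⟫_ℂ =
    (eigFreq L n ^ (2 * τ) : ℝ) * ⟪sinBasis hL n, Energy.phiT L U⟫_ℂ := coef_opPow hL _ n

theorem coef_powPsiT (U : domB L τ σ ξ) (n : ℕ) : ⟪sinBasis hL n, powPsiT L τ σ ξ U⟫_ℂ =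
    (eigFreq L n ^ (2 * σ) : ℝ) * ⟪sinBasis hL n, Energy.psiT L U⟫_ℂ := coef_opPow hL _ n

theorem coef_powThetaT (U : domB L τ σ ξ) (n : ℕ) : ⟪sinBasis hL n, powThetaT L τ σ ξ U⟫_ℂ =
    (eigFreq L n ^ (2 * ξ) : ℝ) * ⟪sinBasis hL n, Energy.thetaT L U⟫_ℂ := coef_opPow hL _ n

theorem mem_iff (U : Energy L) : U ∈ domB L τ σ ξ ↔
    ∀ j, H01.fn L (Energy.pos L j U) ∈ (opA L).domain ∧ Energy.vel L j U ∈ h01Space L ∧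
      Energy.vel L j U ∈ (opPow (opA L) (![τ, σ, ξ] j)).domain := by
  constructor
  · rintro ⟨⟨⟨⟨⟨h1, h2⟩, h3⟩, h4⟩, h5⟩, h6⟩ j
    match j with
    | 0 => exact ⟨h1, h2.1, h2.2⟩
    | 1 => exact ⟨h3, h4.1, h4.2⟩
    | 2 => exact ⟨h5, h6.1, h6.2⟩
  · intro h
    exact ⟨⟨⟨⟨⟨(h 0).1, (h 0).2⟩, (h 1).1⟩, (h 1).2⟩, (h 2).1⟩, (h 2).2⟩

end domB

open domB

variable {L ρ₁ ρ₂ ρ₃ κ b δ β γ μ μ₁ μ₂ K τ σ ξ : ℝ}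

/-- The coefficients of the first system. -/
noncomputable def coeffs₁ (hρ₁ : 0 < ρ₁) (hρ₂ : 0 < ρ₂) (hρ₃ : 0 < ρ₃) (hκ : 0 < κ) (hb : 0 < b)
    (hδ : 0 < δ) (hβ : 0 < β) (hγ : 0 < γ) (hμ₁ : 0 < μ₁) (hμ₂ : 0 < μ₂) (hK : 0 < K)
    (hτ : τ ∈ Icc (0 : ℝ) 1) (hσ : σ ∈ Icc (0 : ℝ) 1) (hξ : ξ ∈ Icc (0 : ℝ) 1) : Coeffs where
  a := ![κ / ρ₁, b / ρ₂, δ / ρ₃]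
  c := ![μ₁ / ρ₁, μ₂ / ρ₂, K / ρ₃]
  s := ![τ, σ, ξ]
  -- Chosen so that both weighted coupling entries between Ψ and Θ equal -1; φ has no velocity
  -- coupling, so its weight is free.
  w := ![1, ρ₂ / β, ρ₃ / γ]
  d := ![![0, 0, 0], ![0, 0, -(β / ρ₂)], ![0, -(γ / ρ₃), 0]]
  a_pos j := by fin_cases j; exacts [div_pos hκ hρ₁, div_pos hb hρ₂, div_pos hδ hρ₃]
  c_pos j := by fin_cases j; exacts [div_pos hμ₁ hρ₁, div_pos hμ₂ hρ₂, div_pos hK hρ₃]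
  w_pos j := by fin_cases j; exacts [one_pos, div_pos hρ₂ hβ, div_pos hρ₃ hγ]
  s_nonneg j := by fin_cases j; exacts [hτ.1, hσ.1, hξ.1]
  s_le j := by fin_cases j; exacts [hτ.2, hσ.2, hξ.2]
  symm j k := by
    have h2 := hρ₂.ne'
    have h3 := hρ₃.ne'
    have h4 := hβ.ne'
    have h5 := hγ.ne'
    fin_cases j <;> fin_cases k <;> simp <;> field_simp

/-- The coefficients of the second system. -/
noncomputable def coeffs₂ (μ : ℝ) (hρ₁ : 0 < ρ₁) (hρ₂ : 0 < ρ₂) (hρ₃ : 0 < ρ₃) (hκ : 0 < κ)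
    (hb : 0 < b) (hδ : 0 < δ) (hγ : 0 < γ) (hμ₁ : 0 < μ₁) (hμ₂ : 0 < μ₂)
    (hτ : τ ∈ Icc (0 : ℝ) 1) (hσ : σ ∈ Icc (0 : ℝ) 1) (hξ : ξ ∈ Icc (0 : ℝ) 1) : Coeffs where
  a := ![κ / ρ₁, b / ρ₂, δ / ρ₃]
  c := ![μ₁ / ρ₁, μ₂ / ρ₂, γ / ρ₃]
  s := ![τ, σ, ξ]
  -- Both weighted coupling entries between Φ and Θ become -μ, whatever the sign of μ; the middle
  -- weight is free.
  w := ![ρ₁, 1, ρ₃]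
  d := ![![0, 0, -(μ / ρ₁)], ![0, 0, 0], ![-(μ / ρ₃), 0, 0]]
  a_pos j := by fin_cases j; exacts [div_pos hκ hρ₁, div_pos hb hρ₂, div_pos hδ hρ₃]
  c_pos j := by fin_cases j; exacts [div_pos hμ₁ hρ₁, div_pos hμ₂ hρ₂, div_pos hγ hρ₃]
  w_pos j := by fin_cases j; exacts [hρ₁, one_pos, hρ₃]
  s_nonneg j := by fin_cases j; exacts [hτ.1, hσ.1, hξ.1]
  s_le j := by fin_cases j; exacts [hτ.2, hσ.2, hξ.2]
  symm j k := by
    have h1 := hρ₁.ne'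
    have h3 := hρ₃.ne'
    fin_cases j <;> fin_cases k <;> simp <;> field_simp

/-- The bounded terms of the first system. -/
noncomputable def lowerOrder₁ (L ρ₁ ρ₂ κ : ℝ) : Fin 3 → Energy L →L[ℂ] L2 L
  -- First derivatives of positions are bounded, since positions are measured in H¹₀; no symmetry is
  -- required of these terms.
  | 0 => ((κ / ρ₁ : ℝ) : ℂ) • H01.dxL L ∘L Energy.pos L 1
  | 1 => ((-(κ / ρ₂) : ℝ) : ℂ) • (H01.dxL L ∘L Energy.pos L 0 + H01.fnL L ∘L Energy.pos L 1)
  | 2 => 0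

/-- The bounded terms of the second system. -/
noncomputable def lowerOrder₂ (L ρ₁ ρ₂ ρ₃ κ μ : ℝ) : Fin 3 → Energy L →L[ℂ] L2 L
  | 0 => ((κ / ρ₁ : ℝ) : ℂ) • H01.dxL L ∘L Energy.pos L 1
  | 1 => ((-(κ / ρ₂) : ℝ) : ℂ) • (H01.dxL L ∘L Energy.pos L 0 + H01.fnL L ∘L Energy.pos L 1) +
      ((μ / ρ₂ : ℝ) : ℂ) • Energy.vel L 2
  | 2 => ((-(μ / ρ₃) : ℝ) : ℂ) • Energy.vel L 1

theorem isOp_opB₁ (hL : 0 < L) (hρ₁ : 0 < ρ₁) (hρ₂ : 0 < ρ₂) (hρ₃ : 0 < ρ₃) (hκ : 0 < κ) (hb : 0 < b)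
    (hδ : 0 < δ) (hβ : 0 < β) (hγ : 0 < γ) (hμ₁ : 0 < μ₁) (hμ₂ : 0 < μ₂) (hK : 0 < K)
    (hτ : τ ∈ Icc (0 : ℝ) 1) (hσ : σ ∈ Icc (0 : ℝ) 1) (hξ : ξ ∈ Icc (0 : ℝ) 1) :
    (coeffs₁ hρ₁ hρ₂ hρ₃ hκ hb hδ hβ hγ hμ₁ hμ₂ hK hτ hσ hξ).IsOp hL (lowerOrder₁ L ρ₁ ρ₂ κ)
      (opB₁ L ρ₁ ρ₂ ρ₃ κ b δ β γ μ₁ μ₂ K τ σ ξ) := by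
  refine ⟨fun U => mem_iff U, fun U j => ?_, fun (U : domB L τ σ ξ) j n => ?_⟩
  · match j with
    | 0 => exact fn_liftH01 L _
    | 1 => exact fn_liftH01 L _
    | 2 => exact fn_liftH01 L _
  · rw [Fin.sum_univ_three]
    match j with
    | 0 =>
      change ⟪_, (1 / ρ₁) • (κ • shearX L τ σ ξ U - μ₁ • powPhiT L τ σ ξ U)⟫_ℂ =
        -(((κ / ρ₁ : ℝ) : ℂ) * (_ * ⟪_, H01.fn L (phi L τ σ ξ U)⟫_ℂ)) - ((μ₁ / ρ₁ : ℝ) : ℂ) *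
            ((eigFreq L n ^ (2 * τ) : ℝ) * ⟪_, Energy.phiT L U⟫_ℂ)
          - (((0 : ℝ) : ℂ) * _ + ((0 : ℝ) : ℂ) * _ + ((0 : ℝ) : ℂ) * _)
          + ⟪_, ((κ / ρ₁ : ℝ) : ℂ) • H01.dx L (psi L τ σ ξ U)⟫_ℂ
      simp only [inner_sub_right, inner_real_smul, inner_smul_right, coef_shearX, coef_powPhiT]
      push_cast; ring
    | 1 =>
      change ⟪_, -((1 / ρ₂) • (b • aPsi L τ σ ξ U + κ • shear L τ σ ξ U + β • thetaTX L τ σ ξ U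
        + μ₂ • powPsiT L τ σ ξ U))⟫_ℂ =
        -(((b / ρ₂ : ℝ) : ℂ) * (_ * ⟪_, H01.fn L (psi L τ σ ξ U)⟫_ℂ))
          - ((μ₂ / ρ₂ : ℝ) : ℂ) *
            ((eigFreq L n ^ (2 * σ) : ℝ) * ⟪_, Energy.psiT L U⟫_ℂ)
          - (((0 : ℝ) : ℂ) * _ + ((0 : ℝ) : ℂ) * _
            + ((-(β / ρ₂) : ℝ) : ℂ) * (_ * ⟪_, Energy.thetaT L U⟫_ℂ))
          + ⟪_, ((-(κ / ρ₂) : ℝ) : ℂ) • shear L τ σ ξ U⟫_ℂ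
      simp only [inner_neg_right, inner_add_right, inner_real_smul, inner_smul_right, coef_aPsi,
        coef_powPsiT, coef_thetaTX]
      push_cast; ring
    | 2 =>
      change ⟪_, -((1 / ρ₃) • (δ • aTheta L τ σ ξ U + γ • psiTX L τ σ ξ U
        + K • powThetaT L τ σ ξ U))⟫_ℂ =
        -(((δ / ρ₃ : ℝ) : ℂ) * (_ * ⟪_, H01.fn L (theta L τ σ ξ U)⟫_ℂ))
          - ((K / ρ₃ : ℝ) : ℂ) *
            ((eigFreq L n ^ (2 * ξ) : ℝ) * ⟪_, Energy.thetaT L U⟫_ℂ)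
          - (((0 : ℝ) : ℂ) * _ + ((-(γ / ρ₃) : ℝ) : ℂ) * (_ * ⟪_, Energy.psiT L U⟫_ℂ)
            + ((0 : ℝ) : ℂ) * _) + ⟪_, (0 : L2 L)⟫_ℂ
      simp only [inner_neg_right, inner_add_right, inner_real_smul, inner_zero_right, coef_aTheta,
        coef_powThetaT, coef_psiTX]
      push_cast; ring

theorem isOp_opB₂ (hL : 0 < L) (hρ₁ : 0 < ρ₁) (hρ₂ : 0 < ρ₂) (hρ₃ : 0 < ρ₃) (hκ : 0 < κ) (hb : 0 < b)
    (hδ : 0 < δ) (hγ : 0 < γ) (hμ₁ : 0 < μ₁) (hμ₂ : 0 < μ₂)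
    (hτ : τ ∈ Icc (0 : ℝ) 1) (hσ : σ ∈ Icc (0 : ℝ) 1) (hξ : ξ ∈ Icc (0 : ℝ) 1) :
    (coeffs₂ μ hρ₁ hρ₂ hρ₃ hκ hb hδ hγ hμ₁ hμ₂ hτ hσ hξ).IsOp hL (lowerOrder₂ L ρ₁ ρ₂ ρ₃ κ μ)
      (opB₂ L ρ₁ ρ₂ ρ₃ κ b δ μ γ μ₁ μ₂ τ σ ξ) := by
  refine ⟨fun U => mem_iff U, fun U j => ?_, fun (U : domB L τ σ ξ) j n => ?_⟩
  · match j with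
    | 0 => exact fn_liftH01 L _
    | 1 => exact fn_liftH01 L _
    | 2 => exact fn_liftH01 L _
  · rw [Fin.sum_univ_three]
    match j with
    | 0 =>
      change ⟪_, (1 / ρ₁) • (κ • shearX L τ σ ξ U - μ • thetaTX L τ σ ξ U
        - μ₁ • powPhiT L τ σ ξ U)⟫_ℂ =
        -(((κ / ρ₁ : ℝ) : ℂ) * (_ * ⟪_, H01.fn L (phi L τ σ ξ U)⟫_ℂ)) - ((μ₁ / ρ₁ : ℝ) : ℂ) *
            ((eigFreq L n ^ (2 * τ) : ℝ) * ⟪_, Energy.phiT L U⟫_ℂ)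
          - (((0 : ℝ) : ℂ) * _ + ((0 : ℝ) : ℂ) * _
            + ((-(μ / ρ₁) : ℝ) : ℂ) * (_ * ⟪_, Energy.thetaT L U⟫_ℂ))
          + ⟪_, ((κ / ρ₁ : ℝ) : ℂ) • H01.dx L (psi L τ σ ξ U)⟫_ℂ
      simp only [inner_sub_right, inner_real_smul, inner_smul_right, coef_shearX, coef_powPhiT,
        coef_thetaTX]
      push_cast; ring
    | 1 =>
      change ⟪_, (1 / ρ₂) • (-(b • aPsi L τ σ ξ U) - κ • shear L τ σ ξ U + μ • Energy.thetaT L U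
        - μ₂ • powPsiT L τ σ ξ U)⟫_ℂ =
        -(((b / ρ₂ : ℝ) : ℂ) * (_ * ⟪_, H01.fn L (psi L τ σ ξ U)⟫_ℂ))
          - ((μ₂ / ρ₂ : ℝ) : ℂ) *
            ((eigFreq L n ^ (2 * σ) : ℝ) * ⟪_, Energy.psiT L U⟫_ℂ)
          - (((0 : ℝ) : ℂ) * _ + ((0 : ℝ) : ℂ) * _ + ((0 : ℝ) : ℂ) * _)
          + ⟪_, ((-(κ / ρ₂) : ℝ) : ℂ) • shear L τ σ ξ U
            + ((μ / ρ₂ : ℝ) : ℂ) • Energy.thetaT L U⟫_ℂ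
      simp only [inner_neg_right, inner_sub_right, inner_add_right, inner_real_smul,
        inner_smul_right, coef_aPsi, coef_powPsiT]
      push_cast; ring
    | 2 =>
      change ⟪_, (1 / ρ₃) • (-(δ • aTheta L τ σ ξ U) - μ • (phiTX L τ σ ξ U + Energy.psiT L U)
        - γ • powThetaT L τ σ ξ U)⟫_ℂ =
        -(((δ / ρ₃ : ℝ) : ℂ) * (_ * ⟪_, H01.fn L (theta L τ σ ξ U)⟫_ℂ))
          - ((γ / ρ₃ : ℝ) : ℂ) *
            ((eigFreq L n ^ (2 * ξ) : ℝ) * ⟪_, Energy.thetaT L U⟫_ℂ)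
          - (((-(μ / ρ₃) : ℝ) : ℂ) * (_ * ⟪_, Energy.phiT L U⟫_ℂ) + ((0 : ℝ) : ℂ) * _
            + ((0 : ℝ) : ℂ) * _) + ⟪_, ((-(μ / ρ₃) : ℝ) : ℂ) • Energy.psiT L U⟫_ℂ
      simp only [inner_neg_right, inner_sub_right, inner_add_right, inner_real_smul,
        inner_smul_right, coef_aTheta, coef_powThetaT, coef_phiTX]
      push_cast; ring

end Timoshenko

theorem theorem2
    (L ρ₁ ρ₂ ρ₃ κ b δ β γ μ μ₁ μ₂ K τ σ ξ : ℝ)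
    (hL : 0 < L) (hρ₁ : 0 < ρ₁) (hρ₂ : 0 < ρ₂) (hρ₃ : 0 < ρ₃) (hκ : 0 < κ) (hb : 0 < b)
    (hδ : 0 < δ) (hβ : 0 < β) (hγ : 0 < γ) (hμ₁ : 0 < μ₁) (hμ₂ : 0 < μ₂) (hK : 0 < K)
    (hτ : τ ∈ Set.Icc (0 : ℝ) 1) (hσ : σ ∈ Set.Icc (0 : ℝ) 1) (hξ : ξ ∈ Set.Icc (0 : ℝ) 1)
    (B : Timoshenko.Energy L →ₗ.[ℂ] Timoshenko.Energy L)
    (hB : B = Timoshenko.opB₁ L ρ₁ ρ₂ ρ₃ κ b δ β γ μ₁ μ₂ K τ σ ξ ∨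
      B = Timoshenko.opB₂ L ρ₁ ρ₂ ρ₃ κ b δ μ γ μ₁ μ₂ τ σ ξ)
    (U₀ : Timoshenko.Energy L) :
    ∃ U : ℝ → Timoshenko.Energy L,
      Timoshenko.IsWeakSolution B U₀ U ∧
      (∀ V : ℝ → Timoshenko.Energy L, Timoshenko.IsWeakSolution B U₀ V →
        Set.EqOn V U (Set.Ici 0)) ∧
      ∀ k : ℕ, U₀ ∈ LinearMap.range (Timoshenko.powDomain.incl B k) →
        ∀ j m : ℕ, m + j = k →
          ∃ W : ℝ → Timoshenko.powDomain B j,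
            ContDiffOn ℝ m W (Set.Ici 0) ∧
            ∀ t ∈ Set.Ici (0 : ℝ), Timoshenko.powDomain.incl B j (W t) = U t := by
  rcases hB with rfl | rfl
  · exact (Timoshenko.isOp_opB₁ hL hρ₁ hρ₂ hρ₃ hκ hb hδ hβ hγ hμ₁ hμ₂ hK hτ hσ
      hξ).exists_weakSolution U₀
  · exact (Timoshenko.isOp_opB₂ hL hρ₁ hρ₂ hρ₃ hκ hb hδ hγ hμ₁ hμ₂ hτ hσ hξ).exists_weakSolution U₀
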